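/- **Setting.** A database schema consists of finitely many table names, each with an arity $n$ and a primary key formed by its first $k\le n$ attributes. A database $\mathbf{db}$ is a finite set of facts $R(\vec t)$; its size $N$ is the number of its facts. A *block* is a maximal set of facts of one table that agree on the primary key, and a *repair* of $\mathbf{db}$ selects exactly one fact from each block. A Boolean conjunctive query (BCQ) $q$ is a finite set of atoms $R(\underline{\vec x},\vec y)$ over variables and constants, with the primary key underlined, $\mathrm{key}(R)=\mathrm{vars}(\vec x)$; it is *self-join-free* if no table name occurs twice, and atoms are then denoted by their table names. $\mathsf{CQA}(q)$ asks whether every repair of the input database satisfies $q$; the query is fixed (data complexity). A *join tree* of $q$ is a tree $\tau$ on the atoms of $q$ such that the variables common to two atoms occur in all atoms on the path between them; $q$ is *acyclic* if it has one. For a subtree $\tau'$ of $\tau$ let $q_{\tau'}$ be the query formed by the nodes of $\tau'$. For $F\in q_{\tau'}$ let $F^{+}$ be the set of variables functionally determined by $\mathrm{key}(F)$ with respect to the dependencies $\mathrm{key}(G)\to\mathrm{vars}(G)$, $G\in q_{\tau'}\setminus\{F\}$. The atom $F$ *attacks* $G\neq F$ in $q_{\tau'}$ if any two adjacent atoms on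 the path from $F$ to $G$ in $\tau'$ share a variable not in $F^{+}$. The rooted tree $(\tau,R)$ is a *pair-pruning join tree* (PPJT) of $q$ if for each rooted subtree $(\tau',R')$ of $(\tau,R)$ no atom attacks $R'$ in $q_{\tau'}$. **Rewriting.** For a rooted join tree $(\tau,R_0)$ of $q$, let $P_{\tau,R_0}$ be the set of the following rules, for all atoms $R(\underline{x_1,\dots,x_k},x_{k+1},\dots,x_n)$ of $q$, where the $z_i$ are fresh distinct variables. 1. If $x_i$ is a constant $c$: $\;R_{\mathsf{fkey}}(z_1,\dots,z_k)\leftarrow R(z_1,\dots,z_n),\,z_i\ne c$. If $x_i=x_j$ is a variable and $j<i$: $\;R_{\mathsf{fkey}}(z_1,\dots,z_k)\leftarrow R(z_1,\dots,z_n),\,z_i\neq z_j$. 2. If $R$ has a parent $T$, $i>k$ and $x_i$ is a variable that occurs in $T$: $\;R_{\mathsf{fkey}}(x_1,\dots,x_k)\leftarrow R(x_1,\dots,x_n),\,R(x_1,\dots,x_k,z_{k+1},\dots,z_n),\,z_i\neq x_i$. 3. For each child $S$ of $R$: $\;R_{\mathsf{fkey}}(x_1,\dots,x_k)\leftarrow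 R(x_1,\dots,x_n),\,\neg S_{\mathsf{join}}(\vec w)$, where $\vec w$ lists the variables common to $R$ and $S$. 4. $R_{\mathsf{join}}(\vec w)\leftarrow R(x_1,\dots,x_n),\,\neg R_{\mathsf{fkey}}(x_1,\dots,x_k)$, where $\vec w$ lists the variables common to $R$ and its parent and is empty if $R=R_0$; the negated atom is omitted if no rule has $R_{\mathsf{fkey}}$ in its head. **Theorem.** Let $q$ be an acyclic self-join-free BCQ that has a PPJT $(\tau,R_0)$. Then: (a) $P_{\tau,R_0}$ is a non-recursive Datalog program with negation (a finite set of safe rules whose derived predicates can be ranked so that every rule body uses only derived predicates of smaller rank than the head); (b) for every database $\mathbf{db}$, evaluating $P_{\tau,R_0}$ on $\mathbf{db}$ derives the fact $(R_0)_{\mathsf{join}}()$ if and only if every repair of $\mathbf{db}$ satisfies $q$; (c) $\mathsf{CQA}(q)$ can be decided in time $O(N)$: there are a program of a unit-cost random-access machine (with successor as its only arithmetic operation, equality and order tests, and indirectly addressed memory arrays) and a constant $C$, both depending only on the schema and $q$, such that on every database of size $N$, given as a list of the rows of each table in any order, one constant per memory cell, the program halts within $C\cdot(N+1)$ steps with the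 correct answer. -/

import Mathlib

/-! ### Schemas, databases, repairs -/

/-- A database schema: finitely many table names, each with an arity; the primary key of a table
consists of its first `keyLen` attributes. -/
structure Schema where
  numRel : ℕ
  arity : Fin numRel → ℕ
  keyLen : Fin numRel → ℕ
  keyLen_le : ∀ r, keyLen r ≤ arity r

/-- A table name of the schema. -/
abbrev Schema.Rel (S : Schema) : Type := Fin S.numRel

/-- A fact `R(t)`. Constants are natural numbers. -/
structure DBFact (S : Schema) where
  rel : S.Rel
  val : Fin (S.arity rel) → ℕ

/-- A database instance, as a finite set of facts. -/
abbrev Database (S : Schema) : Type := Finset (DBFact S)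

/-- The primary-key value of a fact. -/
def DBFact.key {S : Schema} (f : DBFact S) : List ℕ :=
  (List.ofFn f.val).take (S.keyLen f.rel)

/-- Two facts are key-equal if they belong to the same block. -/
def DBFact.KeyEq {S : Schema} (f g : DBFact S) : Prop :=
  f.rel = g.rel ∧ f.key = g.key

/-- A repair selects exactly one fact from each block. -/
def IsRepair {S : Schema} (db r : Database S) : Prop :=
  r ⊆ db ∧ ∀ f ∈ db, ∃! g, g ∈ r ∧ f.KeyEq g

/-! ### Conjunctive queries -/

/-- A term is a variable or a constant. -/
inductive Term (V : Type) where
  | var (v : V)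
  | const (c : ℕ)

namespace Term

def vars {V : Type} : Term V → Finset V
  | var v => {v}
  | const _ => ∅

def eval {V : Type} (ν : V → ℕ) : Term V → ℕ
  | var v => ν v
  | const c => c

def map {V W : Type} (f : V → W) : Term V → Term W
  | var v => var (f v)
  | const c => const c

end Term

/-- An atom `R(x₁, …, xₙ)`; query variables are named by natural numbers. -/
structure Atom (S : Schema) where
  rel : S.Rel
  args : Fin (S.arity rel) → Term ℕ

namespace Atom

variable {S : Schema}

/-- All variables of the atom. -/
def vars (a : Atom S) : Finset ℕ :=
  Finset.univ.biUnion fun i => (a.args i).vars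

/-- The variables that occur in primary-key positions. -/
def keyVars (a : Atom S) : Finset ℕ :=
  (Finset.univ.filter fun i : Fin (S.arity a.rel) => i.val < S.keyLen a.rel).biUnion
    fun i => (a.args i).vars

/-- The fact obtained from an atom by a valuation of the variables. -/
def inst (a : Atom S) (ν : ℕ → ℕ) : DBFact S := ⟨a.rel, fun i => (a.args i).eval ν⟩

end Atom

/-- A Boolean conjunctive query, given by the finite set of its atoms. -/
abbrev BCQ (S : Schema) : Type := Finset (Atom S)

namespace BCQ

variable {S : Schema}

/-- No table name occurs in two distinct atoms. -/
def SelfJoinFree (q : BCQ S) : Prop := ∀ a ∈ q, ∀ b ∈ q, a.rel = b.rel → a = b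

/-- `q` evaluates to true on `db`. -/
def Holds (q : BCQ S) (db : Database S) : Prop :=
  ∃ ν : ℕ → ℕ, ∀ a ∈ q, a.inst ν ∈ db

/-- `db` is a yes-instance of `CQA(q)`: the query is true in every repair of `db`. -/
def Certain (q : BCQ S) (db : Database S) : Prop :=
  ∀ r : Database S, IsRepair db r → q.Holds r

/-! ### Join trees, attacks, pair-pruning join trees -/

/-- `τ` is a join tree: a tree on the atoms of `q` such that any variable common to two atoms
occurs in every atom on the path between them. A query is acyclic if it has a join tree. -/
def IsJoinTree (q : BCQ S) (τ : SimpleGraph q) : Prop :=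
  τ.IsTree ∧ ∀ (F G : q) (p : τ.Walk F G), p.IsPath →
    ∀ H ∈ p.support, F.1.vars ∩ G.1.vars ⊆ H.1.vars

/-- The nodes of the subtree rooted at `R'` of the rooted tree `(τ, R)`: all nodes `G` such that
`R'` is on the path from `R` to `G`. -/
def subtree {q : BCQ S} (τ : SimpleGraph q) (R R' : q) : Set q :=
  {G | ∃ p : τ.Walk R G, p.IsPath ∧ R' ∈ p.support}

/-- In the rooted tree `(τ, R)`, the node `T` is the parent of the node `G`. -/
def IsParent {q : BCQ S} (τ : SimpleGraph q) (R T G : q) : Prop :=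
  τ.Adj T G ∧ G ∈ subtree τ R T

/-- For a set `W` of atoms and `F ∈ W`: the variables that are functionally determined by
`key(F)` with respect to the dependencies `key(G) → vars(G)`, for `G ∈ W` other than `F`. -/
inductive KeyClosure {q : BCQ S} (W : Set q) (F : q) : ℕ → Prop
  | key (v : ℕ) : v ∈ F.1.keyVars → KeyClosure W F v
  | step (G : q) (v : ℕ) : G ∈ W → G ≠ F → (∀ u ∈ G.1.keyVars, KeyClosure W F u) →
      v ∈ G.1.vars → KeyClosure W F v

/-- For the node set `W` of a subtree `τ'` of a join tree `τ`: the atom `F` attacks `G` in the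
attack graph of the subquery with set of atoms `W`, i.e., `F ≠ G` and any two adjacent atoms on
the path from `F` to `G` in `τ'` share a variable outside the key closure of `F` in `W`. -/
def Attacks {q : BCQ S} (τ : SimpleGraph q) (W : Set q) (F G : q) : Prop :=
  F ∈ W ∧ G ∈ W ∧ F ≠ G ∧ ∃ p : τ.Walk F G, p.IsPath ∧ (∀ H ∈ p.support, H ∈ W) ∧
    ∀ d ∈ p.darts, ∃ v, v ∈ d.fst.1.vars ∧ v ∈ d.snd.1.vars ∧ ¬ KeyClosure W F v

/-- `(τ, R)` is a pair-pruning join tree: the root of each rooted subtree is unattacked in the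
subquery formed by the atoms of that subtree. -/
def IsPPJT (q : BCQ S) (τ : SimpleGraph q) (R : q) : Prop :=
  q.IsJoinTree τ ∧ ∀ R' F : q, ¬ Attacks τ (subtree τ R R') F R'

end BCQ

/-! ### Non-recursive Datalog with negation and disequality -/

namespace Datalog

/-- Predicate symbols: the tables, and for every table two derived predicates. -/
inductive Pred (S : Schema) where
  | edb (r : S.Rel)
  | fkey (r : S.Rel)
  | join (r : S.Rel)

/-- Variables of rules: `Sum.inl v` is the query variable `v`; the variables `Sum.inr i` are
distinct from all query variables. -/
abbrev DTerm : Type := Term (ℕ ⊕ ℕ)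

structure DAtom (S : Schema) where
  pred : Pred S
  args : List DTerm

/-- Facts over stored and derived predicates. -/
abbrev DFact (S : Schema) : Type := Pred S × List ℕ

inductive Literal (S : Schema) where
  | pos (a : DAtom S)
  | neg (a : DAtom S)
  | neq (s t : DTerm)

structure Rule (S : Schema) where
  head : DAtom S
  body : List (Literal S)

variable {S : Schema}

def DAtom.inst (a : DAtom S) (ν : ℕ ⊕ ℕ → ℕ) : DFact S := (a.pred, a.args.map (Term.eval ν))

def DAtom.Mentions (a : DAtom S) (v : ℕ ⊕ ℕ) : Prop := ∃ t ∈ a.args, v ∈ t.vars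

def Literal.Mentions : Literal S → ℕ ⊕ ℕ → Prop
  | pos a, v => a.Mentions v
  | neg a, v => a.Mentions v
  | neq s t, v => v ∈ s.vars ∨ v ∈ t.vars

def Literal.Holds (I : Set (DFact S)) (ν : ℕ ⊕ ℕ → ℕ) : Literal S → Prop
  | pos a => a.inst ν ∈ I
  | neg a => a.inst ν ∉ I
  | neq s t => s.eval ν ≠ t.eval ν

def Literal.UsesPred : Literal S → Pred S → Prop
  | pos a, p => a.pred = p
  | neg a, p => a.pred = p
  | neq _ _, _ => False

/-- Every variable of the rule occurs in a non-negated atom of its body. -/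
def Rule.Safe (ρ : Rule S) : Prop :=
  ∀ v, (ρ.head.Mentions v ∨ ∃ l ∈ ρ.body, l.Mentions v) →
    ∃ a, Literal.pos a ∈ ρ.body ∧ a.Mentions v

/-- `rank` partitions the rules of `P` by their head predicates in such a way that rule bodies
use only derived predicates defined in earlier parts. -/
def Stratifies (P : Set (Rule S)) (rank : Pred S → ℕ) : Prop :=
  ∀ ρ ∈ P, ∀ l ∈ ρ.body, ∀ ρ' ∈ P, l.UsesPred ρ'.head.pred →
    rank ρ'.head.pred < rank ρ.head.pred

/-- `P` is a non-recursive Datalog program: a finite set of safe rules with such a partition. -/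
def IsNonRecursiveProgram (P : Set (Rule S)) : Prop :=
  P.Finite ∧ (∀ ρ ∈ P, ρ.Safe) ∧ ∃ rank, Stratifies P rank

/-- The stored facts. -/
def edbFacts (db : Database S) : Set (DFact S) :=
  {f | ∃ g ∈ db, f = (Pred.edb g.rel, List.ofFn g.val)}

/-- The facts obtained from `db` by applying, one part after the other, the rules of the parts
`0, …, n - 1`. -/
def stage (P : Set (Rule S)) (rank : Pred S → ℕ) (db : Database S) : ℕ → Set (DFact S)
  | 0 => edbFacts db
  | n + 1 => stage P rank db n ∪
      {f | ∃ ρ ∈ P, rank ρ.head.pred = n ∧ ∃ ν : ℕ ⊕ ℕ → ℕ,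
        f = ρ.head.inst ν ∧ ∀ l ∈ ρ.body, l.Holds (stage P rank db n) ν}

/-- The result of evaluating a program part by part on `db`. -/
def result (P : Set (Rule S)) (rank : Pred S → ℕ) (db : Database S) : Set (DFact S) :=
  ⋃ n, stage P rank db n

/-! ### The rewriting of a query along a rooted join tree -/

/-- The terms `x₁, …, xₙ` of a query atom. -/
def terms (a : Atom S) : List DTerm := List.ofFn fun i => (a.args i).map Sum.inl

/-- The terms `x₁, …, xₖ` in key positions. -/
def keyTerms (a : Atom S) : List DTerm := (terms a).take (S.keyLen a.rel)

/-- The fresh variables `z₁, …, zₙ`. -/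
def freshTerms (a : Atom S) : List DTerm :=
  List.ofFn fun i : Fin (S.arity a.rel) => Term.var (Sum.inr i.val)

/-- A sequence of distinct variables with all and only the variables common to two atoms. -/
def commonVars (a b : Atom S) : List DTerm :=
  ((a.vars ∩ b.vars).sort (· ≤ ·)).map fun v => Term.var (Sum.inl v)

/-- Rule 1: `fkey_R(z₁,…,zₖ) :- R(z₁,…,zₙ), zᵢ ≠ c` if `xᵢ` is the constant `c`, and
`fkey_R(z₁,…,zₖ) :- R(z₁,…,zₙ), zᵢ ≠ zⱼ` if `xᵢ` and `xⱼ` are the same variable and `j < i`. -/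
def rule1 (a : Atom S) : Set (Rule S) :=
  {ρ | ∃ (i : Fin (S.arity a.rel)) (t : DTerm),
    ((∃ c, a.args i = .const c ∧ t = .const c) ∨
      ∃ j v, j < i ∧ a.args i = .var v ∧ a.args j = .var v ∧ t = .var (.inr j.val)) ∧
    ρ = ⟨⟨.fkey a.rel, (freshTerms a).take (S.keyLen a.rel)⟩,
      [.pos ⟨.edb a.rel, freshTerms a⟩, .neq (.var (.inr i.val)) t]⟩}

/-- Rule 2: `fkey_R(x₁,…,xₖ) :- R(x₁,…,xₙ), R(x₁,…,xₖ,zₖ₊₁,…,zₙ), zᵢ ≠ xᵢ` if `i > k` and `xᵢ` is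
a variable of the parent of the atom. -/
def rule2 {q : BCQ S} (τ : SimpleGraph q) (R a : q) : Set (Rule S) :=
  {ρ | ∃ T, BCQ.IsParent τ R T a ∧ ∃ (i : Fin (S.arity a.1.rel)) (v : ℕ),
    S.keyLen a.1.rel ≤ i.val ∧ a.1.args i = .var v ∧ v ∈ T.1.vars ∧
    ρ = ⟨⟨.fkey a.1.rel, keyTerms a.1⟩,
      [.pos ⟨.edb a.1.rel, terms a.1⟩,
        .pos ⟨.edb a.1.rel, keyTerms a.1 ++ (freshTerms a.1).drop (S.keyLen a.1.rel)⟩,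
        .neq (.var (.inr i.val)) (.var (.inl v))]⟩}

/-- Rule 3: `fkey_R(x₁,…,xₖ) :- R(x₁,…,xₙ), ¬ S_join(w)` for each child `S` of the atom, where `w`
lists the common variables. -/
def rule3 {q : BCQ S} (τ : SimpleGraph q) (R a : q) : Set (Rule S) :=
  {ρ | ∃ b, BCQ.IsParent τ R a b ∧
    ρ = ⟨⟨.fkey a.1.rel, keyTerms a.1⟩,
      [.pos ⟨.edb a.1.rel, terms a.1⟩, .neg ⟨.join b.1.rel, commonVars a.1 b.1⟩]⟩}

/-- All rules for `fkey_R`. -/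
def fkeyRules {q : BCQ S} (τ : SimpleGraph q) (R a : q) : Set (Rule S) :=
  rule1 a.1 ∪ rule2 τ R a ∪ rule3 τ R a

/-- Rule 4: `R_join(w) :- R(x₁,…,xₙ), ¬ fkey_R(x₁,…,xₖ)`, where the negated atom is present only
if there is a rule for `fkey_R`. Here `w` lists the variables common to the atom and its parent;
it is empty at the root. -/
def rule4 {q : BCQ S} (τ : SimpleGraph q) (R a : q) : Set (Rule S) :=
  {ρ | ∃ w : List DTerm,
    ((a = R ∧ w = []) ∨ ∃ T, BCQ.IsParent τ R T a ∧ w = commonVars T.1 a.1) ∧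
    (((fkeyRules τ R a).Nonempty ∧
        ρ = ⟨⟨.join a.1.rel, w⟩,
          [.pos ⟨.edb a.1.rel, terms a.1⟩, .neg ⟨.fkey a.1.rel, keyTerms a.1⟩]⟩) ∨
      (fkeyRules τ R a = ∅ ∧
        ρ = ⟨⟨.join a.1.rel, w⟩, [.pos ⟨.edb a.1.rel, terms a.1⟩]⟩))}

/-- The rewriting of `q` along the rooted join tree `(τ, R)`. -/
def rewriting {q : BCQ S} (τ : SimpleGraph q) (R : q) : Set (Rule S) :=
  ⋃ a : q, fkeyRules τ R a ∪ rule4 τ R a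

/-- The fact that says that the query is certain: `R_join()` for the root `R`. -/
def goal {q : BCQ S} (R : q) : DFact S := (.join R.1.rel, [])

end Datalog

/-! ### Random-access machines and linear time -/

namespace RAM

/-- Programs of a random-access machine with structured control flow. The machine has registers
and a fixed number of memory arrays, all holding natural numbers; a program mentions finitely
many registers and arrays. Arrays are addressed by the contents of registers. The only arithmetic
operation is the successor, so `t` steps exceed the largest number of the input and of the program
text by at most `t`: charging one unit per operation does not hide work on long numbers. -/
inductive Prog where
  /-- `x := c` -/
  | const (x c : ℕ)
  /-- `x := y` -/
  | copy (x y : ℕ)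
  /-- `x := y + 1` -/
  | succ (x y : ℕ)
  /-- `x := b[y]` -/
  | load (x b y : ℕ)
  /-- `b[x] := y` -/
  | store (b x y : ℕ)
  /-- `p; p'` -/
  | seq (p p' : Prog)
  /-- `if x = y then p else p'` -/
  | ifEq (x y : ℕ) (p p' : Prog)
  /-- `if x < y then p else p'` -/
  | ifLt (x y : ℕ) (p p' : Prog)
  /-- `while x ≠ y do p` -/
  | whileNe (x y : ℕ) (p : Prog)

/-- Contents of the registers and of the memory arrays. -/
structure State where
  reg : ℕ → ℕ
  mem : ℕ → ℕ → ℕ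

def State.setReg (σ : State) (x n : ℕ) : State :=
  { σ with reg := Function.update σ.reg x n }

def State.setMem (σ : State) (b i n : ℕ) : State :=
  { σ with mem := Function.update σ.mem b (Function.update (σ.mem b) i n) }

/-- `Exec p σ t σ'`: started in `σ`, the program `p` halts in `σ'` after exactly `t` steps, where
each operation and each evaluation of a test is one step. -/
inductive Exec : Prog → State → ℕ → State → Prop
  | const (x c : ℕ) (σ : State) : Exec (.const x c) σ 1 (σ.setReg x c)
  | copy (x y : ℕ) (σ : State) : Exec (.copy x y) σ 1 (σ.setReg x (σ.reg y))
  | succ (x y : ℕ) (σ : State) : Exec (.succ x y) σ 1 (σ.setReg x (σ.reg y + 1))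
  | load (x b y : ℕ) (σ : State) : Exec (.load x b y) σ 1 (σ.setReg x (σ.mem b (σ.reg y)))
  | store (b x y : ℕ) (σ : State) : Exec (.store b x y) σ 1 (σ.setMem b (σ.reg x) (σ.reg y))
  | seq {p p' : Prog} {σ σ₁ σ₂ : State} {t t' : ℕ} :
      Exec p σ t σ₁ → Exec p' σ₁ t' σ₂ → Exec (.seq p p') σ (t + t') σ₂
  | ifEq_true {x y : ℕ} {p p' : Prog} {σ σ₁ : State} {t : ℕ} :
      σ.reg x = σ.reg y → Exec p σ t σ₁ → Exec (.ifEq x y p p') σ (t + 1) σ₁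
  | ifEq_false {x y : ℕ} {p p' : Prog} {σ σ₁ : State} {t : ℕ} :
      σ.reg x ≠ σ.reg y → Exec p' σ t σ₁ → Exec (.ifEq x y p p') σ (t + 1) σ₁
  | ifLt_true {x y : ℕ} {p p' : Prog} {σ σ₁ : State} {t : ℕ} :
      σ.reg x < σ.reg y → Exec p σ t σ₁ → Exec (.ifLt x y p p') σ (t + 1) σ₁
  | ifLt_false {x y : ℕ} {p p' : Prog} {σ σ₁ : State} {t : ℕ} :
      ¬ σ.reg x < σ.reg y → Exec p' σ t σ₁ → Exec (.ifLt x y p p') σ (t + 1) σ₁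
  | while_done {x y : ℕ} {p : Prog} {σ : State} :
      σ.reg x = σ.reg y → Exec (.whileNe x y p) σ 1 σ
  | while_step {x y : ℕ} {p : Prog} {σ σ₁ σ₂ : State} {t t' : ℕ} :
      σ.reg x ≠ σ.reg y → Exec p σ t σ₁ → Exec (.whileNe x y p) σ₁ t' σ₂ →
      Exec (.whileNe x y p) σ (t + t' + 1) σ₂

/-- Programs are deterministic. -/
theorem Exec.deterministic {p : Prog} {σ σ₁ σ₂ : State} {t₁ t₂ : ℕ}
    (h₁ : Exec p σ t₁ σ₁) (h₂ : Exec p σ t₂ σ₂) : t₁ = t₂ ∧ σ₁ = σ₂ := by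
  induction h₁ generalizing t₂ σ₂ with
  | const | copy | succ | load | store => cases h₂; exact ⟨rfl, rfl⟩
  | seq _ _ ih ih' =>
    cases h₂ with
    | seq g g' =>
      obtain ⟨rfl, rfl⟩ := ih g
      obtain ⟨rfl, rfl⟩ := ih' g'
      exact ⟨rfl, rfl⟩
  | ifEq_true h _ ih | ifEq_false h _ ih | ifLt_true h _ ih | ifLt_false h _ ih =>
    cases h₂ <;> first
      | contradiction
      | (rename_i g; obtain ⟨rfl, rfl⟩ := ih g; exact ⟨rfl, rfl⟩)
  | while_done h =>
    cases h₂ with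
    | while_done => exact ⟨rfl, rfl⟩
    | while_step h' => contradiction
  | while_step h _ _ ih ih' =>
    cases h₂ with
    | while_done => contradiction
    | while_step _ g g' =>
      obtain ⟨rfl, rfl⟩ := ih g
      obtain ⟨rfl, rfl⟩ := ih' g'
      exact ⟨rfl, rfl⟩

/-- A presentation of a database: for each table, a list of its rows, in any order. -/
abbrev Listing (S : Schema) : Type := (r : S.Rel) → List (Fin (S.arity r) → ℕ)

/-- `L` lists the rows of each table of `db` without repetitions. -/
def Listing.Presents {S : Schema} (L : Listing S) (db : Database S) : Prop :=
  ∀ r, (L r).Nodup ∧ ∀ t, t ∈ L r ↔ (⟨r, t⟩ : DBFact S) ∈ db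

/-- The input state: register `r` holds the number of rows of table `r`, array `r` holds these
rows, one after the other; everything else is `0`. -/
def Listing.input {S : Schema} (L : Listing S) : State where
  reg x := if h : x < S.numRel then (L ⟨x, h⟩).length else 0
  mem b i := if h : b < S.numRel then ((L ⟨b, h⟩).flatMap List.ofFn).getD i 0 else 0

/-- The decision problem `A` on databases over a fixed schema is solved by a program in time
`O(N)`, where `N` is the number of facts of the database: on every presentation of the database
the program halts after at most `C * (N + 1)` steps, and register `0` then holds the answer, `1`
for yes and `0` for no. -/
def DecidableInLinearTime {S : Schema} (A : Database S → Prop) : Prop :=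
  ∃ (p : Prog) (C : ℕ), ∀ (db : Database S) (L : Listing S), L.Presents db →
    ∃ (t : ℕ) (σ : State), Exec p L.input t σ ∧ t ≤ C * (db.card + 1) ∧
      (A db → σ.reg 0 = 1) ∧ (¬ A db → σ.reg 0 = 0)

end RAM

/-! ### Rooted trees -/

namespace BCQ

variable {S : Schema} {q : BCQ S} {τ : SimpleGraph q} {R : q}

/-! For an atom `a` and values `θ` of the variables shared with its parent, `CertainBelow` says that
every repair embeds the subquery of the subtree of `a` compatibly with `θ`; at the root this is
certainty of the query. Everything rests on the recursion `certainBelow_iff`: such a subquery is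
certain iff one block of the table of `a` is good, that is, each fact of the block matches `a`,
agrees with `θ` and makes all child subqueries certain. If a good block exists, a repair picks one
of its facts, and the child embeddings glue along the join tree.

The converse needs a key of `a` that serves all repairs at once (`CertainBelow.exists_key`). Start
from a repair with the fewest possible root keys of embeddings, and move it towards another repair
`s` by replacing, one at a time, a fact that is used by an embedding and missing from `s`. Such a
swap creates no new root key (`IsPPJT.exists_embeds_of_swap`): since the swapped atom does not
attack the root, all variables common to the ends of some edge above it are determined by its key,
so the old embedding below this edge can be glued to the new one above it. By minimality the set of
root keys never changes, hence each of these keys also occurs in `s`. With the key fixed, forcing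
any fact of its block into a repair forces the embedding to use that fact, and its part below `a`
certifies the children.

The rewriting expresses this recursion by double negation: `fkey` marks the blocks that fail, `join`
projects the facts of the others (`fkey_mem_result_iff`, `join_mem_result_iff`). Induction from the
leaves gives `join_mem_result_iff_certainBelow`; the stages of the evaluation enter only through
`mem_result_iff`.

For linear time, goodness of a block does not depend on `θ` once the interface values are read off
the row itself. So `GoodRow` is a Boolean column on the table of all facts, and the test for a child
is a semijoin (`certainBelow_iff_goodRow`). Columns computable in linear time (`Layout.Comp`) are
closed under case distinction and under quantification over classes of rows. The delicate operation
is `Comp.pair`, which groups rows by two columns without sorting or hashing: rows are linked so that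
the classes of the first column are contiguous, and during a walk along this list an array addressed
by the second value needs to remember only the latest class seen with it. -/

theorem mem_subtree_iff (hT : τ.IsTree) {G a : q} {p : τ.Walk R G} (hp : p.IsPath) :
    G ∈ subtree τ R a ↔ a ∈ p.support := by
  refine ⟨?_, fun h => ⟨p, hp, h⟩⟩
  rintro ⟨p', hp', h⟩
  have := (hT.isAcyclic.subsingleton_path R G).elim ⟨p, hp⟩ ⟨p', hp'⟩
  have h' : p = p' := congrArg Subtype.val this
  rwa [h']

theorem exists_path (hT : τ.IsTree) (F G : q) : ∃ p : τ.Walk F G, p.IsPath :=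
  (hT.existsUnique_path F G).exists

theorem self_mem_subtree (hT : τ.IsTree) (a : q) : a ∈ subtree τ R a := by
  obtain ⟨p, hp⟩ := exists_path hT R a
  exact ⟨p, hp, p.end_mem_support⟩

theorem mem_subtree_root (hT : τ.IsTree) (a : q) : a ∈ subtree τ R R := by
  obtain ⟨p, hp⟩ := exists_path hT R a
  exact ⟨p, hp, p.start_mem_support⟩

theorem mem_subtree_trans (hT : τ.IsTree) {a b G : q} (h₁ : G ∈ subtree τ R b)
    (h₂ : b ∈ subtree τ R a) : G ∈ subtree τ R a := by
  classical
  obtain ⟨p, hp, hb⟩ := h₁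
  rw [mem_subtree_iff hT (hp.takeUntil hb)] at h₂
  exact ⟨p, hp, p.support_takeUntil_subset_support hb h₂⟩

theorem mem_subtree_antisymm (hT : τ.IsTree) {a b : q} (h₁ : a ∈ subtree τ R b)
    (h₂ : b ∈ subtree τ R a) : a = b := by
  classical
  obtain ⟨p, hp, hb⟩ := h₁
  rw [mem_subtree_iff hT (hp.takeUntil hb)] at h₂
  by_contra hne
  exact SimpleGraph.Walk.endpoint_notMem_support_takeUntil hp hb hne h₂

theorem IsParent.mem {T G : q} (h : IsParent τ R T G) : G ∈ subtree τ R T := h.2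

theorem IsParent.ne {T G : q} (h : IsParent τ R T G) : T ≠ G := h.1.ne

theorem IsParent.notMem (hT : τ.IsTree) {T G : q} (h : IsParent τ R T G) :
    T ∉ subtree τ R G := fun h' => h.ne (mem_subtree_antisymm hT h' h.mem)

/-- The parent is the second node on the path from `G` to the root, so every other node of that path
is met from the parent as well. -/
theorem exists_parent (hT : τ.IsTree) {G : q} (hG : G ≠ R) :
    ∃ T, IsParent τ R T G ∧ ∀ a, G ∈ subtree τ R a → a ≠ G → T ∈ subtree τ R a := by
  obtain ⟨p, hp⟩ := exists_path hT G R
  cases p with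
  | nil => exact absurd rfl hG
  | @cons _ T _ h p =>
    rw [SimpleGraph.Walk.cons_isPath_iff] at hp
    have key : ∀ a, G ∈ subtree τ R a ↔ a = G ∨ T ∈ subtree τ R a := by
      intro a
      have h1 : ((SimpleGraph.Walk.cons h p).reverse).IsPath := by
        rw [SimpleGraph.Walk.isPath_reverse_iff, SimpleGraph.Walk.cons_isPath_iff]; exact hp
      rw [mem_subtree_iff hT h1, mem_subtree_iff hT hp.1.reverse]
      simp only [SimpleGraph.Walk.support_reverse, SimpleGraph.Walk.support_cons,
        List.mem_reverse, List.mem_cons]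
    refine ⟨T, ⟨h.symm, (key T).2 (.inr (self_mem_subtree hT T))⟩, fun a ha hne => ?_⟩
    exact ((key a).1 ha).resolve_left hne

theorem IsParent.unique (hT : τ.IsTree) {T T' G : q} (h : IsParent τ R T G)
    (h' : IsParent τ R T' G) : T = T' := by
  have hG : G ≠ R := by
    rintro rfl
    exact h.notMem hT (mem_subtree_root hT T)
  obtain ⟨U, hU, hU'⟩ := exists_parent hT hG
  have key : ∀ T, IsParent τ R T G → T = U := by
    intro T h
    by_contra hne
    -- `U` lies below `T`; the path from the root through `T` to `G` will show that `T` also lies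
    -- below `U`.
    have h1 := hU' T h.mem h.ne
    obtain ⟨p, hp⟩ := exists_path hT R T
    have hGp : G ∉ p.support := fun hm => h.notMem hT ((mem_subtree_iff hT hp).2 hm)
    have h2 : (p.concat h.1).IsPath := by
      rw [SimpleGraph.Walk.concat_isPath_iff]
      exact ⟨hp, hGp⟩
    have h3 := (mem_subtree_iff hT h2).1 hU.mem
    rw [SimpleGraph.Walk.support_concat, List.mem_append] at h3
    rcases h3 with h3 | h3
    · exact hne (mem_subtree_antisymm hT ((mem_subtree_iff hT hp).2 h3) h1)
    · exact hU.ne (by simpa using h3)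
  rw [key T h, key T' h']

theorem not_isParent_root (hT : τ.IsTree) {T : q} : ¬ IsParent τ R T R :=
  fun h => h.notMem hT (mem_subtree_root hT T)

/-- The proper-descendant relation of the rooted tree. -/
def Below (τ : SimpleGraph q) (R : q) (G a : q) : Prop := G ∈ subtree τ R a ∧ G ≠ a

theorem below_trans (hT : τ.IsTree) {a b c : q} (h₁ : Below τ R a b) (h₂ : Below τ R b c) :
    Below τ R a c := by
  refine ⟨mem_subtree_trans hT h₁.1 h₂.1, ?_⟩
  rintro rfl
  exact h₁.2 (mem_subtree_antisymm hT h₁.1 h₂.1)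

theorem wellFounded_below (hT : τ.IsTree) : WellFounded (Below τ R) := by
  have : IsTrans q (Below τ R) := ⟨fun _ _ _ => below_trans hT⟩
  have : Std.Irrefl (Below τ R) := ⟨fun _ h => h.2 rfl⟩
  exact Finite.wellFounded_of_trans_of_irrefl _

theorem wellFounded_above (hT : τ.IsTree) : WellFounded (Function.swap (Below τ R)) := by
  have : IsTrans q (Function.swap (Below τ R)) := ⟨fun _ _ _ h h' => below_trans hT h' h⟩
  have : Std.Irrefl (Function.swap (Below τ R)) := ⟨fun _ h => h.2 rfl⟩
  exact Finite.wellFounded_of_trans_of_irrefl _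

theorem IsParent.below {T G : q} (h : IsParent τ R T G) : Below τ R G T := ⟨h.mem, h.ne.symm⟩

/-- Induction from the leaves to the root. -/
theorem subtree_induction (hT : τ.IsTree) {P : q → Prop}
    (h : ∀ a, (∀ b, IsParent τ R a b → P b) → P a) (a : q) : P a :=
  (wellFounded_below hT).induction a fun a ih => h a fun b hb => ih b hb.below

/-- Induction from the root to the leaves. -/
theorem parent_induction (hT : τ.IsTree) {P : q → Prop}
    (h : ∀ a, (∀ b, IsParent τ R b a → P b) → P a) (a : q) : P a :=
  (wellFounded_above hT).induction a fun a ih => h a fun b hb => ih b hb.below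

theorem parent_mem_subtree (hT : τ.IsTree) {a T G : q} (hG : G ∈ subtree τ R a) (hne : a ≠ G)
    (h : IsParent τ R T G) : T ∈ subtree τ R a := by
  have hGR : G ≠ R := by
    rintro rfl
    exact not_isParent_root hT h
  obtain ⟨U, hU, hU'⟩ := exists_parent hT hGR
  rw [h.unique hT hU]
  exact hU' a hG hne

theorem mem_subtree_cases (hT : τ.IsTree) {a : q} (G : q) :
    G ∈ subtree τ R a ↔ G = a ∨ ∃ b, IsParent τ R a b ∧ G ∈ subtree τ R b := by
  constructor
  · induction G using parent_induction (R := R) hT with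
    | h G ih =>
    intro hG
    by_cases hGa : G = a
    · exact .inl hGa
    have hGR : G ≠ R := by
      rintro rfl
      obtain ⟨p, hp, h⟩ := hG
      have : p = .nil := by
        have := (hT.isAcyclic.subsingleton_path _ _).elim ⟨p, hp⟩ ⟨.nil, .nil⟩
        exact congrArg Subtype.val this
      subst this
      simp at h
      exact hGa h.symm
    obtain ⟨T, hTG, -⟩ := exists_parent hT hGR
    have hTa := parent_mem_subtree hT hG (Ne.symm hGa) hTG
    rcases ih T hTG hTa with rfl | ⟨b, hb, hTb⟩
    · exact .inr ⟨G, hTG, self_mem_subtree hT G⟩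
    · exact .inr ⟨b, hb, mem_subtree_trans hT hTG.mem hTb⟩
  · rintro (rfl | ⟨b, hb, hG⟩)
    · exact self_mem_subtree hT G
    · exact mem_subtree_trans hT hG hb.mem

/-- The path from a node of a subtree up to the root of the subtree. -/
theorem exists_path_up (hT : τ.IsTree) {a F : q} (hF : F ∈ subtree τ R a) :
    ∃ p : τ.Walk F a, p.IsPath ∧ (∀ H ∈ p.support, H ∈ subtree τ R a ∧ F ∈ subtree τ R H) ∧
      ∀ d ∈ p.darts, IsParent τ R d.snd d.fst ∧ F ∈ subtree τ R d.fst := by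
  induction F using parent_induction (R := R) hT with
  | h F ih =>
  by_cases hFa : F = a
  · subst hFa
    exact ⟨.nil, .nil, by simpa using self_mem_subtree hT F, by simp⟩
  have hFR : F ≠ R := by
    rintro rfl
    exact hFa (mem_subtree_antisymm hT hF (mem_subtree_root hT a))
  obtain ⟨T, hTF, -⟩ := exists_parent hT hFR
  have hTa := parent_mem_subtree hT hF (Ne.symm hFa) hTF
  obtain ⟨p, hp, hs, hd⟩ := ih T hTF hTa
  refine ⟨.cons hTF.1.symm p, ?_, ?_, ?_⟩
  · rw [SimpleGraph.Walk.cons_isPath_iff]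
    exact ⟨hp, fun h => hTF.notMem hT (hs F h).2⟩
  · intro H hH
    rw [SimpleGraph.Walk.support_cons, List.mem_cons] at hH
    rcases hH with rfl | hH
    · exact ⟨hF, self_mem_subtree hT _⟩
    · exact ⟨(hs H hH).1, mem_subtree_trans hT hTF.mem (hs H hH).2⟩
  · intro d hdm
    rw [SimpleGraph.Walk.darts_cons, List.mem_cons] at hdm
    rcases hdm with rfl | hdm
    · exact ⟨hTF, self_mem_subtree hT F⟩
    · exact ⟨(hd d hdm).1, mem_subtree_trans hT hTF.mem (hd d hdm).2⟩

/-- A walk that leaves a subtree uses the edge from its root to the parent of its root. -/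
theorem edge_mem_of_leaves (hT : τ.IsTree) {x y G G' : q} (hxy : IsParent τ R y x)
    (hG : G ∈ subtree τ R x) (hG' : G' ∉ subtree τ R x) (w : τ.Walk G G') :
    s(x, y) ∈ w.edges := by
  have hb := SimpleGraph.isAcyclic_iff_forall_adj_isBridge.1 hT.isAcyclic hxy.1.symm
  rw [SimpleGraph.isBridge_iff_forall_walk_mem_edges] at hb
  obtain ⟨u, -, hu, -⟩ := exists_path_up hT hG
  obtain ⟨p', hp'⟩ := exists_path hT R G'
  obtain ⟨v, hv⟩ := exists_path hT R y
  -- The detour from `x` via `G`, `G'` and the root to `y` must use the bridge. Only `w` can: `y` is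
  -- not below `x`, and neither path from the root meets `x`.
  have h := hb (((u.reverse.append w).append p'.reverse).append v)
  simp only [SimpleGraph.Walk.edges_append, List.mem_append, SimpleGraph.Walk.edges_reverse,
    List.mem_reverse] at h
  rcases h with ((h | h) | h) | h
  · exact absurd (hu _ (u.snd_mem_support_of_mem_edges h)).1 (hxy.notMem hT)
  · exact h
  · exact absurd ((mem_subtree_iff hT hp').2 (p'.fst_mem_support_of_mem_edges h)) hG'
  · exact absurd ((mem_subtree_iff hT hv).2 (v.fst_mem_support_of_mem_edges h)) (hxy.notMem hT)

/-- The edge above a subtree separates it from all other atoms, so the join-tree condition carries a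
variable that occurs on both sides to both ends of this edge. -/
theorem IsJoinTree.mem_vars (hJ : q.IsJoinTree τ) {x y G G' : q} (hxy : IsParent τ R y x)
    (hG : G ∈ subtree τ R x) (hG' : G' ∉ subtree τ R x) {v : ℕ} (h : v ∈ G.1.vars)
    (h' : v ∈ G'.1.vars) : v ∈ x.1.vars ∧ v ∈ y.1.vars := by
  obtain ⟨w, hw⟩ := exists_path hJ.1 G G'
  have he := edge_mem_of_leaves hJ.1 hxy hG hG' w
  have hv := Finset.mem_inter.2 ⟨h, h'⟩
  exact ⟨hJ.2 _ _ w hw _ (w.fst_mem_support_of_mem_edges he) hv,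
    hJ.2 _ _ w hw _ (w.snd_mem_support_of_mem_edges he) hv⟩

/-- If `F` does not attack the root `a` of a subtree, then all variables common to the two ends
of some edge between `F` and `a` are determined by the key of `F`. -/
theorem IsPPJT.exists_edge (hτ : q.IsPPJT τ R) {a F : q} (hF : F ∈ subtree τ R a) (hne : F ≠ a) :
    ∃ x y, IsParent τ R y x ∧ x ∈ subtree τ R a ∧ x ≠ a ∧ F ∈ subtree τ R x ∧
      ∀ v, v ∈ x.1.vars → v ∈ y.1.vars → KeyClosure (subtree τ R a) F v := by
  have hT := hτ.1.1
  obtain ⟨p, hp, hs, hd⟩ := exists_path_up hT hF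
  by_contra! hcon
  refine hτ.2 a F ⟨hF, self_mem_subtree hT a, hne, p, hp, fun H hH => (hs H hH).1, ?_⟩
  intro d hdm
  obtain ⟨h1, h2⟩ := hd d hdm
  have hx := (hs _ (p.dart_fst_mem_support_of_mem_darts hdm)).1
  have hy := (hs _ (p.dart_snd_mem_support_of_mem_darts hdm)).1
  refine hcon _ _ h1 hx ?_ h2
  intro h
  rw [h] at h1
  exact h1.notMem hT hy

end BCQ

/-! ### Repairs and block-wise evaluation -/

section Facts

variable {S : Schema}

theorem DBFact.key_eq_iff (r : S.Rel) (t t' : Fin (S.arity r) → ℕ) :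
    DBFact.key ⟨r, t⟩ = DBFact.key ⟨r, t'⟩ ↔
      ∀ i : Fin (S.arity r), i.val < S.keyLen r → t i = t' i := by
  unfold DBFact.key
  constructor
  · intro h i hi
    have := congrArg (fun l => l[i.val]?) h
    simpa [hi, List.getElem?_take] using this
  · intro h
    apply List.ext_getElem
    · simp
    · intro n h₁ h₂
      simp only [List.length_take, List.length_ofFn, lt_inf_iff] at h₁
      simpa using h ⟨n, h₁.2⟩ h₁.1

theorem DBFact.KeyEq.refl (f : DBFact S) : f.KeyEq f := ⟨rfl, rfl⟩

theorem DBFact.KeyEq.symm {f g : DBFact S} (h : f.KeyEq g) : g.KeyEq f := ⟨h.1.symm, h.2.symm⟩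

theorem DBFact.KeyEq.trans {f g h : DBFact S} (h₁ : f.KeyEq g) (h₂ : g.KeyEq h) : f.KeyEq h :=
  ⟨h₁.1.trans h₂.1, h₁.2.trans h₂.2⟩

theorem Term.eval_congr {V : Type} {ν μ : V → ℕ} {t : Term V} :
    t.eval ν = t.eval μ ↔ ∀ v ∈ t.vars, ν v = μ v := by
  cases t <;> simp [Term.eval, Term.vars]

theorem Atom.mem_vars {a : Atom S} {v : ℕ} : v ∈ a.vars ↔ ∃ i, a.args i = .var v := by
  simp only [Atom.vars, Finset.mem_biUnion, Finset.mem_univ, true_and]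
  refine exists_congr fun i => ?_
  cases a.args i <;> simp [Term.vars, eq_comm]

theorem Atom.inst_eq_iff {a : Atom S} {ν μ : ℕ → ℕ} :
    a.inst ν = a.inst μ ↔ ∀ v ∈ a.vars, ν v = μ v := by
  simp only [Atom.inst, DBFact.mk.injEq, heq_eq_eq, true_and, funext_iff, Term.eval_congr,
    Atom.vars, Finset.mem_biUnion, Finset.mem_univ]
  exact ⟨fun h v ⟨i, hi⟩ => h i v hi, fun h i v hi => h v ⟨i, hi⟩⟩

theorem Atom.key_inst_eq_iff {a : Atom S} {ν μ : ℕ → ℕ} :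
    (a.inst ν).key = (a.inst μ).key ↔ ∀ v ∈ a.keyVars, ν v = μ v := by
  simp only [Atom.inst, DBFact.key_eq_iff, Term.eval_congr, Atom.keyVars, Finset.mem_biUnion,
    Finset.mem_univ, Finset.mem_filter, true_and]
  exact ⟨fun h v ⟨i, hi, hv⟩ => h i hi v hv, fun h i hi v hv => h v ⟨i, hi, hv⟩⟩

theorem BCQ.SelfJoinFree.eq {q : BCQ S} (hq : q.SelfJoinFree) {F G : q} (h : F.1.rel = G.1.rel) :
    F = G := Subtype.ext (hq _ F.2 _ G.2 h)

theorem IsRepair.eq {db r : Database S} (hr : IsRepair db r) {f g : DBFact S} (hf : f ∈ r)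
    (hg : g ∈ r) (h : f.KeyEq g) : f = g :=
  (hr.2 f (hr.1 hf)).unique ⟨hf, .refl f⟩ ⟨hg, h⟩

/-- If `B` belongs to the database, then every repair can be modified to contain `B`. -/
theorem IsRepair.swap {db r : Database S} (hr : IsRepair db r) {B : DBFact S} (hB : B ∈ db) :
    ∃ r', IsRepair db r' ∧ ∀ g, g ∈ r' ↔ g = B ∨ (g ∈ r ∧ ¬ B.KeyEq g) := by
  classical
  refine ⟨insert B (r.filter fun g => ¬ B.KeyEq g), ⟨?_, ?_⟩, by simp⟩
  · intro g hg
    simp only [Finset.mem_insert, Finset.mem_filter] at hg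
    rcases hg with rfl | hg
    · exact hB
    · exact hr.1 hg.1
  · intro f hf
    simp only [Finset.mem_insert, Finset.mem_filter]
    by_cases hBf : B.KeyEq f
    · refine ⟨B, ⟨.inl rfl, hBf.symm⟩, ?_⟩
      rintro g ⟨rfl | hg, hfg⟩
      · rfl
      · exact absurd (hBf.trans hfg) hg.2
    · obtain ⟨g, ⟨hg, hfg⟩, hu⟩ := hr.2 f hf
      refine ⟨g, ⟨.inr ⟨hg, fun h => hBf (h.trans hfg.symm)⟩, hfg⟩, ?_⟩
      rintro g' ⟨rfl | hg', hfg'⟩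
      · exact absurd hfg'.symm hBf
      · exact hu g' ⟨hg'.1, hfg'⟩

/-- Facts are added one by one: a fact whose block is already represented leaves the repair
unchanged, any other fact joins it. -/
theorem exists_repair (db : Database S) : ∃ r, IsRepair db r := by
  classical
  induction db using Finset.induction_on with
  | empty => exact ⟨∅, by simp [IsRepair]⟩
  | insert f db hf ih =>
    obtain ⟨r, hr⟩ := ih
    by_cases h : ∃ g ∈ db, f.KeyEq g
    · obtain ⟨g, hg, hfg⟩ := h
      refine ⟨r, hr.1.trans (Finset.subset_insert _ _), ?_⟩
      intro e he
      rcases Finset.mem_insert.1 he with rfl | he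
      · obtain ⟨g', ⟨h₁, h₂⟩, hu⟩ := hr.2 g hg
        exact ⟨g', ⟨h₁, hfg.trans h₂⟩, fun y hy => hu y ⟨hy.1, hfg.symm.trans hy.2⟩⟩
      · exact hr.2 e he
    · push Not at h
      refine ⟨insert f r, Finset.insert_subset_insert _ hr.1, ?_⟩
      intro e he
      rcases Finset.mem_insert.1 he with rfl | hed
      · refine ⟨e, ⟨Finset.mem_insert_self _ _, .refl e⟩, ?_⟩
        rintro y ⟨hy, hey⟩
        rcases Finset.mem_insert.1 hy with rfl | hy
        · rfl
        · exact absurd hey (h y (hr.1 hy))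
      · obtain ⟨g', ⟨h₁, h₂⟩, hu⟩ := hr.2 e hed
        refine ⟨g', ⟨Finset.mem_insert_of_mem h₁, h₂⟩, ?_⟩
        rintro y ⟨hy, hey⟩
        rcases Finset.mem_insert.1 hy with rfl | hy
        · exact absurd hey.symm (h e hed)
        · exact hu y ⟨hy, hey⟩

end Facts

/-! ### Pair pruning and the block-wise recursion for certainty -/

namespace BCQ

variable {S : Schema} {q : BCQ S} {τ : SimpleGraph q} {R : q}

/-- The variables that an atom shares with its parent. -/
def iface (τ : SimpleGraph q) (R a : q) : Set ℕ :=
  {v | v ∈ a.1.vars ∧ ∃ T, IsParent τ R T a ∧ v ∈ T.1.vars}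

/-- `ν` embeds the subtree rooted at `a` into `r` and agrees with `θ` on the variables shared with
the parent of `a`. -/
def Embeds (τ : SimpleGraph q) (R a : q) (θ ν : ℕ → ℕ) (r : Database S) : Prop :=
  (∀ v ∈ iface τ R a, ν v = θ v) ∧ ∀ G ∈ subtree τ R a, G.1.inst ν ∈ r

/-- The subquery rooted at `a`, with its interface instantiated by `θ`, is certain. -/
def CertainBelow (τ : SimpleGraph q) (R a : q) (db : Database S) (θ : ℕ → ℕ) : Prop :=
  ∀ r, IsRepair db r → ∃ ν, Embeds τ R a θ ν r

theorem certainBelow_root (hT : τ.IsTree) {db : Database S} {θ : ℕ → ℕ} :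
    CertainBelow τ R R db θ ↔ q.Certain db := by
  unfold CertainBelow Certain Holds Embeds
  refine forall₂_congr fun r _ => exists_congr fun ν => ⟨fun h a ha => ?_, fun h => ⟨?_, ?_⟩⟩
  · exact h.2 ⟨a, ha⟩ (mem_subtree_root hT _)
  · rintro v ⟨-, T, h, -⟩
    exact absurd h (not_isParent_root hT)
  · exact fun G _ => h G.1 G.2

theorem certainBelow_congr {a : q} {db : Database S} {θ θ' : ℕ → ℕ}
    (h : ∀ v ∈ iface τ R a, θ v = θ' v) :
    CertainBelow τ R a db θ ↔ CertainBelow τ R a db θ' := by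
  unfold CertainBelow Embeds
  refine forall₂_congr fun r _ => exists_congr fun ν => and_congr_left fun _ =>
    forall₂_congr fun v hv => ?_
  rw [h v hv]

/-- Embeddings into a repair and into a repair that differs from it in one fact of `F` agree on
the variables determined by the key of `F`. -/
theorem KeyClosure.eval_eq {W : Set q} {F : q} {db r : Database S}
    (hr : IsRepair db r) {ν μ : ℕ → ℕ} (hkey : (F.1.inst ν).key = (F.1.inst μ).key)
    (hν : ∀ G ∈ W, G ≠ F → G.1.inst ν ∈ r) (hμ : ∀ G ∈ W, G ≠ F → G.1.inst μ ∈ r) {v : ℕ}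
    (hv : KeyClosure W F v) : ν v = μ v := by
  induction hv with
  | key v hv => exact Atom.key_inst_eq_iff.1 hkey v hv
  | step G v hG hne _ hvG ih =>
    have h := hr.eq (hν G hG hne) (hμ G hG hne) ⟨rfl, Atom.key_inst_eq_iff.2 ih⟩
    exact Atom.inst_eq_iff.1 h v hvG

/-- Replacing one fact used by an embedding does not give rise to new key values at the root. -/
theorem IsPPJT.exists_embeds_of_swap (hq : q.SelfJoinFree) (hτ : q.IsPPJT τ R) {a F : q}
    {θ ν μ : ℕ → ℕ} {db r r' : Database S} (hr : IsRepair db r) {B : DBFact S}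
    (hF : F ∈ subtree τ R a) (hB : (F.1.inst ν).KeyEq B)
    (hr' : ∀ g, g ∈ r' ↔ g = B ∨ (g ∈ r ∧ ¬ B.KeyEq g))
    (hν : Embeds τ R a θ ν r) (hμ : Embeds τ R a θ μ r') :
    ∃ κ, Embeds τ R a θ κ r ∧ (a.1.inst κ).key = (a.1.inst μ).key := by
  classical
  have hJ := hτ.1
  have hT := hJ.1
  -- The inserted fact `B` belongs to the table of `F`, which no other atom uses.
  have hμr : ∀ G ∈ subtree τ R a, G ≠ F → G.1.inst μ ∈ r := by
    intro G hG hne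
    rcases (hr' _).1 (hμ.2 G hG) with h | h
    · refine absurd (hq.eq ?_) hne
      have h1 : B.rel = G.1.rel := by rw [← h]; rfl
      rw [← h1]
      exact hB.1.symm
    · exact h.1
  -- If `μ` does not use `B` at `F`, it embeds into `r` already. Otherwise `ν` and `μ` give `F` the
  -- same key.
  rcases (hr' _).1 (hμ.2 F hF) with hFB | hFr
  swap
  · refine ⟨μ, ⟨hμ.1, fun G hG => ?_⟩, rfl⟩
    by_cases h : G = F
    · subst h; exact hFr.1
    · exact hμr G hG h
  have hkey : (F.1.inst ν).key = (F.1.inst μ).key := by rw [hFB]; exact hB.2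
  by_cases hFa : F = a
  · subst hFa
    exact ⟨ν, hν, hkey⟩
  obtain ⟨x, y, hyx, hxa, hxne, hFx, hcl⟩ := hτ.exists_edge hF hFa
  have heq : ∀ v, v ∈ x.1.vars → v ∈ y.1.vars → ν v = μ v := fun v h₁ h₂ =>
    KeyClosure.eval_eq hr hkey (fun G hG _ => hν.2 G hG) hμr (hcl v h₁ h₂)
  have hax : a ∉ subtree τ R x := fun h => hxne (mem_subtree_antisymm hT hxa h)
  -- Below the pruned edge use `ν`, above it `μ`. They agree on the variables common to `x` and `y`,
  -- hence on all variables that cross the edge; and `F`, the only atom whose image under `μ` may be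
  -- missing from `r`, lies on the side of `ν`.
  set κ : ℕ → ℕ := fun v => if ∃ G ∈ subtree τ R x, v ∈ G.1.vars then ν v else μ v with hκ
  have hκν : ∀ G ∈ subtree τ R x, G.1.inst κ = G.1.inst ν := fun G hG =>
    Atom.inst_eq_iff.2 fun v hv => by rw [hκ]; exact if_pos ⟨G, hG, hv⟩
  have hκμ' : ∀ G ∉ subtree τ R x, ∀ v ∈ G.1.vars, κ v = μ v := by
    intro G hG v hv
    by_cases h : ∃ G ∈ subtree τ R x, v ∈ G.1.vars
    · obtain ⟨G', hG', hv'⟩ := h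
      obtain ⟨h₁, h₂⟩ := hJ.mem_vars hyx hG' hG hv' hv
      have : κ v = ν v := if_pos ⟨G', hG', hv'⟩
      rw [this, heq v h₁ h₂]
    · exact if_neg h
  have hκμ : ∀ G ∉ subtree τ R x, G.1.inst κ = G.1.inst μ := fun G hG =>
    Atom.inst_eq_iff.2 (hκμ' G hG)
  refine ⟨κ, ⟨fun v hv => ?_, fun G hG => ?_⟩, by rw [hκμ a hax]⟩
  · rw [hκμ' a hax v hv.1, hμ.1 v hv]
  · by_cases hGx : G ∈ subtree τ R x
    · rw [hκν G hGx]; exact hν.2 G hG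
    · rw [hκμ G hGx]
      exact hμr G hG fun h => hGx (h ▸ hFx)

/-- If the subquery rooted at `a` is certain, then it is certain with a fixed key value of `a`. -/
theorem CertainBelow.exists_key (hq : q.SelfJoinFree) (hτ : q.IsPPJT τ R) {a : q}
    {db : Database S} {θ : ℕ → ℕ} (h : CertainBelow τ R a db θ) :
    ∃ k, ∀ r, IsRepair db r → ∃ ν, Embeds τ R a θ ν r ∧ (a.1.inst ν).key = k := by
  classical
  let K : Database S → Set (List ℕ) := fun r =>
    {k | ∃ ν, Embeds τ R a θ ν r ∧ (a.1.inst ν).key = k}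
  have hfin : ∀ r, (K r).Finite := by
    intro r
    refine (r.finite_toSet.image DBFact.key).subset ?_
    rintro k ⟨ν, hν, rfl⟩
    exact ⟨_, hν.2 a (self_mem_subtree hτ.1.1 a), rfl⟩
  -- The swaps below never enlarge the set of root keys; starting at the minimum size, they cannot
  -- shrink it either.
  obtain ⟨r₀, hr₀, hmin⟩ : ∃ r, IsRepair db r ∧ ∀ r', IsRepair db r' →
      (K r).ncard ≤ (K r').ncard := by
    have hne : {r | IsRepair db r}.Nonempty := exists_repair db
    exact ⟨Function.argminOn (fun r => (K r).ncard) _ hne, Function.argminOn_mem _ _ hne,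
      fun r' hr' => Function.argminOn_le (fun r => (K r).ncard) {r | IsRepair db r} hr'⟩
  -- Induction on the number of facts of `s` that are missing from `r`: each swap brings in one of
  -- them and removes no fact of `s`.
  have key : ∀ s, IsRepair db s → ∀ n r, IsRepair db r → K r = K r₀ → (s \ r).card = n →
      K r ⊆ K s := by
    intro s hs n
    induction n using Nat.strong_induction_on with
    | _ n ih =>
    intro r hr hrK hn k hk
    by_contra hks
    obtain ⟨ν, hν, rfl⟩ := hk
    obtain ⟨F, hF, hFs⟩ : ∃ F ∈ subtree τ R a, F.1.inst ν ∉ s := by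
      by_contra! hcon
      exact hks ⟨ν, ⟨hν.1, hcon⟩, rfl⟩
    obtain ⟨B, ⟨hBs, hAB⟩, -⟩ := hs.2 _ (hr.1 (hν.2 F hF))
    obtain ⟨r', hr', hmem⟩ := hr.swap (hs.1 hBs)
    have hsub : K r' ⊆ K r := by
      rintro _ ⟨μ, hμ, rfl⟩
      exact hτ.exists_embeds_of_swap hq hr hF hAB hmem hν hμ
    have hK : K r' = K r := by
      refine Set.eq_of_subset_of_ncard_le hsub ?_ (hfin r)
      rw [hrK]
      exact hmin r' hr'
    have hBr : B ∉ r := fun hBr => hFs (by rw [hr.eq (hν.2 F hF) hBr hAB]; exact hBs)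
    have hlt : (s \ r').card < n := by
      rw [← hn]
      refine Finset.card_lt_card ⟨fun g hg => ?_, fun hsub' => ?_⟩
      · rw [Finset.mem_sdiff, hmem] at hg
        push Not at hg
        refine Finset.mem_sdiff.2 ⟨hg.1, fun hgr => hg.2.1 ?_⟩
        exact (hs.eq hBs hg.1 (hg.2.2 hgr)).symm
      · have := hsub' (Finset.mem_sdiff.2 ⟨hBs, hBr⟩)
        rw [Finset.mem_sdiff, hmem] at this
        exact this.2 (.inl rfl)
    exact hks (ih _ hlt r' hr' (hK.trans hrK) rfl (hK ▸ ⟨ν, hν, rfl⟩))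
  obtain ⟨ν, hν⟩ := h r₀ hr₀
  exact ⟨_, fun s hs => key s hs _ r₀ hr₀ rfl rfl ⟨ν, hν, rfl⟩⟩

theorem mem_iface_iff (hT : τ.IsTree) {a b : q} (h : IsParent τ R a b) {v : ℕ} :
    v ∈ iface τ R b ↔ v ∈ b.1.vars ∧ v ∈ a.1.vars :=
  ⟨fun ⟨h₁, _, h₂, h₃⟩ => ⟨h₁, h₂.unique hT h ▸ h₃⟩, fun ⟨h₁, h₂⟩ => ⟨h₁, a, h, h₂⟩⟩

/-- If the children were distinct, the path from `G` up to `b'` would leave the subtree of `b`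
through `a`, although `a` is not below `b'`. -/
theorem eq_of_mem_subtrees (hT : τ.IsTree) {a b b' G : q} (hb : IsParent τ R a b)
    (hb' : IsParent τ R a b') (hG : G ∈ subtree τ R b) (hG' : G ∈ subtree τ R b') : b = b' := by
  by_contra hne
  have hbb : b' ∉ subtree τ R b := fun h =>
    hb.notMem hT (parent_mem_subtree hT h hne hb')
  obtain ⟨p, -, hs, -⟩ := exists_path_up hT hG'
  have he := edge_mem_of_leaves hT hb hG hbb p
  exact hb'.notMem hT (hs _ (p.snd_mem_support_of_mem_edges he)).1

/-- All facts of the block of `f` match the atom `a` and agree with `θ` on the interface, and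
their instances of the subqueries rooted at the children of `a` are certain. -/
def GoodBlock (τ : SimpleGraph q) (R a : q) (db : Database S) (θ : ℕ → ℕ) (f : DBFact S) : Prop :=
  ∀ g ∈ db, f.KeyEq g → ∃ ν, g = a.1.inst ν ∧ (∀ v ∈ iface τ R a, ν v = θ v) ∧
    ∀ b, IsParent τ R a b → CertainBelow τ R b db ν

/-- Pair pruning is needed from left to right: it fixes one key, hence one block, for all repairs,
and each fact of this block is then tested by forcing it into a repair. From right to left,
embeddings for the children are glued to the fact that the repair selects from the block. -/
theorem certainBelow_iff (hq : q.SelfJoinFree) (hτ : q.IsPPJT τ R) {a : q} {db : Database S}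
    {θ : ℕ → ℕ} :
    CertainBelow τ R a db θ ↔ ∃ f ∈ db, f.rel = a.1.rel ∧ GoodBlock τ R a db θ f := by
  classical
  have hJ := hτ.1
  have hT := hJ.1
  constructor
  · intro h
    obtain ⟨k, hk⟩ := h.exists_key hq hτ
    obtain ⟨r₀, hr₀⟩ := exists_repair db
    obtain ⟨ν₀, hν₀, hkey₀⟩ := hk r₀ hr₀
    refine ⟨a.1.inst ν₀, hr₀.1 (hν₀.2 a (self_mem_subtree hT a)), rfl, ?_⟩
    intro g hg hfg
    have hcontain : ∀ r, IsRepair db r → g ∈ r →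
        ∃ ν, Embeds τ R a θ ν r ∧ a.1.inst ν = g := by
      intro r hr hgr
      obtain ⟨ν, hν, hνk⟩ := hk r hr
      refine ⟨ν, hν, hr.eq (hν.2 a (self_mem_subtree hT a)) hgr ?_⟩
      refine DBFact.KeyEq.trans (g := a.1.inst ν₀) ⟨rfl, ?_⟩ hfg
      rw [hνk, hkey₀]
    obtain ⟨r, hr, hmem⟩ := hr₀.swap hg
    obtain ⟨ν, hν, rfl⟩ := hcontain r hr ((hmem g).2 (.inl rfl))
    refine ⟨ν, rfl, hν.1, ?_⟩
    -- Force `g` into the given repair `s`. The resulting embedding agrees with `ν` on `a`, and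
    -- below `b` it uses no fact of the table of `a`, so these facts were in `s` before.
    intro b hb s hs
    obtain ⟨s', hs', hmem'⟩ := hs.swap hg
    obtain ⟨μ, hμ, hμa⟩ := hcontain s' hs' ((hmem' _).2 (.inl rfl))
    refine ⟨μ, ?_, ?_⟩
    · intro v hv
      exact Atom.inst_eq_iff.1 hμa v ((mem_iface_iff hT hb).1 hv).2
    · intro G hG
      rcases (hmem' _).1 (hμ.2 G (mem_subtree_trans hT hG hb.mem)) with h | h
      · have : G = a := hq.eq (congrArg DBFact.rel h)
        subst this
        exact absurd hG (hb.notMem hT)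
      · exact h.1
  · rintro ⟨f, hf, -, hgood⟩ r hr
    obtain ⟨g, ⟨hgr, hfg⟩, -⟩ := hr.2 f hf
    obtain ⟨ν, rfl, hνθ, hch⟩ := hgood g (hr.1 hgr) hfg
    have hch' : ∀ b, ∃ μ, IsParent τ R a b → Embeds τ R b ν μ r := by
      intro b
      by_cases hb : IsParent τ R a b
      · obtain ⟨μ, hμ⟩ := hch b hb r hr
        exact ⟨μ, fun _ => hμ⟩
      · exact ⟨ν, fun h => absurd h hb⟩
    choose μ hμ using hch'
    -- A variable outside `a` occurs below at most one child, so the chosen child is the right one;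
    -- the value `0` only concerns variables that do not occur in the subtree.
    set κ : ℕ → ℕ := fun v => if v ∈ a.1.vars then ν v else
      if h : ∃ b, IsParent τ R a b ∧ ∃ G ∈ subtree τ R b, v ∈ G.1.vars then μ h.choose v else 0
      with hκ
    have hκa : ∀ v ∈ a.1.vars, κ v = ν v := fun v hv => if_pos hv
    have hκb : ∀ b, IsParent τ R a b → ∀ G ∈ subtree τ R b, ∀ v ∈ G.1.vars, κ v = μ b v := by
      intro b hb G hG v hv
      by_cases hva : v ∈ a.1.vars
      · rw [hκa v hva]
        obtain ⟨h₁, h₂⟩ := hJ.mem_vars hb hG (hb.notMem hT) hv hva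
        exact ((hμ b hb).1 v ((mem_iface_iff hT hb).2 ⟨h₁, h₂⟩)).symm
      · have h : ∃ b, IsParent τ R a b ∧ ∃ G ∈ subtree τ R b, v ∈ G.1.vars := ⟨b, hb, G, hG, hv⟩
        have hκv : κ v = μ h.choose v := by simp only [hκ, if_neg hva, dif_pos h]
        obtain ⟨h₁, G', hG', hv'⟩ := h.choose_spec
        have hbe : h.choose = b := by
          by_contra hne
          have hGb : G' ∉ subtree τ R b := fun hh => hne (eq_of_mem_subtrees hT h₁ hb hG' hh)
          exact hva (hJ.mem_vars hb hG hGb hv hv').2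
        rw [hκv, hbe]
    refine ⟨κ, fun v hv => by rw [hκa v hv.1, hνθ v hv], fun G hG => ?_⟩
    rcases (mem_subtree_cases hT G).1 hG with rfl | ⟨b, hb, hGb⟩
    · rw [Atom.inst_eq_iff.2 hκa]
      exact hgr
    · rw [Atom.inst_eq_iff.2 (hκb b hb G hGb)]
      exact (hμ b hb).2 G hGb

end BCQ

/-! ### Evaluation of stratified programs -/

namespace Datalog

variable {S : Schema}

section Evaluation

variable {P : Set (Rule S)} {rank : Pred S → ℕ} {db : Database S}

theorem stage_mono : Monotone (stage P rank db) :=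
  monotone_nat_of_le_succ fun _ => Set.subset_union_left

/-- The facts of a predicate are complete once the stage exceeds the rank of the predicate. -/
theorem mem_stage_of_mem {f : DFact S} {m n : ℕ} (hf : f ∈ stage P rank db m)
    (hn : ∀ ρ ∈ P, ρ.head.pred = f.1 → rank ρ.head.pred < n) : f ∈ stage P rank db n := by
  induction m with
  | zero => exact stage_mono (Nat.zero_le n) hf
  | succ m ih =>
    rcases hf with hf | ⟨ρ, hρ, hr, ν, rfl, hb⟩
    · exact ih hf
    · have h := hn ρ hρ rfl
      rw [hr] at h
      exact stage_mono h (.inr ⟨ρ, hρ, hr, ν, rfl, hb⟩)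

theorem mem_result {f : DFact S} : f ∈ result P rank db ↔ ∃ n, f ∈ stage P rank db n :=
  Set.mem_iUnion

/-- When a rule fires, the predicates of its body are complete, so even its negated literals have
their final truth values. Hence the stages disappear, and the result is a fixed point of all rules
at once. -/
theorem mem_result_iff (hP : Stratifies P rank) {f : DFact S} :
    f ∈ result P rank db ↔ f ∈ edbFacts db ∨
      ∃ ρ ∈ P, ∃ ν, f = ρ.head.inst ν ∧ ∀ l ∈ ρ.body, l.Holds (result P rank db) ν := by
  have hlit : ∀ ρ ∈ P, ∀ ν, ∀ l ∈ ρ.body,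
      (l.Holds (stage P rank db (rank ρ.head.pred)) ν ↔ l.Holds (result P rank db) ν) := by
    intro ρ hρ ν l hl
    have key : ∀ a : DAtom S, (∀ ρ' ∈ P, ρ'.head.pred = a.pred →
        rank ρ'.head.pred < rank ρ.head.pred) →
        (a.inst ν ∈ stage P rank db (rank ρ.head.pred) ↔ a.inst ν ∈ result P rank db) := by
      intro a ha
      refine ⟨fun h => mem_result.2 ⟨_, h⟩, fun h => ?_⟩
      obtain ⟨n, hn⟩ := mem_result.1 h
      exact mem_stage_of_mem hn ha
    have hs := hP ρ hρ l hl
    cases l with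
    | pos a => exact key a fun ρ' hρ' h => hs ρ' hρ' h.symm
    | neg a => exact not_congr (key a fun ρ' hρ' h => hs ρ' hρ' h.symm)
    | neq s t => exact Iff.rfl
  constructor
  · intro h
    obtain ⟨n, hn⟩ := mem_result.1 h
    induction n with
    | zero => exact .inl hn
    | succ n ih =>
      rcases hn with hn | ⟨ρ, hρ, rfl, ν, rfl, hb⟩
      · exact ih hn
      · exact .inr ⟨ρ, hρ, ν, rfl, fun l hl => (hlit ρ hρ ν l hl).1 (hb l hl)⟩
  · rintro (h | ⟨ρ, hρ, ν, rfl, hb⟩)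
    · exact mem_result.2 ⟨0, h⟩
    · exact mem_result.2 ⟨rank ρ.head.pred + 1,
        .inr ⟨ρ, hρ, rfl, ν, rfl, fun l hl => (hlit ρ hρ ν l hl).2 (hb l hl)⟩⟩

end Evaluation

/-! ### Terms of the rewriting -/

theorem eval_map_inl (ν : ℕ ⊕ ℕ → ℕ) (t : Term ℕ) :
    (t.map Sum.inl).eval ν = t.eval (ν ∘ Sum.inl) := by
  cases t <;> rfl

theorem map_eval_terms (a : Atom S) (ν : ℕ ⊕ ℕ → ℕ) :
    (terms a).map (Term.eval ν) = List.ofFn (a.inst (ν ∘ Sum.inl)).val := by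
  simp only [terms, List.map_ofFn, Atom.inst]
  congr 1
  funext i
  exact eval_map_inl ν _

theorem map_eval_keyTerms (a : Atom S) (ν : ℕ ⊕ ℕ → ℕ) :
    (keyTerms a).map (Term.eval ν) = (a.inst (ν ∘ Sum.inl)).key := by
  rw [keyTerms, List.map_take, map_eval_terms]
  rfl

theorem map_eval_freshTerms (a : Atom S) (ν : ℕ ⊕ ℕ → ℕ) :
    (freshTerms a).map (Term.eval ν) = List.ofFn fun i : Fin (S.arity a.rel) => ν (.inr i) := by
  simp only [freshTerms, List.map_ofFn]
  rfl

theorem map_eval_mixedTerms (a : Atom S) (ν : ℕ ⊕ ℕ → ℕ) :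
    (keyTerms a ++ (freshTerms a).drop (S.keyLen a.rel)).map (Term.eval ν) =
      List.ofFn fun i : Fin (S.arity a.rel) =>
        if i.val < S.keyLen a.rel then (a.args i).eval (ν ∘ Sum.inl) else ν (.inr i) := by
  have hk := S.keyLen_le a.rel
  rw [List.map_append, map_eval_keyTerms, List.map_drop, map_eval_freshTerms]
  apply List.ext_getElem
  · simp [DBFact.key, Atom.inst]
    omega
  · intro n h₁ h₂
    simp only [List.getElem_append, DBFact.key, Atom.inst, List.length_take, List.length_ofFn,
      List.getElem_take, List.getElem_ofFn, List.getElem_drop]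
    simp only [min_eq_left hk]
    split
    · rfl
    · congr 2
      omega

theorem map_eval_commonVars (a b : Atom S) (ν : ℕ ⊕ ℕ → ℕ) :
    (commonVars a b).map (Term.eval ν) =
      ((a.vars ∩ b.vars).sort (· ≤ ·)).map (ν ∘ Sum.inl) := by
  rw [commonVars, List.map_map]
  rfl

theorem mem_edbFacts {db : Database S} {r : S.Rel} {t : Fin (S.arity r) → ℕ} :
    ((Pred.edb r, List.ofFn t) : DFact S) ∈ edbFacts db ↔ ⟨r, t⟩ ∈ db := by
  constructor
  · rintro ⟨⟨r', t'⟩, hg, h⟩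
    simp only [Prod.mk.injEq, Pred.edb.injEq] at h
    obtain ⟨rfl, h⟩ := h
    rw [List.ofFn_injective h]
    exact hg
  · intro h
    exact ⟨_, h, rfl⟩

/-! ### Syntactic properties of the rewriting -/

section Program

variable {q : BCQ S} {τ : SimpleGraph q} {R : q}

theorem head_pred_fkeyRules {a : q} {ρ : Rule S} (h : ρ ∈ fkeyRules τ R a) :
    ρ.head.pred = .fkey a.1.rel := by
  rcases h with (⟨i, t, -, rfl⟩ | ⟨T, -, i, v, -, -, -, rfl⟩) | ⟨b, -, rfl⟩ <;> rfl

theorem head_pred_rule4 {a : q} {ρ : Rule S} (h : ρ ∈ rule4 τ R a) :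
    ρ.head.pred = .join a.1.rel := by
  rcases h with ⟨w, -, ⟨-, rfl⟩ | ⟨-, rfl⟩⟩ <;> rfl

theorem mem_rewriting {ρ : Rule S} :
    ρ ∈ rewriting τ R ↔ ∃ a : q, ρ ∈ fkeyRules τ R a ∨ ρ ∈ rule4 τ R a := by
  simp [rewriting]

theorem finite_rewriting : (rewriting τ R).Finite := by
  refine Set.finite_iUnion fun a => ((Set.Finite.union ?_ ?_).union ?_).union ?_
  · refine (Set.Finite.image2 (fun i t => (⟨⟨.fkey a.1.rel,
      (freshTerms a.1).take (S.keyLen a.1.rel)⟩, [.pos ⟨.edb a.1.rel, freshTerms a.1⟩,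
        .neq (.var (.inr i)) t]⟩ : Rule S))
      (Set.finite_range fun i : Fin (S.arity a.1.rel) => i.val)
      ((Set.finite_range fun i => (a.1.args i).map Sum.inl).union
        (Set.finite_range fun i : Fin (S.arity a.1.rel) =>
          (Term.var (.inr i.val) : DTerm)))).subset ?_
    rintro ρ ⟨i, t, ⟨c, hc, rfl⟩ | ⟨j, v, -, -, -, rfl⟩, rfl⟩
    · exact ⟨_, ⟨i, rfl⟩, _, .inl ⟨i, by simp [hc, Term.map]⟩, rfl⟩
    · exact ⟨_, ⟨i, rfl⟩, _, .inr ⟨j, rfl⟩, rfl⟩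
  · refine (Set.Finite.image2 (fun i v => (⟨⟨.fkey a.1.rel, keyTerms a.1⟩,
      [.pos ⟨.edb a.1.rel, terms a.1⟩,
        .pos ⟨.edb a.1.rel, keyTerms a.1 ++ (freshTerms a.1).drop (S.keyLen a.1.rel)⟩,
        .neq (.var (.inr i)) (.var (.inl v))]⟩ : Rule S))
      (Set.finite_range fun i : Fin (S.arity a.1.rel) => i.val)
      a.1.vars.finite_toSet).subset ?_
    rintro ρ ⟨T, -, i, v, -, hv, -, rfl⟩
    exact ⟨_, ⟨i, rfl⟩, v, Atom.mem_vars.2 ⟨i, hv⟩, rfl⟩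
  · refine (Set.finite_range fun b : q => (⟨⟨.fkey a.1.rel, keyTerms a.1⟩,
      [.pos ⟨.edb a.1.rel, terms a.1⟩,
        .neg ⟨.join b.1.rel, commonVars a.1 b.1⟩]⟩ : Rule S)).subset ?_
    rintro ρ ⟨b, -, rfl⟩
    exact ⟨b, rfl⟩
  · refine (Set.Finite.image2 (fun w l => (⟨⟨.join a.1.rel, w⟩,
      .pos ⟨.edb a.1.rel, terms a.1⟩ :: l⟩ : Rule S))
      ((Set.finite_singleton []).union (Set.finite_range fun T : q => commonVars T.1 a.1))
      (Set.toFinite {[.neg ⟨.fkey a.1.rel, keyTerms a.1⟩], []})).subset ?_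
    rintro ρ ⟨w, hw, hρ⟩
    have hw' : w ∈ ({[]} ∪ Set.range fun T : q => commonVars T.1 a.1 : Set (List DTerm)) := by
      rcases hw with ⟨-, rfl⟩ | ⟨T, -, rfl⟩
      · exact .inl rfl
      · exact .inr ⟨T, rfl⟩
    rcases hρ with ⟨-, rfl⟩ | ⟨-, rfl⟩
    · exact ⟨w, hw', _, .inl rfl, rfl⟩
    · exact ⟨w, hw', _, .inr rfl, rfl⟩

theorem mentions_terms {a : Atom S} {p : Pred S} {v : ℕ} (hv : v ∈ a.vars) :
    (⟨p, terms a⟩ : DAtom S).Mentions (.inl v) := by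
  obtain ⟨i, hi⟩ := Atom.mem_vars.1 hv
  refine ⟨_, (List.mem_ofFn' _ _).2 ⟨i, rfl⟩, ?_⟩
  simp [hi, Term.map, Term.vars]

theorem DAtom.Mentions.of_subset {p p' : Pred S} {l l' : List DTerm} {v : ℕ ⊕ ℕ}
    (h : (⟨p, l⟩ : DAtom S).Mentions v) (hl : l ⊆ l') : (⟨p', l'⟩ : DAtom S).Mentions v := by
  obtain ⟨t, ht, hv⟩ := h
  exact ⟨t, hl ht, hv⟩

theorem mentions_commonVars {a b : Atom S} {p : Pred S} {v : ℕ ⊕ ℕ}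
    (h : (⟨p, commonVars a b⟩ : DAtom S).Mentions v) :
    ∃ u, v = .inl u ∧ u ∈ a.vars ∧ u ∈ b.vars := by
  obtain ⟨t, ht, hv⟩ := h
  simp only [commonVars, List.mem_map, Finset.mem_sort, Finset.mem_inter] at ht
  obtain ⟨u, hu, rfl⟩ := ht
  simp only [Term.vars, Finset.mem_singleton] at hv
  exact ⟨u, hv, hu⟩

theorem mentions_fresh {a : Atom S} {p : Pred S} (i : Fin (S.arity a.rel)) {l : List DTerm}
    (hl : Term.var (.inr i.val) ∈ l) : (⟨p, l⟩ : DAtom S).Mentions (.inr i.val) :=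
  ⟨_, hl, by simp [Term.vars]⟩

theorem fresh_mem {a : Atom S} (i : Fin (S.arity a.rel)) :
    (Term.var (.inr i.val) : DTerm) ∈ freshTerms a :=
  (List.mem_ofFn' _ _).2 ⟨i, rfl⟩

theorem safe_of_mem_rewriting {ρ : Rule S} (h : ρ ∈ rewriting τ R) : ρ.Safe := by
  obtain ⟨a, ((h | h) | h) | h⟩ := mem_rewriting.1 h
  · obtain ⟨i, t, ht, rfl⟩ := h
    intro v hv
    refine ⟨_, List.mem_cons_self, ?_⟩
    rcases hv with hv | ⟨l, hl, hv⟩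
    · exact hv.of_subset (List.take_subset _ _)
    · simp only [List.mem_cons, List.not_mem_nil, or_false] at hl
      rcases hl with rfl | rfl
      · exact hv
      · rcases hv with hv | hv
        · simp only [Term.vars, Finset.mem_singleton] at hv
          subst hv
          exact mentions_fresh i (fresh_mem i)
        · rcases ht with ⟨c, -, rfl⟩ | ⟨j, u, -, -, -, rfl⟩
          · simp [Term.vars] at hv
          · simp only [Term.vars, Finset.mem_singleton] at hv
            subst hv
            exact mentions_fresh j (fresh_mem j)
  · obtain ⟨T, -, i, u, hi, hu, -, rfl⟩ := h
    intro v hv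
    rcases hv with hv | ⟨l, hl, hv⟩
    · exact ⟨_, List.mem_cons_self, hv.of_subset (List.take_subset _ _)⟩
    · simp only [List.mem_cons, List.not_mem_nil, or_false] at hl
      rcases hl with rfl | rfl | rfl
      · exact ⟨_, List.mem_cons_self, hv⟩
      · exact ⟨_, List.mem_cons_of_mem _ List.mem_cons_self, hv⟩
      · rcases hv with hv | hv
        · simp only [Term.vars, Finset.mem_singleton] at hv
          subst hv
          refine ⟨_, List.mem_cons_of_mem _ List.mem_cons_self, mentions_fresh i ?_⟩
          refine List.mem_append_right _ (List.mem_drop_iff_getElem.2 ⟨i - S.keyLen a.1.rel, ?_, ?_⟩)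
          · simp [freshTerms]
            omega
          · simp only [freshTerms, List.getElem_ofFn]
            congr 2
            omega
        · simp only [Term.vars, Finset.mem_singleton] at hv
          subst hv
          exact ⟨_, List.mem_cons_self, mentions_terms (Atom.mem_vars.2 ⟨i, hu⟩)⟩
  · obtain ⟨b, -, rfl⟩ := h
    intro v hv
    refine ⟨_, List.mem_cons_self, ?_⟩
    rcases hv with hv | ⟨l, hl, hv⟩
    · exact hv.of_subset (List.take_subset _ _)
    · simp only [List.mem_cons, List.not_mem_nil, or_false] at hl
      rcases hl with rfl | rfl
      · exact hv
      · obtain ⟨u, rfl, hu, -⟩ := mentions_commonVars hv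
        exact mentions_terms hu
  · obtain ⟨w, hw, hρ⟩ := h
    have hwm : ∀ v, (⟨.join a.1.rel, w⟩ : DAtom S).Mentions v →
        (⟨.edb a.1.rel, terms a.1⟩ : DAtom S).Mentions v := by
      intro v hv
      rcases hw with ⟨-, rfl⟩ | ⟨T, -, rfl⟩
      · obtain ⟨t, ht, -⟩ := hv
        simp at ht
      · obtain ⟨u, rfl, -, hu⟩ := mentions_commonVars hv
        exact mentions_terms hu
    rcases hρ with ⟨-, rfl⟩ | ⟨-, rfl⟩
    · intro v hv
      refine ⟨_, List.mem_cons_self, ?_⟩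
      rcases hv with hv | ⟨l, hl, hv⟩
      · exact hwm v hv
      · simp only [List.mem_cons, List.not_mem_nil, or_false] at hl
        rcases hl with rfl | rfl
        · exact hv
        · exact DAtom.Mentions.of_subset hv (List.take_subset _ _)
    · intro v hv
      refine ⟨_, List.mem_cons_self, ?_⟩
      rcases hv with hv | ⟨l, hl, hv⟩
      · exact hwm v hv
      · simp only [List.mem_cons, List.not_mem_nil, or_false] at hl
        subst hl
        exact hv

/-- The number of atoms in the subtree rooted at the atom with the given table name. -/
noncomputable def subtreeSize (τ : SimpleGraph q) (R : q) (r : S.Rel) : ℕ :=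
  {G : q | ∃ a : q, a.1.rel = r ∧ G ∈ BCQ.subtree τ R a}.ncard

/-- Predicates carry table names instead of atoms; without self-joins, the name identifies the atom.
-/
theorem subtreeSize_eq (hq : q.SelfJoinFree) (a : q) :
    subtreeSize τ R a.1.rel = (BCQ.subtree τ R a).ncard := by
  unfold subtreeSize
  congr 1
  ext G
  constructor
  · rintro ⟨b, hb, hG⟩
    rwa [← hq.eq hb]
  · exact fun h => ⟨a, rfl, h⟩

theorem subtreeSize_lt (hq : q.SelfJoinFree) (hT : τ.IsTree) {a b : q}
    (h : BCQ.IsParent τ R a b) : subtreeSize τ R b.1.rel < subtreeSize τ R a.1.rel := by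
  rw [subtreeSize_eq hq, subtreeSize_eq hq]
  refine Set.ncard_lt_ncard ⟨fun G hG => BCQ.mem_subtree_trans hT hG h.mem, fun hsub => ?_⟩
  exact h.notMem hT (hsub (BCQ.self_mem_subtree hT a))

/-- `fkey` of an atom uses `join` of its children, whose subtrees are smaller, and `join` uses
`fkey` of the same atom: hence twice the size of the subtree, plus one for `join`. -/
theorem exists_stratifies (hq : q.SelfJoinFree) (hT : τ.IsTree) :
    ∃ rank, Stratifies (rewriting τ R) rank := by
  refine ⟨fun
    | .edb _ => 0
    | .fkey r => 2 * subtreeSize τ R r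
    | .join r => 2 * subtreeSize τ R r + 1, ?_⟩
  intro ρ hρ l hl ρ' hρ' hu
  have hedb : ∀ r, ρ'.head.pred ≠ .edb r := by
    intro r
    obtain ⟨b, hb | hb⟩ := mem_rewriting.1 hρ'
    · rw [head_pred_fkeyRules hb]; simp
    · rw [head_pred_rule4 hb]; simp
  obtain ⟨a, ((h | h) | h) | h⟩ := mem_rewriting.1 hρ
  · obtain ⟨i, t, ht, rfl⟩ := h
    simp only [List.mem_cons, List.not_mem_nil, or_false] at hl
    rcases hl with rfl | rfl
    · exact absurd hu.symm (hedb _)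
    · exact hu.elim
  · obtain ⟨T, -, i, u, hi, hu', -, rfl⟩ := h
    simp only [List.mem_cons, List.not_mem_nil, or_false] at hl
    rcases hl with rfl | rfl | rfl
    · exact absurd hu.symm (hedb _)
    · exact absurd hu.symm (hedb _)
    · exact hu.elim
  · obtain ⟨b, hb, rfl⟩ := h
    simp only [List.mem_cons, List.not_mem_nil, or_false] at hl
    rcases hl with rfl | rfl
    · exact absurd hu.symm (hedb _)
    · have hu' : ρ'.head.pred = .join b.1.rel := hu.symm
      rw [hu']
      have := subtreeSize_lt hq hT hb
      show 2 * subtreeSize τ R b.1.rel + 1 < 2 * subtreeSize τ R a.1.rel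
      omega
  · obtain ⟨w, hw, ⟨-, rfl⟩ | ⟨-, rfl⟩⟩ := h
    · simp only [List.mem_cons, List.not_mem_nil, or_false] at hl
      rcases hl with rfl | rfl
      · exact absurd hu.symm (hedb _)
      · have hu' : ρ'.head.pred = .fkey a.1.rel := hu.symm
        rw [hu']
        show 2 * subtreeSize τ R a.1.rel < 2 * subtreeSize τ R a.1.rel + 1
        omega
    · simp only [List.mem_cons, List.not_mem_nil, or_false] at hl
      subst hl
      exact absurd hu.symm (hedb _)

theorem isNonRecursiveProgram_rewriting (hq : q.SelfJoinFree) (hT : τ.IsTree) :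
    IsNonRecursiveProgram (rewriting τ R) :=
  ⟨finite_rewriting, fun _ => safe_of_mem_rewriting, exists_stratifies hq hT⟩

end Program

end Datalog

/-! ### Correctness of the rewriting -/

section

variable {S : Schema}

/-- A fact matches an atom if it has the constants of the atom and equal values at positions with
the same variable. -/
theorem Atom.exists_inst_iff {a : Atom S} {t : Fin (S.arity a.rel) → ℕ} :
    (∃ ν, (⟨a.rel, t⟩ : DBFact S) = a.inst ν) ↔ (∀ i c, a.args i = .const c → t i = c) ∧
      ∀ i j v, a.args i = .var v → a.args j = .var v → t i = t j := by
  classical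
  simp only [Atom.inst, DBFact.mk.injEq, heq_eq_eq, true_and]
  constructor
  · rintro ⟨ν, rfl⟩
    refine ⟨fun i c h => by simp only [h, Term.eval], fun i j v hi hj => ?_⟩
    simp only [hi, hj, Term.eval]
  · rintro ⟨hc, hv⟩
    refine ⟨fun v => if h : ∃ i, a.args i = .var v then t h.choose else 0, ?_⟩
    funext i
    cases h : a.args i with
    | const c => exact hc i c h
    | var v =>
      have h' : ∃ i, a.args i = .var v := ⟨i, h⟩
      simp only [Term.eval, dif_pos h']
      exact hv _ _ v h h'.choose_spec

end

namespace Datalog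

variable {S : Schema} {q : BCQ S} {τ : SimpleGraph q} {R : q} {rank : Pred S → ℕ}
  {db : Database S}

theorem edb_mem_result (hP : Stratifies (rewriting τ R) rank) {r : S.Rel}
    {t : Fin (S.arity r) → ℕ} :
    ((Pred.edb r, List.ofFn t) : DFact S) ∈ result (rewriting τ R) rank db ↔ ⟨r, t⟩ ∈ db := by
  rw [mem_result_iff hP, mem_edbFacts, or_iff_left]
  rintro ⟨ρ, hρ, ν, h, -⟩
  have h' : Pred.edb r = ρ.head.pred := congrArg Prod.fst h
  obtain ⟨b, hb | hb⟩ := mem_rewriting.1 hρ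
  · rw [head_pred_fkeyRules hb] at h'; simp at h'
  · rw [head_pred_rule4 hb] at h'; simp at h'

theorem fkey_mem_result (hq : q.SelfJoinFree) (hP : Stratifies (rewriting τ R) rank) {a : q}
    {k : List ℕ} :
    ((Pred.fkey a.1.rel, k) : DFact S) ∈ result (rewriting τ R) rank db ↔
      ∃ ρ ∈ fkeyRules τ R a, ∃ ν, k = ρ.head.args.map (Term.eval ν) ∧
        ∀ l ∈ ρ.body, l.Holds (result (rewriting τ R) rank db) ν := by
  rw [mem_result_iff hP, or_iff_right]
  · constructor
    · rintro ⟨ρ, hρ, ν, h, hb⟩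
      obtain ⟨b, h' | h'⟩ := mem_rewriting.1 hρ
      · have h1 : Pred.fkey a.1.rel = ρ.head.pred := congrArg Prod.fst h
        rw [head_pred_fkeyRules h'] at h1
        have : a = b := hq.eq (by simpa using h1)
        subst this
        exact ⟨ρ, h', ν, congrArg Prod.snd h, hb⟩
      · have h1 : Pred.fkey a.1.rel = ρ.head.pred := congrArg Prod.fst h
        rw [head_pred_rule4 h'] at h1
        simp at h1
    · rintro ⟨ρ, hρ, ν, rfl, hb⟩
      refine ⟨ρ, mem_rewriting.2 ⟨a, .inl hρ⟩, ν, ?_, hb⟩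
      rw [← head_pred_fkeyRules hρ]
      rfl
  · rintro ⟨g, -, h⟩
    simp at h

theorem join_mem_result (hq : q.SelfJoinFree) (hP : Stratifies (rewriting τ R) rank) {a : q}
    {k : List ℕ} :
    ((Pred.join a.1.rel, k) : DFact S) ∈ result (rewriting τ R) rank db ↔
      ∃ ρ ∈ rule4 τ R a, ∃ ν, k = ρ.head.args.map (Term.eval ν) ∧
        ∀ l ∈ ρ.body, l.Holds (result (rewriting τ R) rank db) ν := by
  rw [mem_result_iff hP, or_iff_right]
  · constructor
    · rintro ⟨ρ, hρ, ν, h, hb⟩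
      obtain ⟨b, h' | h'⟩ := mem_rewriting.1 hρ
      · have h1 : Pred.join a.1.rel = ρ.head.pred := congrArg Prod.fst h
        rw [head_pred_fkeyRules h'] at h1
        simp at h1
      · have h1 : Pred.join a.1.rel = ρ.head.pred := congrArg Prod.fst h
        rw [head_pred_rule4 h'] at h1
        have : a = b := hq.eq (by simpa using h1)
        subst this
        exact ⟨ρ, h', ν, congrArg Prod.snd h, hb⟩
    · rintro ⟨ρ, hρ, ν, rfl, hb⟩
      refine ⟨ρ, mem_rewriting.2 ⟨a, .inr hρ⟩, ν, ?_, hb⟩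
      rw [← head_pred_rule4 hρ]
      rfl
  · rintro ⟨g, -, h⟩
    simp at h

theorem posTerms_holds (hP : Stratifies (rewriting τ R) rank) {a : Atom S} {ν : ℕ ⊕ ℕ → ℕ} :
    (Literal.pos ⟨.edb a.rel, terms a⟩).Holds (result (rewriting τ R) rank db) ν ↔
      a.inst (ν ∘ Sum.inl) ∈ db := by
  simp only [Literal.Holds, DAtom.inst, map_eval_terms]
  exact edb_mem_result hP

/-- The block of a stored fact is marked by `fkey` if it has a fact that does not match the atom,
or two facts that differ at a variable of the parent, or a matching fact without join partner in
a child. -/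
theorem fkey_mem_result_iff (hq : q.SelfJoinFree) (hP : Stratifies (rewriting τ R) rank) {a : q}
    {k : List ℕ} :
    ((Pred.fkey a.1.rel, k) : DFact S) ∈ result (rewriting τ R) rank db ↔
      (∃ t, (⟨a.1.rel, t⟩ : DBFact S) ∈ db ∧ (⟨a.1.rel, t⟩ : DBFact S).key = k ∧
        ¬ ∃ ν, (⟨a.1.rel, t⟩ : DBFact S) = a.1.inst ν) ∨
      (∃ ν t i v, a.1.inst ν ∈ db ∧ (a.1.inst ν).key = k ∧ (⟨a.1.rel, t⟩ : DBFact S) ∈ db ∧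
        (⟨a.1.rel, t⟩ : DBFact S).key = k ∧ S.keyLen a.1.rel ≤ i.val ∧ a.1.args i = .var v ∧
          v ∈ BCQ.iface τ R a ∧ t i ≠ ν v) ∨
      ∃ ν b, a.1.inst ν ∈ db ∧ (a.1.inst ν).key = k ∧ BCQ.IsParent τ R a b ∧
        ((Pred.join b.1.rel, ((a.1.vars ∩ b.1.vars).sort (· ≤ ·)).map ν) : DFact S) ∉
          result (rewriting τ R) rank db := by
  rw [fkey_mem_result hq hP]
  constructor
  · rintro ⟨ρ, (h | h) | h, ν, rfl, hb⟩
    · obtain ⟨i, t, ht, rfl⟩ := h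
      simp only [List.forall_mem_cons, List.not_mem_nil, IsEmpty.forall_iff, implies_true,
        and_true] at hb
      obtain ⟨h1, h2⟩ := hb
      simp only [Literal.Holds, DAtom.inst, map_eval_freshTerms] at h1
      refine .inl ⟨_, (edb_mem_result hP).1 h1, ?_, ?_⟩
      · simp only [List.map_take, map_eval_freshTerms, DBFact.key]
      · rw [Atom.exists_inst_iff]
        rintro ⟨hc, hv⟩
        rcases ht with ⟨c, hi, rfl⟩ | ⟨j, v, -, hi, hj, rfl⟩
        · exact h2 (hc i c hi)
        · exact h2 (hv i j v hi hj)
    · obtain ⟨T, hT, i, v, hi, hv, hvT, rfl⟩ := h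
      simp only [List.forall_mem_cons, List.not_mem_nil, IsEmpty.forall_iff, implies_true,
        and_true] at hb
      obtain ⟨h1, h2, h3⟩ := hb
      rw [posTerms_holds hP] at h1
      simp only [Literal.Holds, DAtom.inst, map_eval_mixedTerms] at h2
      refine .inr (.inl ⟨ν ∘ Sum.inl, _, i, v, h1, (map_eval_keyTerms _ _).symm,
        (edb_mem_result hP).1 h2, ?_, hi, hv, ⟨Atom.mem_vars.2 ⟨i, hv⟩, T, hT, hvT⟩, ?_⟩)
      · simp only [map_eval_keyTerms]
        refine (DBFact.key_eq_iff _ _ _).2 fun j hj => ?_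
        simp only [hj, if_true]
      · rw [if_neg (by omega)]
        exact h3
    · obtain ⟨b, hab, rfl⟩ := h
      simp only [List.forall_mem_cons, List.not_mem_nil, IsEmpty.forall_iff, implies_true,
        and_true] at hb
      obtain ⟨h1, h2⟩ := hb
      rw [posTerms_holds hP] at h1
      simp only [Literal.Holds, DAtom.inst, map_eval_commonVars] at h2
      exact .inr (.inr ⟨ν ∘ Sum.inl, b, h1, (map_eval_keyTerms _ _).symm, hab, h2⟩)
  · rintro (⟨t, ht, rfl, hn⟩ | ⟨ν, t, i, v, hν, rfl, ht, htk, hi, hv, ⟨-, T, hT, hvT⟩, hne⟩ |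
      ⟨ν, b, hν, rfl, hab, hj⟩)
    -- A failure to match violates a constant or an equality between two occurrences of a variable.
    -- The fresh variables receive the entries of `t`; all other values are irrelevant.
    · have hn' : ∃ (i : Fin (S.arity a.1.rel)) (s : DTerm),
          ((∃ c, a.1.args i = .const c ∧ s = .const c) ∨ ∃ j v, j < i ∧ a.1.args i = .var v ∧
            a.1.args j = .var v ∧ s = .var (.inr j.val)) ∧
          t i ≠ s.eval (Sum.elim (fun _ => 0)
            fun n => if h : n < S.arity a.1.rel then t ⟨n, h⟩ else 0) := by
        by_contra! hcon
        refine hn (Atom.exists_inst_iff.2 ⟨fun i c hc => ?_, fun i j v hi hj => ?_⟩)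
        · exact hcon i (.const c) (.inl ⟨c, hc, rfl⟩)
        -- Rule 1 compares a position only with an earlier one, so the later of the two takes the
        -- role of `i`.
        · rcases lt_trichotomy i j with h | rfl | h
          · have := hcon j _ (.inr ⟨i, v, h, hj, hi, rfl⟩)
            simp only [Term.eval, Sum.elim_inr, Fin.is_lt, dite_true] at this
            exact this.symm
          · rfl
          · have := hcon i _ (.inr ⟨j, v, h, hi, hj, rfl⟩)
            simpa only [Term.eval, Sum.elim_inr, Fin.is_lt, dite_true] using this
      obtain ⟨i, s, hs, hne⟩ := hn'
      refine ⟨_, .inl (.inl ⟨i, s, hs, rfl⟩), Sum.elim (fun _ => 0)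
        fun n => if h : n < S.arity a.1.rel then t ⟨n, h⟩ else 0, ?_, ?_⟩
      · simp [List.map_take, map_eval_freshTerms, DBFact.key]
      · simp only [List.forall_mem_cons, List.not_mem_nil, IsEmpty.forall_iff, implies_true,
          and_true]
        refine ⟨?_, ?_⟩
        · simp only [Literal.Holds, DAtom.inst, map_eval_freshTerms]
          rw [edb_mem_result hP]
          simpa using ht
        · simpa [Literal.Holds, Term.eval] using hne
    · refine ⟨_, .inl (.inr ⟨T, hT, i, v, hi, hv, hvT, rfl⟩), Sum.elim ν
        fun n => if h : n < S.arity a.1.rel then t ⟨n, h⟩ else 0, ?_, ?_⟩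
      · exact (map_eval_keyTerms a.1 (Sum.elim ν _)).symm
      · simp only [List.forall_mem_cons, List.not_mem_nil, IsEmpty.forall_iff, implies_true,
          and_true]
        refine ⟨(posTerms_holds hP).2 hν, ?_, ?_⟩
        · simp only [Literal.Holds, DAtom.inst, map_eval_mixedTerms]
          rw [edb_mem_result hP]
          convert ht using 2
          funext j
          split
          · next h => exact ((DBFact.key_eq_iff _ _ _).1 htk j h).symm
          · simp
        · simpa [Literal.Holds, Term.eval] using hne
    · refine ⟨_, .inr ⟨b, hab, rfl⟩, Sum.elim ν fun _ => 0,
        (map_eval_keyTerms a.1 (Sum.elim ν _)).symm, ?_⟩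
      simp only [List.forall_mem_cons, List.not_mem_nil, IsEmpty.forall_iff, implies_true,
        and_true]
      refine ⟨(posTerms_holds hP).2 hν, ?_⟩
      simp only [Literal.Holds, DAtom.inst, map_eval_commonVars]
      exact hj

/-- The list of the variables common to an atom and its parent, empty at the root. -/
def IsIfaceList (τ : SimpleGraph q) (R a : q) (w : List ℕ) : Prop :=
  (a = R ∧ w = []) ∨
    ∃ T, BCQ.IsParent τ R T a ∧ w = (T.1.vars ∩ a.1.vars).sort (· ≤ ·)

theorem IsIfaceList.mem_iff (hT : τ.IsTree) {a : q} {w : List ℕ} (h : IsIfaceList τ R a w)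
    {v : ℕ} : v ∈ w ↔ v ∈ BCQ.iface τ R a := by
  rcases h with ⟨rfl, rfl⟩ | ⟨T, h, rfl⟩
  · simp only [List.not_mem_nil, false_iff]
    rintro ⟨-, T, h, -⟩
    exact BCQ.not_isParent_root hT h
  · rw [BCQ.mem_iface_iff hT h]
    simp [and_comm]

theorem IsIfaceList.unique (hT : τ.IsTree) {a : q} {w w' : List ℕ} (h : IsIfaceList τ R a w)
    (h' : IsIfaceList τ R a w') : w = w' := by
  rcases h with ⟨rfl, rfl⟩ | ⟨T, h, rfl⟩ <;> rcases h' with ⟨h₁, rfl⟩ | ⟨T', h', rfl⟩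
  · rfl
  · exact absurd h' (BCQ.not_isParent_root hT)
  · subst h₁
    exact absurd h (BCQ.not_isParent_root hT)
  · rw [h.unique hT h']

/-- Both forms of rule 4 have the same effect: if no rule defines `fkey` for the atom, no such fact
is ever derived, and the omitted negated literal would hold. -/
theorem join_mem_result_iff (hq : q.SelfJoinFree) (hT : τ.IsTree)
    (hP : Stratifies (rewriting τ R) rank) {a : q} {w : List ℕ} (hw : IsIfaceList τ R a w)
    {θ : ℕ → ℕ} :
    ((Pred.join a.1.rel, w.map θ) : DFact S) ∈ result (rewriting τ R) rank db ↔
      ∃ μ, a.1.inst μ ∈ db ∧ (∀ v ∈ BCQ.iface τ R a, μ v = θ v) ∧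
        ((Pred.fkey a.1.rel, (a.1.inst μ).key) : DFact S) ∉ result (rewriting τ R) rank db := by
  have hagree : ∀ μ : ℕ → ℕ, w.map θ = w.map μ ↔ ∀ v ∈ BCQ.iface τ R a, μ v = θ v := by
    intro μ
    rw [List.map_inj_left]
    exact forall_congr' fun v => by rw [hw.mem_iff hT, eq_comm]
  have hhead : ∀ w' : List DTerm, ((a = R ∧ w' = []) ∨ ∃ T, BCQ.IsParent τ R T a ∧
      w' = commonVars T.1 a.1) ↔ w' = w.map fun v => Term.var (Sum.inl v) := by
    intro w'
    constructor
    · rintro (⟨h, rfl⟩ | ⟨T, h, rfl⟩)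
      · rw [hw.unique hT (.inl ⟨h, rfl⟩)]
        rfl
      · rw [hw.unique hT (.inr ⟨T, h, rfl⟩)]
        rfl
    · rintro rfl
      rcases hw with ⟨h, rfl⟩ | ⟨T, h, rfl⟩
      · exact .inl ⟨h, rfl⟩
      · exact .inr ⟨T, h, rfl⟩
  have heval : ∀ ν : ℕ ⊕ ℕ → ℕ, (w.map fun v => (Term.var (Sum.inl v) : DTerm)).map
      (Term.eval ν) = w.map (ν ∘ Sum.inl) := by
    intro ν
    rw [List.map_map]
    rfl
  rw [join_mem_result hq hP]
  constructor
  · rintro ⟨ρ, ⟨w', hw', hρ⟩, ν, hθ, hb⟩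
    rw [hhead] at hw'
    subst hw'
    rcases hρ with ⟨hne, rfl⟩ | ⟨he, rfl⟩
    · simp only [List.forall_mem_cons, List.not_mem_nil, IsEmpty.forall_iff, implies_true,
        and_true] at hb
      rw [heval] at hθ
      refine ⟨ν ∘ Sum.inl, (posTerms_holds hP).1 hb.1, (hagree _).1 hθ, ?_⟩
      have h2 := hb.2
      simp only [Literal.Holds, DAtom.inst, map_eval_keyTerms] at h2
      exact h2
    · simp only [List.forall_mem_cons, List.not_mem_nil, IsEmpty.forall_iff, implies_true,
        and_true] at hb
      rw [heval] at hθ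
      refine ⟨ν ∘ Sum.inl, (posTerms_holds hP).1 hb, (hagree _).1 hθ, ?_⟩
      rw [fkey_mem_result hq hP, he]
      rintro ⟨ρ, hρ, -⟩
      exact hρ
  · rintro ⟨μ, hμ, hμθ, hf⟩
    have hpos : (Literal.pos ⟨.edb a.1.rel, terms a.1⟩).Holds (result (rewriting τ R) rank db)
        (Sum.elim μ fun _ => 0) := (posTerms_holds hP).2 hμ
    rcases Set.eq_empty_or_nonempty (fkeyRules τ R a) with he | hne
    · refine ⟨_, ⟨_, (hhead _).2 rfl, .inr ⟨he, rfl⟩⟩, Sum.elim μ fun _ => 0, ?_, ?_⟩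
      · rw [heval]
        exact (hagree _).2 hμθ
      · simpa using hpos
    · refine ⟨_, ⟨_, (hhead _).2 rfl, .inl ⟨hne, rfl⟩⟩, Sum.elim μ fun _ => 0, ?_, ?_⟩
      · rw [heval]
        exact (hagree _).2 hμθ
      · simp only [List.forall_mem_cons, List.not_mem_nil, IsEmpty.forall_iff, implies_true,
          and_true]
        refine ⟨hpos, ?_⟩
        simp only [Literal.Holds, DAtom.inst, map_eval_keyTerms]
        exact hf

/-- The three ways in which `fkey` marks a block correspond to the three ways in which `GoodBlock`
fails, with the children handled by induction from the leaves; `certainBelow_iff` does the rest. -/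
theorem join_mem_result_iff_certainBelow (hq : q.SelfJoinFree) (hτ : q.IsPPJT τ R)
    (hP : Stratifies (rewriting τ R) rank) (a : q) :
    ∀ (w : List ℕ) (θ : ℕ → ℕ), IsIfaceList τ R a w →
      (((Pred.join a.1.rel, w.map θ) : DFact S) ∈ result (rewriting τ R) rank db ↔
        BCQ.CertainBelow τ R a db θ) := by
  have hT := hτ.1.1
  induction a using BCQ.subtree_induction (R := R) hT with
  | h a ih =>
  intro w θ hw
  have ih' : ∀ b, BCQ.IsParent τ R a b → ∀ ν : ℕ → ℕ,
      (((Pred.join b.1.rel, ((a.1.vars ∩ b.1.vars).sort (· ≤ ·)).map ν) : DFact S) ∈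
        result (rewriting τ R) rank db ↔ BCQ.CertainBelow τ R b db ν) := fun b hb ν =>
    ih b hb _ ν (.inr ⟨a, hb, rfl⟩)
  rw [join_mem_result_iff hq hT hP hw, BCQ.certainBelow_iff hq hτ]
  constructor
  · rintro ⟨μ, hμ, hμθ, hf⟩
    rw [fkey_mem_result_iff hq hP] at hf
    push Not at hf
    obtain ⟨h1, h2, h3⟩ := hf
    refine ⟨_, hμ, rfl, ?_⟩
    rintro ⟨r, t⟩ hg ⟨hrel, hkey⟩
    obtain rfl : a.1.rel = r := hrel
    obtain ⟨ν, hν⟩ := h1 t hg hkey.symm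
    rw [hν] at hg hkey
    refine ⟨ν, hν, ?_, ?_⟩
    · intro v hv
      rw [← hμθ v hv]
      obtain ⟨i, hi⟩ := Atom.mem_vars.1 hv.1
      -- Rule 2 inspects only non-key positions; at a key position the agreement comes from key
      -- equality.
      by_cases hik : i.val < S.keyLen a.1.rel
      · have := (DBFact.key_eq_iff _ _ _).1 hkey i hik
        simpa [hi, Term.eval] using this.symm
      · have := h2 ν (a.1.inst μ).val i v hg hkey.symm hμ rfl (by omega) hi hv
        simpa [Atom.inst, hi, Term.eval] using this.symm
    · intro b hb
      exact (ih' b hb ν).1 (h3 ν b hg hkey.symm hb)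
  · rintro ⟨⟨r, t⟩, hf, hrel, hgood⟩
    obtain rfl : r = a.1.rel := hrel
    obtain ⟨μ, hμ, hμθ, -⟩ := hgood _ hf (.refl _)
    rw [hμ] at hf
    refine ⟨μ, hf, hμθ, ?_⟩
    rw [fkey_mem_result_iff hq hP]
    rintro (⟨t', ht', hk, hn⟩ | ⟨ν, t', i, v, hν, hk, ht', hk', hi, hv, hvi, hne⟩ |
      ⟨ν, b, hν, hk, hab, hj⟩)
    · obtain ⟨ν, hν, -⟩ := hgood _ ht' (hμ ▸ ⟨rfl, hk.symm⟩)
      exact hn ⟨ν, hν⟩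
    · obtain ⟨ν₁, hν₁, hνθ₁, -⟩ := hgood _ hν (hμ ▸ ⟨rfl, hk.symm⟩)
      obtain ⟨ν₂, hν₂, hνθ₂, -⟩ := hgood _ ht' (hμ ▸ ⟨rfl, hk'.symm⟩)
      apply hne
      rw [Atom.inst_eq_iff.1 hν₁ v hvi.1, hνθ₁ v hvi, ← hνθ₂ v hvi]
      simp only [Atom.inst, DBFact.mk.injEq, heq_eq_eq, true_and] at hν₂
      rw [hν₂]
      simp [hv, Term.eval]
    · obtain ⟨ν₁, hν₁, -, hch⟩ := hgood _ hν (hμ ▸ ⟨rfl, hk.symm⟩)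
      rw [ih' b hab, BCQ.certainBelow_congr (θ' := ν₁)] at hj
      · exact hj (hch b hab)
      · intro v hv
        exact Atom.inst_eq_iff.1 hν₁ v ((BCQ.mem_iface_iff hT hab).1 hv).2

theorem goal_mem_result_iff (hq : q.SelfJoinFree) (hτ : q.IsPPJT τ R)
    (hP : Stratifies (rewriting τ R) rank) :
    goal R ∈ result (rewriting τ R) rank db ↔ q.Certain db := by
  rw [← BCQ.certainBelow_root hτ.1.1 (θ := fun _ => 0),
    ← join_mem_result_iff_certainBelow hq hτ hP R [] _ (.inl ⟨rfl, rfl⟩)]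
  rfl

end Datalog

/-! ### Reasoning about programs -/

namespace RAM

namespace State

@[simp] theorem reg_setReg (σ : State) (x n y : ℕ) :
    (σ.setReg x n).reg y = if y = x then n else σ.reg y := by
  simp [setReg, Function.update_apply]

@[simp] theorem mem_setReg (σ : State) (x n : ℕ) : (σ.setReg x n).mem = σ.mem := rfl

@[simp] theorem reg_setMem (σ : State) (b i n : ℕ) : (σ.setMem b i n).reg = σ.reg := rfl

@[simp] theorem mem_setMem (σ : State) (b i n c : ℕ) :
    (σ.setMem b i n).mem c = if c = b then Function.update (σ.mem b) i n else σ.mem c := by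
  simp [setMem, Function.update_apply]

theorem setReg_self (σ : State) (x : ℕ) : σ.setReg x (σ.reg x) = σ := by
  simp [setReg]

end State

/-- Started in `σ`, the program `p` halts after at most `c` steps in a state with property `Q`. -/
def Runs (p : Prog) (σ : State) (c : ℕ) (Q : State → Prop) : Prop :=
  ∃ t σ', Exec p σ t σ' ∧ t ≤ c ∧ Q σ'

/-- The program without effect. -/
def skip : Prog := .copy 0 0

/-- Consecutive execution. -/
def block : List Prog → Prog
  | [] => skip
  | p :: l => .seq p (block l)

/-- `for i = 0, …, n - 1 do p`, where `i` and `n` are registers. -/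
def forLoop (i n : ℕ) (p : Prog) : Prog :=
  .seq (.const i 0) (.whileNe i n (.seq p (.succ i i)))

variable {p p' : Prog} {σ : State} {c c' : ℕ} {Q Q' : State → Prop}

theorem Runs.mono (h : Runs p σ c Q) (hc : c ≤ c') (hQ : ∀ σ, Q σ → Q' σ) : Runs p σ c' Q' := by
  obtain ⟨t, σ', h, ht, hq⟩ := h
  exact ⟨t, σ', h, ht.trans hc, hQ _ hq⟩

theorem Runs.seq (h : Runs p σ c fun σ' => Runs p' σ' c' Q) : Runs (.seq p p') σ (c + c') Q := by
  obtain ⟨t, σ', h, ht, t', σ'', h', ht', hq⟩ := h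
  exact ⟨_, σ'', h.seq h', add_le_add ht ht', hq⟩

theorem Runs.skip (h : Q σ) : Runs skip σ 1 Q :=
  ⟨1, _, .copy 0 0 σ, le_rfl, by rwa [State.setReg_self]⟩

theorem Runs.block_nil (h : Q σ) : Runs (block []) σ (c + 1) Q :=
  (Runs.skip h).mono (by omega) fun _ => id

variable {l : List Prog}

theorem Runs.block_cons (h : Runs p σ c fun σ' => Runs (block l) σ' c' Q) :
    Runs (block (p :: l)) σ (c + c') Q :=
  h.seq

theorem Runs.of_exec {σ' : State} (he : Exec p σ 1 σ') (h : Runs (block l) σ' c Q) :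
    Runs (block (p :: l)) σ (c + 1) Q := by
  rw [add_comm]
  exact Runs.block_cons ⟨1, σ', he, le_rfl, h⟩

theorem Runs.const {x n : ℕ} (h : Runs (block l) (σ.setReg x n) c Q) :
    Runs (block (.const x n :: l)) σ (c + 1) Q := .of_exec (.const ..) h

theorem Runs.copy {x y : ℕ} (h : Runs (block l) (σ.setReg x (σ.reg y)) c Q) :
    Runs (block (.copy x y :: l)) σ (c + 1) Q := .of_exec (.copy ..) h

theorem Runs.succ {x y : ℕ} (h : Runs (block l) (σ.setReg x (σ.reg y + 1)) c Q) :
    Runs (block (.succ x y :: l)) σ (c + 1) Q := .of_exec (.succ ..) h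

theorem Runs.load {x b y : ℕ} (h : Runs (block l) (σ.setReg x (σ.mem b (σ.reg y))) c Q) :
    Runs (block (.load x b y :: l)) σ (c + 1) Q := .of_exec (.load ..) h

theorem Runs.store {b x y : ℕ} (h : Runs (block l) (σ.setMem b (σ.reg x) (σ.reg y)) c Q) :
    Runs (block (.store b x y :: l)) σ (c + 1) Q := .of_exec (.store ..) h

theorem Runs.ifEq {x y : ℕ} (h : σ.reg x = σ.reg y → Runs p σ c Q)
    (h' : σ.reg x ≠ σ.reg y → Runs p' σ c Q) : Runs (.ifEq x y p p') σ (c + 1) Q := by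
  by_cases hxy : σ.reg x = σ.reg y
  · obtain ⟨t, σ', he, ht, hq⟩ := h hxy
    exact ⟨t + 1, σ', .ifEq_true hxy he, by omega, hq⟩
  · obtain ⟨t, σ', he, ht, hq⟩ := h' hxy
    exact ⟨t + 1, σ', .ifEq_false hxy he, by omega, hq⟩

theorem Runs.load' {x b y v : ℕ} (hv : σ.mem b (σ.reg y) = v)
    (h : Runs (block l) (σ.setReg x v) c Q) : Runs (block (.load x b y :: l)) σ (c + 1) Q :=
  .load (hv ▸ h)

theorem Runs.store' {x b y i v : ℕ} (hi : σ.reg x = i) (hv : σ.reg y = v)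
    (h : Runs (block l) (σ.setMem b i v) c Q) : Runs (block (.store b x y :: l)) σ (c + 1) Q :=
  .store (hi ▸ hv ▸ h)

theorem Runs.ifEq_copy_const {x y z w n v : ℕ}
    (hv : (if σ.reg x = σ.reg y then σ.reg w else n) = v)
    (h : Runs (block l) (σ.setReg z v) c Q) :
    Runs (block (.ifEq x y (.copy z w) (.const z n) :: l)) σ (c + 2) Q := by
  rw [add_comm]
  subst hv
  refine Runs.block_cons (Runs.ifEq (c := 1) (fun he => ?_) fun he => ?_)
  · rw [if_pos he] at h
    exact ⟨1, _, .copy .., le_rfl, h⟩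
  · rw [if_neg he] at h
    exact ⟨1, _, .const .., le_rfl, h⟩

theorem Runs.ifEq_copy {x y z w v : ℕ} (hv : (if σ.reg x = σ.reg y then σ.reg w else σ.reg z) = v)
    (h : Runs (block l) (σ.setReg z v) c Q) :
    Runs (block (.ifEq x y (.copy z w) RAM.skip :: l)) σ (c + 2) Q := by
  rw [add_comm]
  subst hv
  refine Runs.block_cons (Runs.ifEq (c := 1) (fun he => ?_) fun he => ?_)
  · rw [if_pos he] at h
    exact ⟨1, _, .copy .., le_rfl, h⟩
  · rw [if_neg he, State.setReg_self] at h
    exact .skip h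

theorem Runs.ifEq_succ {x y z v : ℕ} (hv : (if σ.reg x = σ.reg y then σ.reg z + 1 else σ.reg x) = v)
    (h : Runs (block l) (σ.setReg x v) c Q) :
    Runs (block (.ifEq x y (.succ x z) RAM.skip :: l)) σ (c + 2) Q := by
  rw [add_comm]
  subst hv
  refine Runs.block_cons (Runs.ifEq (c := 1) (fun he => ?_) fun he => ?_)
  · rw [if_pos he] at h
    exact ⟨1, _, .succ .., le_rfl, h⟩
  · rw [if_neg he, State.setReg_self] at h
    exact .skip h

/-- Each round pays `c` for the body and `2` for increment and test; the final `2` pays for the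
initialization and the last test. The invariant is required after the increment. -/
theorem Runs.forLoop {i n N : ℕ} (Inv : ℕ → State → Prop) (h0 : Inv 0 (σ.setReg i 0))
    (hreg : ∀ k σ, Inv k σ → σ.reg i = k ∧ σ.reg n = N)
    (hstep : ∀ k σ, k < N → Inv k σ →
      Runs p σ c fun σ' => σ'.reg i = k ∧ Inv (k + 1) (σ'.setReg i (k + 1))) :
    Runs (forLoop i n p) σ ((c + 2) * N + 2) (Inv N) := by
  have key : ∀ m k σ, k + m = N → Inv k σ →
      Runs (.whileNe i n (.seq p (.succ i i))) σ ((c + 2) * m + 1) (Inv N) := by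
    intro m
    induction m with
    | zero =>
      rintro k σ rfl hk
      obtain ⟨h1, h2⟩ := hreg k σ hk
      exact ⟨1, σ, .while_done (h1.trans h2.symm), by omega, hk⟩
    | succ m ih =>
      intro k σ hkm hk
      obtain ⟨h1, h2⟩ := hreg k σ hk
      obtain ⟨t, σ', he, ht, hi, hinv⟩ := hstep k σ (by omega) hk
      obtain ⟨t', σ'', he', ht', hq⟩ := ih (k + 1) _ (by omega) hinv
      have hs := Exec.succ i i σ'
      rw [hi] at hs
      refine ⟨_, σ'', .while_step (by omega) (he.seq hs) he', ?_, hq⟩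
      have : (c + 2) * (m + 1) = (c + 2) * m + c + 2 := by ring
      omega
  obtain ⟨t, σ', he, ht, hq⟩ := key N 0 _ (by omega) h0
  exact ⟨_, σ', (Exec.const i 0 σ).seq he, by omega, hq⟩

/-- For walks along linked lists: the items still to be visited parametrize the invariant and bound
the number of rounds. -/
theorem Runs.whileNe_list {α : Type*} {x y : ℕ} (Inv : List α → State → Prop)
    (hnil : ∀ σ, Inv [] σ → σ.reg x = σ.reg y)
    (hcons : ∀ a l σ, Inv (a :: l) σ → σ.reg x ≠ σ.reg y ∧ Runs p σ c (Inv l)) (L : List α)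
    (h0 : Inv L σ) : Runs (.whileNe x y p) σ ((c + 1) * L.length + 1) (Inv []) := by
  induction L generalizing σ with
  | nil => exact ⟨1, σ, .while_done (hnil σ h0), by omega, h0⟩
  | cons a L ih =>
    obtain ⟨hne, t, σ', he, ht, hinv⟩ := hcons a L σ h0
    obtain ⟨t', σ'', he', ht', hq⟩ := ih hinv
    refine ⟨_, σ'', .while_step hne he he', ?_, hq⟩
    have : (c + 1) * (L.length + 1) = (c + 1) * L.length + c + 1 := by ring
    simp only [List.length_cons]
    omega

/-! ### Columns computable in linear time -/

/-- Linked lists in memory, with the successors of the nodes given by `nxt` and the first node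
`s`; the list ends at the value `e`. -/
def Linked (nxt : ℕ → ℕ) (e : ℕ) : ℕ → List ℕ → Prop
  | s, [] => s = e
  | s, n :: l => s = n ∧ n ≠ e ∧ Linked nxt e (nxt n) l

theorem Linked.update {nxt : ℕ → ℕ} {e s i v : ℕ} {l : List ℕ} (h : Linked nxt e s l)
    (hi : i ∉ l) : Linked (Function.update nxt i v) e s l := by
  induction l generalizing s with
  | nil => exact h
  | cons n l ih =>
    obtain ⟨h1, h2, h3⟩ := h
    simp only [List.mem_cons, not_or] at hi
    refine ⟨h1, h2, ?_⟩
    rw [Function.update_of_ne (Ne.symm hi.1)]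
    exact ih h3 hi.2

theorem Linked.insert {nxt : ℕ → ℕ} {e s i p : ℕ} {l₁ l₂ : List ℕ}
    (h : Linked nxt e s (l₁ ++ p :: l₂)) (hnd : (l₁ ++ p :: l₂).Nodup)
    (hi : i ∉ l₁ ++ p :: l₂) (hie : i ≠ e) :
    Linked (Function.update (Function.update nxt i (nxt p)) p i) e s (l₁ ++ p :: i :: l₂) := by
  induction l₁ generalizing s with
  | nil =>
    obtain ⟨h1, h2, h3⟩ := h
    simp only [List.nil_append, List.mem_cons, not_or, List.nodup_cons] at hi hnd
    refine ⟨h1, h2, ?_⟩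
    rw [Function.update_self]
    refine ⟨rfl, hie, ?_⟩
    rw [Function.update_of_ne hi.1, Function.update_self]
    exact (h3.update hi.2).update hnd.1
  | cons n l ih =>
    obtain ⟨h1, h2, h3⟩ := h
    simp only [List.cons_append, List.mem_cons, not_or, List.nodup_cons, List.mem_append] at hi hnd
    refine ⟨h1, h2, ?_⟩
    rw [Function.update_of_ne (by tauto), Function.update_of_ne (by tauto)]
    exact ih h3 hnd.2 (by simpa using hi.2)

/-- The first index at which `f` takes the same value as at `i`. -/
noncomputable def firstIdx {α : Type*} (f : ℕ → α) (i : ℕ) : ℕ := sInf {j | f j = f i}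

section firstIdx

variable {α : Type*} {f : ℕ → α} {i j : ℕ}

theorem apply_firstIdx : f (firstIdx f i) = f i := Nat.sInf_mem (s := {j | f j = f i}) ⟨i, rfl⟩

theorem firstIdx_le (h : f j = f i) : firstIdx f i ≤ j := Nat.sInf_le h

theorem firstIdx_eq_iff : firstIdx f i = firstIdx f j ↔ f i = f j := by
  constructor
  · intro h
    exact (apply_firstIdx (f := f)).symm.trans ((congrArg f h).trans apply_firstIdx)
  · intro h
    unfold firstIdx
    rw [h]

theorem firstIdx_eq_self (h : ∀ j < i, f j ≠ f i) : firstIdx f i = i := by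
  by_contra hne
  exact h _ (lt_of_le_of_ne (firstIdx_le rfl) hne) apply_firstIdx

end firstIdx

/-- Links the rows `0, …, N - 1`, whose classes are stored in array `kc`, to a list in which each
class is contiguous. -/
def linkRows (kc b : ℕ) : Prog :=
  .seq (.copy 4 1) (forLoop 2 1 (block [.const 10 0, .load 5 kc 2, .load 6 (b + 1) 5,
    .ifEq 6 10
      (block [.store (b + 3) 2 4, .copy 4 2, .const 7 1, .store (b + 1) 5 7, .store (b + 2) 5 2])
      (block [.load 7 (b + 2) 5, .load 8 (b + 3) 7, .store (b + 3) 2 8, .store (b + 3) 7 2])]))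

/-- A row of a new class goes to the front of the list, any other row directly behind the first row
of its class. So the first indices of the classes never increase along the list; as a first index
determines its class, each class is contiguous. Array `b + 1` flags the classes seen, `b + 2` holds
their first rows, `b + 3` the links; `N` is the end mark. -/
theorem runs_linkRows {kc b N : ℕ} {cls : ℕ → ℕ} {σ : State} (hk : kc < b) (hN : σ.reg 1 = N)
    (hcls : ∀ i < N, σ.mem kc i = cls i) (hz : ∀ i, σ.mem (b + 1) i = 0) :
    Runs (linkRows kc b) σ (13 * N + 3) fun σ' => σ'.reg 1 = N ∧
      (∀ c, c ≠ b + 1 → c ≠ b + 2 → c ≠ b + 3 → σ'.mem c = σ.mem c) ∧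
      ∃ l, l.Perm (List.range N) ∧ Linked (σ'.mem (b + 3)) N (σ'.reg 4) l ∧
        l.Pairwise fun i j => firstIdx cls j ≤ firstIdx cls i := by
  have hk1 : ∀ m, kc ≠ b + m := fun m => by omega
  let Inv : ℕ → State → Prop := fun k τ => τ.reg 2 = k ∧ τ.reg 1 = N ∧
    (∀ c, c ≠ b + 1 → c ≠ b + 2 → c ≠ b + 3 → τ.mem c = σ.mem c) ∧
    (∀ a, τ.mem (b + 1) a = 0 → ∀ j < k, cls j ≠ a) ∧
    (∀ a, τ.mem (b + 1) a ≠ 0 → τ.mem (b + 2) a < k ∧ cls (τ.mem (b + 2) a) = a ∧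
      firstIdx cls (τ.mem (b + 2) a) = τ.mem (b + 2) a) ∧
    ∃ l, l.Perm (List.range k) ∧ Linked (τ.mem (b + 3)) N (τ.reg 4) l ∧
        l.Pairwise fun i j => firstIdx cls j ≤ firstIdx cls i
  have hloop : Runs (forLoop 2 1 (block [.const 10 0, .load 5 kc 2, .load 6 (b + 1) 5,
    .ifEq 6 10
      (block [.store (b + 3) 2 4, .copy 4 2, .const 7 1, .store (b + 1) 5 7, .store (b + 2) 5 2])
      (block [.load 7 (b + 2) 5, .load 8 (b + 3) 7, .store (b + 3) 2 8, .store (b + 3) 7 2])]))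
      (σ.setReg 4 (σ.reg 1)) ((11 + 2) * N + 2) (Inv N) := by
    refine Runs.forLoop Inv ?_ (fun k τ h => ⟨h.1, h.2.1⟩) ?_
    · refine ⟨rfl, ?_, fun c _ _ _ => rfl, by simp, ?_, [], by simp, ?_, by simp⟩
      · simpa [State.reg_setReg] using hN
      · intro a ha
        exact absurd (hz a) ha
      · simpa [Linked, State.reg_setReg] using hN
    · rintro k τ hkN ⟨h2, h1, hframe, hno, hyes, l, hperm, hlink, hpw⟩
      have hlk : ∀ n ∈ l, n < k := fun n hn => List.mem_range.1 (hperm.mem_iff.1 hn)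
      have hkl : k ∉ l := fun h => (hlk k h).false
      have hck : τ.mem kc k = cls k := by
        rw [hframe kc (hk1 _) (hk1 _) (hk1 _)]
        exact hcls k hkN
      refine Runs.const (Runs.load (Runs.load (c := 8) ?_))
      simp only [State.reg_setReg, State.mem_setReg, h2]
      norm_num
      rw [hck]
      refine Runs.block_cons (c := 7) (c' := 1) (Runs.ifEq (c := 6) (fun he => ?_) fun he => ?_)
      · simp only [State.reg_setReg] at he
        norm_num at he
        refine Runs.store (Runs.copy (Runs.const (Runs.store (Runs.store
          (Runs.block_nil (Runs.block_nil ?_))))))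
        have hnoa := hno _ he
        refine ⟨by simp [State.reg_setReg, State.reg_setMem, h2], ?_⟩
        refine ⟨by simp [State.reg_setReg], by simpa [State.reg_setReg, State.reg_setMem] using h1,
          ?_, ?_, ?_, k :: l, ?_, ?_, ?_⟩
        · intro c hc1 hc2 hc3
          simp [State.mem_setReg, State.mem_setMem, hc1, hc2, hc3, hframe c hc1 hc2 hc3]
        · intro a
          simp only [State.mem_setReg, State.mem_setMem, State.reg_setReg, State.reg_setMem]
          norm_num
          simp only [Function.update_apply]
          split_ifs with h
          · simp
          · intro ha j hj
            rcases Nat.lt_or_eq_of_le hj with hj | rfl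
            · exact hno a ha j hj
            · exact Ne.symm h
        · intro a
          simp only [State.mem_setReg, State.mem_setMem, State.reg_setReg, State.reg_setMem]
          norm_num
          simp only [Function.update_apply]
          split_ifs with h
          · intro _
            rw [h, h2]
            exact ⟨by omega, rfl, firstIdx_eq_self hnoa⟩
          · intro ha
            obtain ⟨h3, h4⟩ := hyes a ha
            exact ⟨by omega, h4⟩
        · rw [List.range_succ]
          exact (hperm.cons k).trans (List.perm_append_singleton k _).symm
        · simp only [State.mem_setReg, State.mem_setMem, State.reg_setReg, State.reg_setMem]
          norm_num
          rw [h2]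
          refine ⟨rfl, by omega, ?_⟩
          rw [Function.update_self]
          exact hlink.update hkl
        · refine List.pairwise_cons.2 ⟨fun n hn => ?_, hpw⟩
          rw [firstIdx_eq_self hnoa]
          exact (firstIdx_le rfl).trans (hlk n hn).le
      · simp only [State.reg_setReg] at he
        norm_num at he
        obtain ⟨hp1, hp2, hp3⟩ := hyes _ he
        set p := τ.mem (b + 2) (cls k) with hp
        have hpl : p ∈ l := hperm.mem_iff.2 (List.mem_range.2 hp1)
        obtain ⟨l₁, l₂, rfl⟩ := List.append_of_mem hpl
        have hfk : firstIdx cls k = p := by rw [← hp3]; exact firstIdx_eq_iff.2 hp2.symm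
        refine Runs.load (Runs.load (Runs.store (Runs.store (c := 2)
          (Runs.block_nil (Runs.block_nil ?_)))))
        simp only [State.mem_setReg, State.reg_setReg, State.reg_setMem]
        norm_num
        rw [h2, ← hp]
        refine ⟨by simp, by simp, by simpa using h1, ?_, ?_, ?_, l₁ ++ p :: k :: l₂, ?_, ?_, ?_⟩
        · intro c hc1 hc2 hc3
          simp [State.mem_setReg, State.mem_setMem, hc3, hframe c hc1 hc2 hc3]
        · intro a
          simp only [State.mem_setReg, State.mem_setMem]
          norm_num
          intro ha j hj
          rcases Nat.lt_or_eq_of_le hj with hj | rfl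
          · exact hno a ha j hj
          · rintro rfl
            exact he ha
        · intro a
          simp only [State.mem_setReg, State.mem_setMem]
          norm_num
          intro ha
          obtain ⟨h3, h4⟩ := hyes a ha
          exact ⟨by omega, h4⟩
        · rw [List.range_succ]
          refine List.Perm.trans ?_ (hperm.append_right [k])
          simp only [List.append_assoc, List.cons_append]
          exact ((List.perm_append_singleton k l₂).symm.cons p).append_left l₁
        · simp only [State.mem_setReg, State.mem_setMem, State.reg_setReg, State.reg_setMem]
          norm_num
          exact hlink.insert (hperm.nodup_iff.2 List.nodup_range) hkl (by omega)
        · rw [List.pairwise_append, List.pairwise_cons] at hpw ⊢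
          obtain ⟨hw1, ⟨hw2, hw3⟩, hw4⟩ := hpw
          refine ⟨hw1, ⟨?_, List.pairwise_cons.2 ⟨?_, hw3⟩⟩, ?_⟩
          · intro n hn
            rcases List.mem_cons.1 hn with rfl | hn
            · rw [hfk, hp3]
            · exact hw2 n hn
          · intro n hn
            rw [hfk, ← hp3]
            exact hw2 n hn
          · intro m hm n hn
            simp only [List.mem_cons] at hn
            rcases hn with rfl | rfl | hn
            · exact hw4 m hm _ List.mem_cons_self
            · rw [hfk, ← hp3]
              exact hw4 m hm _ List.mem_cons_self
            · exact hw4 m hm _ (List.mem_cons_of_mem _ hn)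
  have := Runs.seq (p := .copy 4 1) (c := 1) ⟨1, _, Exec.copy 4 1 σ, le_rfl, hloop⟩
  refine this.mono (by omega) fun τ hτ => ?_
  obtain ⟨-, h1, hframe, -, -, hl⟩ := hτ
  exact ⟨h1, hframe, hl⟩

end RAM

/-! ### Numbering the rows by pairs of values -/

namespace RAM

/-- Walks along the linked list of the rows and gives the rows with equal values in the columns
`kc` and `kv` the same nonzero number. -/
def numberRows (kc kv b : ℕ) : Prog :=
  .whileNe 4 1 (block [.load 5 kc 4, .load 6 kv 4, .load 7 (b + 5) 6, .load 8 (b + 4) 6,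
    .const 10 0, .ifEq 7 5 (.copy 9 8) (.const 9 0), .ifEq 9 10 (.succ 9 4) skip,
    .store (b + 4) 6 9, .store (b + 5) 6 5, .store (b + 6) 4 9, .load 4 (b + 3) 4])

/-- For each value of the second column, `b + 4` and `b + 5` keep only the number and the class of
the latest pair. Since classes are contiguous, a pair has occurred before iff the remembered class
is the current one. Numbers are row indices plus one, so `0` in `b + 4` marks an unseen value, and
the initial content of `b + 5` does not matter. -/
theorem runs_numberRows {kc kv b N : ℕ} {cls col : ℕ → ℕ} {σ : State} (hkc : kc < b) (hkv : kv < b)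
    (hN : σ.reg 1 = N) (hcls : ∀ i < N, σ.mem kc i = cls i) (hcol : ∀ i < N, σ.mem kv i = col i)
    (hz : ∀ i, σ.mem (b + 4) i = 0) {L : List ℕ} (hperm : L.Perm (List.range N))
    (hlink : Linked (σ.mem (b + 3)) N (σ.reg 4) L)
    (hpw : L.Pairwise fun i j => firstIdx cls j ≤ firstIdx cls i) :
    Runs (numberRows kc kv b) σ (15 * N + 1) fun σ' => σ'.reg 1 = N ∧
      (∀ c, c ≠ b + 4 → c ≠ b + 5 → c ≠ b + 6 → σ'.mem c = σ.mem c) ∧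
      ∀ i < N, ∀ j < N, σ'.mem (b + 6) i = σ'.mem (b + 6) j ↔ (cls i, col i) = (cls j, col j) := by
  have hk1 : ∀ m, kc ≠ b + m := fun m => by omega
  have hk2 : ∀ m, kv ≠ b + m := fun m => by omega
  have hlen : L.length = N := by simpa using hperm.length_eq
  let Inv : List ℕ → State → Prop := fun l τ => ∃ P, P ++ l = L ∧ τ.reg 1 = N ∧
    (∀ c, c ≠ b + 4 → c ≠ b + 5 → c ≠ b + 6 → τ.mem c = σ.mem c) ∧
    Linked (σ.mem (b + 3)) N (τ.reg 4) l ∧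
    (∀ i ∈ P, ∃ r ∈ P, τ.mem (b + 6) i = r + 1 ∧ (cls r, col r) = (cls i, col i)) ∧
    (∀ i ∈ P, ∀ j ∈ P, (cls i, col i) = (cls j, col j) → τ.mem (b + 6) i = τ.mem (b + 6) j) ∧
    (∀ v, τ.mem (b + 4) v ≠ 0 → ∃ r ∈ P, τ.mem (b + 4) v = τ.mem (b + 6) r ∧ col r = v ∧
      cls r = τ.mem (b + 5) v ∧ ∀ i ∈ P, col i = v → firstIdx cls r ≤ firstIdx cls i) ∧
    ∀ v, τ.mem (b + 4) v = 0 → ∀ i ∈ P, col i ≠ v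
  have hrun := Runs.whileNe_list (x := 4) (y := 1) (c := 14)
    (p := block [.load 5 kc 4, .load 6 kv 4, .load 7 (b + 5) 6, .load 8 (b + 4) 6,
    .const 10 0, .ifEq 7 5 (.copy 9 8) (.const 9 0), .ifEq 9 10 (.succ 9 4) skip,
    .store (b + 4) 6 9, .store (b + 5) 6 5, .store (b + 6) 4 9, .load 4 (b + 3) 4])
    Inv ?_ ?_ L (σ := σ) ?_
  · rw [hlen] at hrun
    refine hrun.mono le_rfl ?_
    rintro τ ⟨P, hP, h1, hframe, -, hid, hsame, -, -⟩
    rw [List.append_nil] at hP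
    subst hP
    refine ⟨h1, hframe, fun i hi j hj => ⟨fun h => ?_, hsame i ?_ j ?_⟩⟩
    · obtain ⟨r, hr, hri, hri'⟩ := hid i (hperm.mem_iff.2 (List.mem_range.2 hi))
      obtain ⟨s, hs, hsj, hsj'⟩ := hid j (hperm.mem_iff.2 (List.mem_range.2 hj))
      have : r = s := by omega
      rw [← hri', ← hsj', this]
    · exact hperm.mem_iff.2 (List.mem_range.2 hi)
    · exact hperm.mem_iff.2 (List.mem_range.2 hj)
  · rintro τ ⟨P, -, h1, -, hl, -⟩
    exact Eq.trans hl h1.symm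
  · rintro k l τ ⟨P, hP, h1, hframe, ⟨h4, hkN', hl⟩, hid, hsame, hyes, hno⟩
    refine ⟨by rw [h4, h1]; exact hkN', ?_⟩
    have hkL : k ∈ L := by rw [← hP]; simp
    have hkN : k < N := List.mem_range.1 (hperm.mem_iff.1 hkL)
    have hck : τ.mem kc k = cls k := by
      rw [hframe kc (hk1 _) (hk1 _) (hk1 _)]
      exact hcls k hkN
    have hvk : τ.mem kv k = col k := by
      rw [hframe kv (hk2 _) (hk2 _) (hk2 _)]
      exact hcol k hkN
    have hnx : τ.mem (b + 3) = σ.mem (b + 3) := hframe _ (by omega) (by omega) (by omega)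
    have hord : ∀ i ∈ P, firstIdx cls k ≤ firstIdx cls i := by
      intro i hi
      rw [← hP, List.pairwise_append] at hpw
      exact hpw.2.2 i hi k List.mem_cons_self
    have hkP : k ∉ P := by
      have hnd : L.Nodup := hperm.nodup_iff.2 List.nodup_range
      rw [← hP, List.nodup_append] at hnd
      exact fun h => hnd.2.2 k h k List.mem_cons_self rfl
    -- `r₀` is the number remembered for the pair of row `k`, or `0` if the pair is new; in the
    -- latter case `r₁` becomes `k + 1`.
    set r₀ := if τ.mem (b + 5) (col k) = cls k then τ.mem (b + 4) (col k) else 0 with hr₀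
    set r₁ := if r₀ = 0 then k + 1 else r₀ with hr₁
    refine Runs.load' (v := cls k) (by simp [h4, hck]) ?_
    refine Runs.load' (v := col k) (by simp [h4, hvk]) ?_
    refine Runs.load' (v := τ.mem (b + 5) (col k)) (by simp) ?_
    refine Runs.load' (v := τ.mem (b + 4) (col k)) (by simp) ?_
    refine Runs.const (Runs.ifEq_copy_const (v := r₀) (by simp [hr₀]) ?_)
    refine Runs.ifEq_succ (v := r₁) (by simp [hr₁, h4]) ?_
    refine Runs.store' (i := col k) (v := r₁) (by simp) (by simp) ?_
    refine Runs.store' (i := col k) (v := cls k) (by simp) (by simp) ?_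
    refine Runs.store' (i := k) (v := r₁) (by simp [h4]) (by simp) ?_
    refine Runs.load' (v := σ.mem (b + 3) k) (by simp [h4, hnx]) (Runs.block_nil (c := 0) ?_)
    refine ⟨P ++ [k], by rw [← hP]; simp, by simpa using h1, ?_, by simpa using hl, ?_⟩
    · intro c hc1 hc2 hc3
      simp [hc1, hc2, hc3, hframe c hc1 hc2 hc3]
    simp only [State.mem_setReg, State.mem_setMem]
    norm_num
    have hid_new : ∀ i ∈ P, Function.update (τ.mem (b + 6)) k r₁ i = τ.mem (b + 6) i := fun i hi =>
      Function.update_of_ne (by rintro rfl; exact hkP hi) _ _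
    have hne : r₁ ≠ 0 := by
      rw [hr₁]
      split_ifs with h
      · omega
      · exact h
    have hcases : (r₁ = k + 1 ∧ ∀ i ∈ P, (cls i, col i) ≠ (cls k, col k)) ∨
        ∃ r ∈ P, r₁ = τ.mem (b + 6) r ∧ (cls r, col r) = (cls k, col k) := by
      by_cases h0 : r₀ = 0
      · refine .inl ⟨if_pos h0, ?_⟩
        intro i hi he
        simp only [Prod.mk.injEq] at he
        have hne4 : τ.mem (b + 4) (col k) ≠ 0 := fun h => hno _ h i hi he.2
        obtain ⟨r, hr, -, -, hr3, hr4⟩ := hyes _ hne4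
        have h5 : τ.mem (b + 5) (col k) ≠ cls k := by
          intro h5
          rw [hr₀, if_pos h5] at h0
          exact hne4 h0
        apply h5
        -- The remembered row `r` has the least first index among the visited rows with this value,
        -- so that of `r` is at most that of `i`, which equals that of `k`; by the order of the list
        -- it is also at least that of `k`.
        rw [← hr3, ← firstIdx_eq_iff (f := cls)]
        refine le_antisymm ?_ (hord r hr)
        rw [← firstIdx_eq_iff.2 he.1]
        exact hr4 i hi he.2
      · have h5 : τ.mem (b + 5) (col k) = cls k := by
          by_contra h5
          exact h0 (if_neg h5)
        have h4 : r₀ = τ.mem (b + 4) (col k) := if_pos h5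
        obtain ⟨r, hr, hr1, hr2, hr3, -⟩ := hyes (col k) (h4 ▸ h0)
        refine .inr ⟨r, hr, ?_, by rw [hr3, hr2, h5]⟩
        rw [hr₁, if_neg h0, h4, hr1]
    have hself : Function.update (τ.mem (b + 6)) k r₁ k = r₁ := Function.update_self ..
    refine ⟨?_, ?_, ?_, ?_⟩
    · rintro i (hi | rfl)
      · obtain ⟨r, hr, hr1, hr2⟩ := hid i hi
        simp only [Prod.mk.injEq] at hr2
        exact .inl ⟨r, hr, by rw [hid_new i hi, hr1], hr2⟩
      · rcases hcases with ⟨hB, -⟩ | ⟨r, hr, hr1, hr2⟩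
        · exact .inr ⟨by rw [hself, hB], rfl, rfl⟩
        · obtain ⟨s, hs, hs1, hs2⟩ := hid r hr
          have := hs2.trans hr2
          simp only [Prod.mk.injEq] at this
          exact .inl ⟨s, hs, by rw [hself, hr1, hs1], this⟩
    · have hmix : ∀ i ∈ P, cls i = cls k → col i = col k → τ.mem (b + 6) i = r₁ := by
        intro i hi h1 h2
        rcases hcases with ⟨-, hB⟩ | ⟨r, hr, hr1, hr2⟩
        · exact absurd (by rw [h1, h2]) (hB i hi)
        · rw [hr1]
          exact hsame i hi r hr (by rw [hr2, h1, h2])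
      rintro i (hi | rfl) j (hj | rfl) h1 h2
      · rw [hid_new i hi, hid_new j hj]
        exact hsame i hi j hj (by rw [h1, h2])
      · rw [hid_new i hi, hself]
        exact hmix i hi h1 h2
      · rw [hid_new j hj, hself]
        exact (hmix j hj h1.symm h2.symm).symm
      · rfl
    · intro v
      by_cases hv : v = col k
      · subst hv
        intro _
        refine .inr ⟨Function.update_self .., rfl, by rw [Function.update_self], ?_⟩
        rintro i (hi | rfl) -
        · exact hord i hi
        · exact le_rfl
      · rw [Function.update_of_ne hv, Function.update_of_ne hv]
        intro h
        obtain ⟨r, hr, hr1, hr2, hr3, hr4⟩ := hyes v h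
        refine .inl ⟨r, hr, by rw [hid_new r hr, hr1], hr2, hr3, ?_⟩
        rintro i (hi | rfl) hiv
        · exact hr4 i hi hiv
        · exact absurd hiv.symm hv
    · intro v
      by_cases hv : v = col k
      · subst hv
        rw [Function.update_self]
        exact fun h => absurd h hne
      · rw [Function.update_of_ne hv]
        rintro h i (hi | rfl)
        · exact hno v h i hi
        · exact Ne.symm hv
  · exact ⟨[], rfl, hN, fun c _ _ _ => rfl, hlink, by simp, by simp,
      fun v hv => absurd (hz v) hv, by simp⟩

/-- Replaces class numbers in array `ki` by the successors of the first indices of the classes. -/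
def firstRows (ki b' b : ℕ) : Prog :=
  forLoop 2 1 (block [.load 5 ki 2, .load 9 b' 5, .const 10 0, .ifEq 9 10 (.succ 9 2) skip,
    .store b' 5 9, .store b 2 9])

/-- Makes the class numbers canonical, so that the column is a function of the table alone, as
`Layout.Comp` requires. The offset `1` keeps `0` free for classes not met yet. -/
theorem runs_firstRows {α : Type*} {ki b' b N : ℕ} {f : ℕ → α} {σ : State} (h1 : ki ≠ b)
    (h2 : ki ≠ b') (h3 : b ≠ b') (hN : σ.reg 1 = N) (hz : ∀ i, σ.mem b' i = 0)
    (hf : ∀ i < N, ∀ j < N, σ.mem ki i = σ.mem ki j ↔ f i = f j) :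
    Runs (firstRows ki b' b) σ (10 * N + 2) fun σ' => σ'.reg 1 = N ∧
      (∀ c, c ≠ b → c ≠ b' → σ'.mem c = σ.mem c) ∧
      ∀ i < N, σ'.mem b i = firstIdx f i + 1 := by
  let Inv : ℕ → State → Prop := fun k τ => τ.reg 2 = k ∧ τ.reg 1 = N ∧
    (∀ c, c ≠ b → c ≠ b' → τ.mem c = σ.mem c) ∧
    (∀ i < k, τ.mem b i = firstIdx f i + 1) ∧
    (∀ i < k, τ.mem b' (σ.mem ki i) = firstIdx f i + 1) ∧
    ∀ v, (∀ i < k, σ.mem ki i ≠ v) → τ.mem b' v = 0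
  refine (Runs.forLoop (c := 8) Inv ?_ (fun k τ h => ⟨h.1, h.2.1⟩) ?_).mono le_rfl ?_
  · exact ⟨rfl, by simpa using hN, fun c _ _ => rfl, by simp, by simp, fun v _ => hz v⟩
  · rintro k τ hkN ⟨hr2, hr1, hframe, hout, hold, hnew⟩
    have hki : τ.mem ki = σ.mem ki := hframe ki h1 h2
    set a := σ.mem ki k with ha
    have hval : (if τ.mem b' a = 0 then k + 1 else τ.mem b' a) = firstIdx f k + 1 := by
      by_cases hex : ∃ i < k, σ.mem ki i = a
      · obtain ⟨i, hi, hia⟩ := hex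
        have h := hold i hi
        rw [hia] at h
        rw [h, if_neg (by omega), firstIdx_eq_iff.2 ((hf i (by omega) k hkN).1 hia)]
      · push Not at hex
        rw [hnew a hex, if_pos rfl, firstIdx_eq_self]
        exact fun j hj hfj => hex j hj ((hf j (by omega) k hkN).2 hfj)
    refine Runs.load' (v := a) (by rw [hr2, hki]) ?_
    refine Runs.load' (v := τ.mem b' a) (by simp) ?_
    refine Runs.const (Runs.ifEq_succ (v := firstIdx f k + 1) (by simpa [hr2] using hval) ?_)
    refine Runs.store' (i := a) (v := firstIdx f k + 1) (by simp) (by simp) ?_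
    refine Runs.store' (i := k) (v := firstIdx f k + 1) (by simp [hr2]) (by simp)
      (Runs.block_nil (c := 0) ?_)
    refine ⟨by simp [hr2], by simp, by simpa using hr1, ?_, ?_, ?_, ?_⟩
    · intro c hc hc'
      simp [hc, hc', hframe c hc hc']
    · intro i hi
      simp only [State.mem_setReg, State.mem_setMem, if_true, if_neg h3, Function.update_apply]
      split_ifs with hik
      · rw [hik]
      · exact hout i (by omega)
    · intro i hi
      simp only [State.mem_setReg, State.mem_setMem, if_true, if_neg h3.symm, Function.update_apply]
      split_ifs with hik
      · rcases Nat.lt_succ_iff_lt_or_eq.1 hi with hi | rfl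
        · rw [firstIdx_eq_iff.2 ((hf i (by omega) k hkN).1 hik)]
        · rfl
      · refine hold i (lt_of_le_of_ne (by omega) ?_)
        rintro rfl
        exact hik rfl
    · intro v hv
      simp only [State.mem_setReg, State.mem_setMem, if_true, if_neg h3.symm, Function.update_apply]
      rw [if_neg (Ne.symm (hv k (by omega)))]
      exact hnew v fun i hi => hv i (by omega)
  · rintro τ ⟨-, hr1, hframe, hout, -⟩
    exact ⟨hr1, hframe, hout⟩

end RAM

/-! ### Closure properties of the columns computable in linear time -/

namespace RAM

/-- A family of tables with `N x` rows, whose columns are stored in the arrays below `size`. -/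
structure Layout (X : Type*) where
  numRows : X → ℕ
  size : ℕ
  column : X → ℕ → ℕ → ℕ

namespace Layout

variable {X : Type*} {A : Layout X}

/-- The columns are in place, register `1` holds the number of rows, and the arrays from `b` on
are empty. -/
def Ready (A : Layout X) (b : ℕ) (x : X) (σ : State) : Prop :=
  σ.reg 1 = A.numRows x ∧ (∀ c < A.size, σ.mem c = A.column x c) ∧
    ∀ c, b ≤ c → ∀ i, σ.mem c i = 0

/-- The column `F` can be computed in linear time. -/
def Comp (A : Layout X) (F : X → ℕ → ℕ) : Prop :=
  ∀ b, A.size ≤ b → ∃ p k b' C, b ≤ b' ∧ k < b' ∧ ∀ x σ, A.Ready b x σ →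
    Runs p σ (C * (A.numRows x + 1)) fun σ' => A.Ready b' x σ' ∧
      (∀ c < b, σ'.mem c = σ.mem c) ∧ ∀ i < A.numRows x, σ'.mem k i = F x i

theorem Comp.congr {F G : X → ℕ → ℕ} (hF : A.Comp F)
    (h : ∀ x, ∀ i < A.numRows x, F x i = G x i) : A.Comp G := by
  intro b hb
  obtain ⟨p, k, b', C, h1, h2, h3⟩ := hF b hb
  refine ⟨p, k, b', C, h1, h2, fun x σ hσ => (h3 x σ hσ).mono le_rfl ?_⟩
  rintro τ ⟨ht1, ht2, ht3⟩
  exact ⟨ht1, ht2, fun i hi => (ht3 i hi).trans (h x i hi)⟩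

theorem comp_column {c : ℕ} (hc : c < A.size) : A.Comp fun x => A.column x c := by
  intro b hb
  refine ⟨skip, c, b, 1, le_rfl, by omega, fun x σ hσ => (Runs.skip ?_).mono (by omega)
    fun _ => id⟩
  exact ⟨hσ, fun _ _ => rfl, fun i _ => by rw [hσ.2.1 c hc]⟩

/-- Finitely many computable columns can be computed together. -/
theorem comp_all (n : ℕ) (F : Fin n → X → ℕ → ℕ) (hF : ∀ j, A.Comp (F j)) (b : ℕ)
    (hb : A.size ≤ b) : ∃ p, ∃ k : Fin n → ℕ, ∃ b' C, b ≤ b' ∧ (∀ j, k j < b') ∧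
      ∀ x σ, A.Ready b x σ → Runs p σ (C * (A.numRows x + 1)) fun σ' => A.Ready b' x σ' ∧
        (∀ c < b, σ'.mem c = σ.mem c) ∧ ∀ j, ∀ i < A.numRows x, σ'.mem (k j) i = F j x i := by
  induction n with
  | zero =>
    refine ⟨skip, Fin.elim0, b, 1, le_rfl, fun j => j.elim0, fun x σ hσ =>
      (Runs.skip ?_).mono (by omega) fun _ => id⟩
    exact ⟨hσ, fun _ _ => rfl, fun j => j.elim0⟩
  | succ n ih =>
    obtain ⟨p, k, b₁, C, h1, h2, h3⟩ := ih (fun j => F j.castSucc) fun j => hF _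
    obtain ⟨p', k', b₂, C', h1', h2', h3'⟩ := hF (Fin.last n) b₁ (hb.trans h1)
    refine ⟨.seq p p', Fin.snoc k k', b₂, C + C', h1.trans h1', ?_, ?_⟩
    · intro j
      refine Fin.lastCases ?_ (fun j => ?_) j
      · simpa using h2'
      · simpa using (h2 j).trans_le h1'
    · intro x σ hσ
      rw [add_mul]
      refine Runs.seq ((h3 x σ hσ).mono le_rfl ?_)
      rintro τ ⟨ht1, ht2, ht3⟩
      refine (h3' x τ ht1).mono le_rfl ?_
      rintro υ ⟨hu1, hu2, hu3⟩
      refine ⟨hu1, fun c hc => (hu2 c (by omega)).trans (ht2 c hc), fun j => ?_⟩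
      refine Fin.lastCases ?_ (fun j => ?_) j
      · simpa using hu3
      · intro i hi
        simp only [Fin.snoc_castSucc]
        rw [hu2 _ (h2 j)]
        exact ht3 j i hi

/-- Arrays are allocated like a stack that only grows: a step gets `w` untouched arrays from `b` on,
delivers its result in the first, and its scratch arrays are never reused. This is why they may be
assumed to be zero. -/
theorem Comp.of_step {n : ℕ} {F : Fin n → X → ℕ → ℕ} (hF : ∀ j, A.Comp (F j)) {G : X → ℕ → ℕ}
    (h : ∀ (b : ℕ) (k : Fin n → ℕ), (∀ j, k j < b) → ∃ p w C, 0 < w ∧ ∀ x σ,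
      σ.reg 1 = A.numRows x → (∀ j, ∀ i < A.numRows x, σ.mem (k j) i = F j x i) →
      (∀ c, b ≤ c → ∀ i, σ.mem c i = 0) → Runs p σ (C * (A.numRows x + 1)) fun σ' =>
        σ'.reg 1 = A.numRows x ∧ (∀ c, c < b ∨ b + w ≤ c → σ'.mem c = σ.mem c) ∧
          ∀ i < A.numRows x, σ'.mem b i = G x i) : A.Comp G := by
  intro b hb
  obtain ⟨p, k, b₁, C, h1, h2, h3⟩ := comp_all n F hF b hb
  obtain ⟨p', w, C', hw, h4⟩ := h b₁ k h2
  refine ⟨.seq p p', b₁, b₁ + w, C + C', by omega, by omega, fun x σ hσ => ?_⟩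
  rw [add_mul]
  refine Runs.seq ((h3 x σ hσ).mono le_rfl ?_)
  rintro τ ⟨ht1, ht2, ht3⟩
  refine (h4 x τ ht1.1 ht3 ht1.2.2).mono le_rfl ?_
  rintro υ ⟨hu1, hu2, hu3⟩
  refine ⟨⟨hu1, fun c hc => ?_, fun c hc i => ?_⟩, fun c hc => ?_, hu3⟩
  · rw [hu2 c (.inl (by omega)), ht1.2.1 c hc]
  · rw [hu2 c (.inr hc), ht1.2.2 c (by omega)]
  · rw [hu2 c (.inl (by omega)), ht2 c hc]

theorem comp_const (n : ℕ) : A.Comp fun _ _ => n := by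
  refine Comp.of_step (n := 0) (F := Fin.elim0) (fun j => j.elim0) fun b k _ =>
    ⟨forLoop 2 1 (block [.const 5 n, .store b 2 5]), 1, 5, one_pos, fun x σ hN _ hz => ?_⟩
  let Inv : ℕ → State → Prop := fun k τ => τ.reg 2 = k ∧ τ.reg 1 = A.numRows x ∧
    (∀ c, c ≠ b → τ.mem c = σ.mem c) ∧ ∀ i < k, τ.mem b i = n
  refine (Runs.forLoop (c := 3) Inv ?_ (fun k τ h => ⟨h.1, h.2.1⟩) ?_).mono (by omega) ?_
  · exact ⟨rfl, by simpa using hN, fun c _ => rfl, by simp⟩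
  · rintro k τ hkN ⟨hr2, hr1, hframe, hout⟩
    refine Runs.const (Runs.store' (i := k) (v := n) (by simp [hr2]) (by simp)
      (Runs.block_nil (c := 0) ?_))
    refine ⟨by simp [hr2], by simp, by simpa using hr1, ?_, ?_⟩
    · intro c hc
      simp [hc, hframe c hc]
    · intro i hi
      simp only [State.mem_setReg, State.mem_setMem, if_true, Function.update_apply]
      split_ifs with hik
      · rfl
      · exact hout i (by omega)
  · rintro τ ⟨-, hr1, hframe, hout⟩
    exact ⟨hr1, fun c hc => hframe c (by omega), hout⟩

theorem Comp.ite_eq {F G H K : X → ℕ → ℕ} (hF : A.Comp F) (hG : A.Comp G) (hH : A.Comp H)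
    (hK : A.Comp K) : A.Comp fun x i => if F x i = G x i then H x i else K x i := by
  refine Comp.of_step (n := 4) (F := ![F, G, H, K]) (fun j => by fin_cases j <;> assumption)
    fun b k hk => ⟨forLoop 2 1 (block [.load 5 (k 0) 2, .load 6 (k 1) 2, .load 7 (k 2) 2,
      .load 8 (k 3) 2, .ifEq 5 6 (.copy 8 7) skip, .store b 2 8]), 1, 10, one_pos,
      fun x σ hN hcol _ => ?_⟩
  let Inv : ℕ → State → Prop := fun k τ => τ.reg 2 = k ∧ τ.reg 1 = A.numRows x ∧
    (∀ c, c ≠ b → τ.mem c = σ.mem c) ∧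
    ∀ i < k, τ.mem b i = if F x i = G x i then H x i else K x i
  refine (Runs.forLoop (c := 8) Inv ?_ (fun k τ h => ⟨h.1, h.2.1⟩) ?_).mono (by omega) ?_
  · exact ⟨rfl, by simpa using hN, fun c _ => rfl, by simp⟩
  · rintro m τ hkN ⟨hr2, hr1, hframe, hout⟩
    have hm : ∀ j, τ.mem (k j) m = (![F, G, H, K] : Fin 4 → X → ℕ → ℕ) j x m := by
      intro j
      rw [hframe _ (hk j).ne]
      exact hcol j m hkN
    refine Runs.load' (v := F x m) (by simp [hr2, hm]) ?_
    refine Runs.load' (v := G x m) (by simp [hr2, hm]) ?_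
    refine Runs.load' (v := H x m) (by simp [hr2, hm]) ?_
    refine Runs.load' (v := K x m) (by simp [hr2, hm]) ?_
    refine Runs.ifEq_copy (v := if F x m = G x m then H x m else K x m) (by simp) ?_
    refine Runs.store' (i := m) (v := if F x m = G x m then H x m else K x m) (by simp [hr2])
      (by simp) (Runs.block_nil (c := 0) ?_)
    refine ⟨by simp [hr2], by simp, by simpa using hr1, ?_, ?_⟩
    · intro c hc
      simp [hc, hframe c hc]
    · intro i hi
      simp only [State.mem_setReg, State.mem_setMem, if_true, Function.update_apply]
      by_cases hik : i = m
      · rw [if_pos hik, hik]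
      · rw [if_neg hik]
        exact hout i (by omega)
  · rintro τ ⟨-, hr1, hframe, hout⟩
    exact ⟨hr1, fun c hc => hframe c (by omega), hout⟩

-- Two passes: the first sets a flag at the address given by the class of each row with nonzero `P`,
-- the second reads the flag of the class of each row. Class values serve directly as addresses.
open Classical in
theorem Comp.exists_class {cls P : X → ℕ → ℕ} (hcls : A.Comp cls) (hP : A.Comp P) :
    A.Comp fun x i => if ∃ j < A.numRows x, cls x j = cls x i ∧ P x j ≠ 0 then 1 else 0 := by
  refine Comp.of_step (n := 2) (F := ![cls, P]) (fun j => by fin_cases j <;> assumption)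
    fun b k hk => ⟨.seq (forLoop 2 1 (block [.load 5 (k 1) 2, .load 6 (k 0) 2, .load 7 (b + 1) 6,
      .const 10 0, .ifEq 5 10 (.copy 9 7) (.const 9 1), .store (b + 1) 6 9]))
      (forLoop 2 1 (block [.load 6 (k 0) 2, .load 7 (b + 1) 6, .store b 2 7])), 2, 16, two_pos,
      fun x σ hN hcol hz => ?_⟩
  have hkb : ∀ j, k j ≠ b := fun j => (hk j).ne
  have hkb' : ∀ j, k j ≠ b + 1 := fun j => ((hk j).trans (Nat.lt_succ_self b)).ne
  let flag : ℕ → ℕ → ℕ := fun m a => if ∃ j < m, cls x j = a ∧ P x j ≠ 0 then 1 else 0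
  let Inv : ℕ → State → Prop := fun m τ => τ.reg 2 = m ∧ τ.reg 1 = A.numRows x ∧
    (∀ c, c ≠ b + 1 → τ.mem c = σ.mem c) ∧ ∀ a, τ.mem (b + 1) a = flag m a
  let Inv' : ℕ → State → Prop := fun m τ => τ.reg 2 = m ∧ τ.reg 1 = A.numRows x ∧
    (∀ c, c ≠ b → c ≠ b + 1 → τ.mem c = σ.mem c) ∧
    (∀ a, τ.mem (b + 1) a = flag (A.numRows x) a) ∧
    ∀ i < m, τ.mem b i = flag (A.numRows x) (cls x i)
  have h1 := Runs.forLoop (σ := σ) (c := 8) (i := 2) (n := 1) (N := A.numRows x)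
    (p := block [.load 5 (k 1) 2, .load 6 (k 0) 2, .load 7 (b + 1) 6,
      .const 10 0, .ifEq 5 10 (.copy 9 7) (.const 9 1), .store (b + 1) 6 9]) Inv ?_
    (fun k τ h => ⟨h.1, h.2.1⟩) ?_
  · refine (Runs.seq (c' := 6 * A.numRows x + 2) (h1.mono le_rfl fun τ hτ => ?_)).mono
      (c := 10 * A.numRows x + 2 + (6 * A.numRows x + 2)) (by omega) fun _ => id
    obtain ⟨-, hr1, hframe, hflag⟩ := hτ
    refine (Runs.forLoop (c := 4) (N := A.numRows x) Inv' ?_ (fun k τ h => ⟨h.1, h.2.1⟩) ?_).mono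
      le_rfl ?_
    · exact ⟨rfl, by simpa using hr1, fun c _ hc => hframe c hc, hflag, by simp⟩
    · rintro m υ hm ⟨hr2, hr1, hframe, hflag, hout⟩
      have hck : υ.mem (k 0) m = cls x m := by
        rw [hframe _ (hkb 0) (hkb' 0)]
        exact hcol 0 m hm
      refine Runs.load' (v := cls x m) (by simp [hr2, hck]) ?_
      refine Runs.load' (v := flag (A.numRows x) (cls x m)) (by simp [hflag]) ?_
      refine Runs.store' (i := m) (v := flag (A.numRows x) (cls x m)) (by simp [hr2]) (by simp)
        (Runs.block_nil (c := 0) ?_)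
      refine ⟨by simp [hr2], by simp, by simpa using hr1, ?_, ?_, ?_⟩
      · intro c hc hc'
        simp [hc, hframe c hc hc']
      · simpa using hflag
      · intro i hi
        simp only [State.mem_setReg, State.mem_setMem, if_true, Function.update_apply]
        by_cases hik : i = m
        · rw [if_pos hik, hik]
        · rw [if_neg hik]
          exact hout i (by omega)
    · rintro υ ⟨-, hr1, hframe, -, hout⟩
      exact ⟨hr1, fun c hc => hframe c (by omega) (by omega), hout⟩
  · refine ⟨rfl, by simpa using hN, fun c _ => rfl, fun a => ?_⟩
    simp [flag, hz (b + 1) (by omega)]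
  · rintro m υ hm ⟨hr2, hr1, hframe, hflag⟩
    have hck : υ.mem (k 0) m = cls x m := by
      rw [hframe _ (hkb' 0)]
      exact hcol 0 m hm
    have hpk : υ.mem (k 1) m = P x m := by
      rw [hframe _ (hkb' 1)]
      exact hcol 1 m hm
    set v := if P x m = 0 then flag m (cls x m) else 1 with hv
    refine Runs.load' (v := P x m) (by simp [hr2, hpk]) ?_
    refine Runs.load' (v := cls x m) (by simp [hr2, hck]) ?_
    refine Runs.load' (v := flag m (cls x m)) (by simp [hflag]) ?_
    refine Runs.const (Runs.ifEq_copy_const (v := v) (by simp [hv]) ?_)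
    refine Runs.store' (i := cls x m) (v := v) (by simp) (by simp) (Runs.block_nil (c := 0) ?_)
    refine ⟨by simp [hr2], by simp, by simpa using hr1, ?_, ?_⟩
    · intro c hc
      simp [hc, hframe c hc]
    · intro a
      simp only [State.mem_setReg, State.mem_setMem, if_true, Function.update_apply]
      have hex : (∃ j < m + 1, cls x j = a ∧ P x j ≠ 0) ↔
          (∃ j < m, cls x j = a ∧ P x j ≠ 0) ∨ (cls x m = a ∧ P x m ≠ 0) := by
        constructor
        · rintro ⟨j, hj, h⟩
          rcases Nat.lt_succ_iff_lt_or_eq.1 hj with hj | rfl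
          · exact .inl ⟨j, hj, h⟩
          · exact .inr h
        · rintro (⟨j, hj, h⟩ | h)
          · exact ⟨j, by omega, h⟩
          · exact ⟨m, by omega, h⟩
      simp only [flag, hex]
      by_cases ha : a = cls x m
      · subst ha
        by_cases hp : P x m = 0
        · simp [hv, hp, flag]
        · simp [hv, hp]
      · have ha' : ¬ cls x m = a := fun h => ha h.symm
        simp [ha, ha', hflag, flag]

/-- Rows with equal values in two columns can be identified by a single column. -/
theorem Comp.pair {F G : X → ℕ → ℕ} (hF : A.Comp F) (hG : A.Comp G) :
    A.Comp fun x i => firstIdx (fun j => (F x j, G x j)) i + 1 := by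
  -- Eight arrays: `b + 1` to `b + 3` for linking, `b + 4` to `b + 6` for numbering, `b + 7` for the
  -- first rows, `b` for the result. The constant `38` is `13 + 15 + 10`.
  refine Comp.of_step (n := 2) (F := ![F, G]) (fun j => by fin_cases j <;> assumption)
    fun b k hk => ⟨.seq (linkRows (k 0) b) (.seq (numberRows (k 0) (k 1) b)
      (firstRows (b + 6) (b + 7) b)), 8, 38, by norm_num, fun x σ hN hcol hz => ?_⟩
  refine (Runs.seq (c := 13 * A.numRows x + 3)
    (c' := 15 * A.numRows x + 1 + (10 * A.numRows x + 2)) ?_).mono (by omega) fun _ => id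
  have hkb : ∀ j m, k j ≠ b + m := fun j m => by have := hk j; omega
  refine (runs_linkRows (cls := F x) (hk 0) hN (hcol 0) (hz (b + 1) (by omega))).mono le_rfl ?_
  rintro τ ⟨hr1, hframe, l, hperm, hlink, hpw⟩
  refine Runs.seq ?_
  refine (runs_numberRows (cls := F x) (col := G x) (hk 0) (hk 1) hr1 ?_ ?_ ?_ hperm hlink
    hpw).mono le_rfl ?_
  · intro i hi
    rw [hframe _ (hkb _ _) (hkb _ _) (hkb _ _)]
    exact hcol 0 i hi
  · intro i hi
    rw [hframe _ (hkb _ _) (hkb _ _) (hkb _ _)]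
    exact hcol 1 i hi
  · intro i
    rw [hframe _ (by omega) (by omega) (by omega)]
    exact hz _ (by omega) i
  rintro υ ⟨hr1', hframe', hid⟩
  refine (runs_firstRows (f := fun j => (F x j, G x j)) (by omega) (by omega) (by omega) hr1' ?_
    hid).mono le_rfl ?_
  · intro i
    rw [hframe' _ (by omega) (by omega) (by omega), hframe _ (by omega) (by omega) (by omega)]
    exact hz _ (by omega) i
  rintro ω ⟨hr1'', hframe'', hout⟩
  refine ⟨hr1'', fun c hc => ?_, hout⟩
  rw [hframe'' c (by omega) (by omega), hframe' c (by omega) (by omega) (by omega),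
    hframe c (by omega) (by omega) (by omega)]

/-- The column that numbers the rows by their values in finitely many columns. -/
theorem exists_comp_class {ι : Type*} (s : Finset ι) {F : ι → X → ℕ → ℕ}
    (hF : ∀ c ∈ s, A.Comp (F c)) :
    ∃ cls, A.Comp cls ∧ ∀ x i j, cls x i = cls x j ↔ ∀ c ∈ s, F c x i = F c x j := by
  classical
  induction s using Finset.induction_on with
  | empty => exact ⟨_, comp_const 0, by simp⟩
  | insert c s hc ih =>
    obtain ⟨cls, hcls, h⟩ := ih fun c' hc' => hF c' (Finset.mem_insert_of_mem hc')
    refine ⟨_, hcls.pair (hF c (Finset.mem_insert_self c s)), fun x i j => ?_⟩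
    rw [Nat.add_right_cancel_iff, firstIdx_eq_iff, Prod.mk.injEq, h]
    simp [and_comm]

/-! ### Computable properties of rows -/

open Classical in
/-- The property `P` of rows can be computed in linear time. -/
def CompProp (A : Layout X) (P : X → ℕ → Prop) : Prop :=
  A.Comp fun x i => if P x i then 1 else 0

variable {P Q : X → ℕ → Prop}

theorem CompProp.congr (hP : A.CompProp P) (h : ∀ x, ∀ i < A.numRows x, P x i ↔ Q x i) :
    A.CompProp Q := by
  classical
  exact Comp.congr hP fun x i hi => if_congr (h x i hi) rfl rfl

theorem Comp.eq {F G : X → ℕ → ℕ} (hF : A.Comp F) (hG : A.Comp G) :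
    A.CompProp fun x i => F x i = G x i := by
  refine (hF.ite_eq hG (comp_const 1) (comp_const 0)).congr fun x i _ => ?_
  by_cases h : F x i = G x i <;> simp [h]

open Classical in
theorem CompProp.ite (hP : A.CompProp P) {F G : X → ℕ → ℕ} (hF : A.Comp F) (hG : A.Comp G) :
    A.Comp fun x i => if P x i then F x i else G x i := by
  refine (Comp.ite_eq hP (comp_const 1) hF hG).congr fun x i _ => ?_
  by_cases h : P x i <;> simp [h]

theorem CompProp.not (hP : A.CompProp P) : A.CompProp fun x i => ¬ P x i := by
  classical
  refine (hP.ite (comp_const 0) (comp_const 1)).congr fun x i _ => ?_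
  by_cases h : P x i <;> simp [h]

theorem CompProp.and (hP : A.CompProp P) (hQ : A.CompProp Q) :
    A.CompProp fun x i => P x i ∧ Q x i := by
  classical
  refine (hP.ite hQ (comp_const 0)).congr fun x i _ => ?_
  by_cases h : P x i <;> simp [h]

theorem compProp_true : A.CompProp fun _ _ => True :=
  (comp_const 1).congr fun _ _ _ => by simp

/-- The truth value does not depend on the input, so it is built into the program. -/
theorem compProp_const (p : Prop) : A.CompProp fun _ _ => p := by
  by_cases hp : p
  · exact compProp_true.congr fun _ _ _ => by simp [hp]
  · exact compProp_true.not.congr fun _ _ _ => by simp [hp]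

theorem CompProp.imp (hP : A.CompProp P) (hQ : A.CompProp Q) :
    A.CompProp fun x i => P x i → Q x i :=
  (hP.and hQ.not).not.congr fun _ _ _ => by tauto

theorem CompProp.forall {ι : Type*} [Finite ι] {P : ι → X → ℕ → Prop}
    (hP : ∀ c, A.CompProp (P c)) : A.CompProp fun x i => ∀ c, P c x i := by
  classical
  have := Fintype.ofFinite ι
  have key : ∀ s : Finset ι, A.CompProp fun x i => ∀ c ∈ s, P c x i := by
    intro s
    induction s using Finset.induction_on with
    | empty => exact compProp_true.congr fun _ _ _ => by simp
    | insert c s hc ih => exact ((hP c).and ih).congr fun _ _ _ => by simp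
  exact (key Finset.univ).congr fun _ _ _ => by simp

theorem CompProp.exists_class {cls : X → ℕ → ℕ} (hcls : A.Comp cls) (hP : A.CompProp P) :
    A.CompProp fun x i => ∃ j < A.numRows x, cls x j = cls x i ∧ P x j := by
  classical
  have key : ∀ x j, (if P x j then 1 else 0) ≠ 0 ↔ P x j := by
    intro x j
    by_cases h : P x j <;> simp [h]
  refine (Comp.exists_class hcls hP).congr fun x i _ => ?_
  simp only [key]
  congr

theorem CompProp.forall_class {cls : X → ℕ → ℕ} (hcls : A.Comp cls) (hP : A.CompProp P) :
    A.CompProp fun x i => ∀ j < A.numRows x, cls x j = cls x i → P x j :=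
  (CompProp.exists_class hcls hP.not).not.congr fun _ _ _ => by push Not; rfl

/-- It can be tested in linear time whether a column is constant on the class of a row. -/
theorem Comp.constant_on_class {cls F : X → ℕ → ℕ} (hcls : A.Comp cls) (hF : A.Comp F) :
    A.CompProp fun x i => ∀ j < A.numRows x, cls x j = cls x i → F x j = F x i := by
  -- Pairing with the constant `0` merely turns `cls` into its first indices, which are then
  -- compared with the first indices of the classes refined by `F`.
  refine (CompProp.forall_class hcls
    ((hcls.pair (comp_const 0)).eq (hcls.pair hF))).congr fun x i hi => ?_
  simp only [Nat.add_right_cancel_iff]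
  have hpair : ∀ j, firstIdx (fun j => (cls x j, 0)) j = firstIdx (cls x) j := by
    intro j
    simp [firstIdx]
  simp only [hpair]
  -- The first row of the class of `j` is also the first row with the pair of values of `j` iff it
  -- has the `F`-value of `j`.
  have key : ∀ j, firstIdx (cls x) j = firstIdx (fun j => (cls x j, F x j)) j ↔
      F x j = F x (firstIdx (cls x) j) := by
    intro j
    constructor
    · intro h
      have := apply_firstIdx (f := fun j => (cls x j, F x j)) (i := j)
      rw [h]
      exact (congrArg Prod.snd this).symm
    · intro h
      refine le_antisymm (firstIdx_le ?_) (firstIdx_le ?_)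
      · exact congrArg Prod.fst (apply_firstIdx (f := fun j => (cls x j, F x j)) (i := j))
      · exact Prod.ext apply_firstIdx h.symm
  simp only [key]
  constructor
  · intro h j hj hji
    rw [h j hj hji, h i hi rfl, firstIdx_eq_iff.2 hji]
  · intro h j hj hji
    have hf : cls x (firstIdx (cls x) j) = cls x i := apply_firstIdx.trans hji
    rw [h j hj hji, h _ ((firstIdx_le rfl).trans_lt hj) hf]

/-- The answer to an existential question about the rows is put into register `0`. -/
theorem CompProp.decide (hP : A.CompProp P) : ∃ p C, ∀ x σ, A.Ready A.size x σ →
    Runs p σ (C * (A.numRows x + 1)) fun σ' =>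
      ((∃ i < A.numRows x, P x i) → σ'.reg 0 = 1) ∧
      ((¬ ∃ i < A.numRows x, P x i) → σ'.reg 0 = 0) := by
  classical
  obtain ⟨p, k, b', C, -, hk, h⟩ := hP A.size le_rfl
  refine ⟨.seq p (.seq (.const 0 0) (forLoop 2 1 (block [.load 5 k 2, .const 10 0,
    .ifEq 5 10 (.copy 0 0) (.const 0 1)]))), C + 8, fun x σ hσ => ?_⟩
  rw [add_mul]
  refine Runs.seq ((h x σ hσ).mono le_rfl ?_)
  rintro τ ⟨⟨hr1, -, -⟩, -, hcol⟩
  let Inv : ℕ → State → Prop := fun m υ => υ.reg 2 = m ∧ υ.reg 1 = A.numRows x ∧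
    υ.mem = τ.mem ∧ υ.reg 0 = if ∃ i < m, P x i then 1 else 0
  have hloop : Runs (forLoop 2 1 (block [.load 5 k 2, .const 10 0,
      .ifEq 5 10 (.copy 0 0) (.const 0 1)])) (τ.setReg 0 0) ((5 + 2) * A.numRows x + 2)
      (Inv (A.numRows x)) := by
    refine Runs.forLoop Inv ?_ (fun k τ h => ⟨h.1, h.2.1⟩) ?_
    · exact ⟨rfl, by simpa using hr1, rfl, by simp⟩
    · rintro m υ hm ⟨hr2, hr1, hmem, hr0⟩
      have hv : υ.mem k m = if P x m then 1 else 0 := by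
        rw [hmem]
        exact hcol m hm
      refine Runs.load' (v := if P x m then 1 else 0) (by rw [hr2, hv]) (Runs.const ?_)
      refine Runs.ifEq_copy_const (v := if P x m then 1 else υ.reg 0) ?_
        (Runs.block_nil (c := 0) ?_)
      · by_cases hp : P x m <;> simp [hp]
      · refine ⟨by simp [hr2], by simp, by simpa using hr1, by simpa using hmem, ?_⟩
        have hex : (∃ j < m + 1, P x j) ↔ (∃ j < m, P x j) ∨ P x m := by
          constructor
          · rintro ⟨j, hj, h⟩
            rcases Nat.lt_succ_iff_lt_or_eq.1 hj with hj | rfl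
            · exact .inl ⟨j, hj, h⟩
            · exact .inr h
          · rintro (⟨j, hj, h⟩ | h)
            · exact ⟨j, by omega, h⟩
            · exact ⟨m, by omega, h⟩
        rw [State.reg_setReg, if_neg (by norm_num), State.reg_setReg, if_pos rfl]
        simp only [hex, hr0]
        by_cases hp : P x m <;> simp [hp]
  have := Runs.seq (p := .const 0 0) (c := 1) ⟨1, _, Exec.const 0 0 τ, le_rfl, hloop⟩
  refine this.mono (by omega) ?_
  rintro υ ⟨-, -, -, hr0⟩
  constructor <;> intro hex <;> simp only [hr0, hex, if_true, if_false]

end Layout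

end RAM

namespace RAM

variable {S : Schema}

/-! ### All facts as the rows of one table -/

/-- The entries of a fact: the number of its table, then its attributes, then zeros. -/
def cell (f : DBFact S) : ℕ → ℕ
  | 0 => f.rel.val
  | p + 1 => if h : p < S.arity f.rel then f.val ⟨p, h⟩ else 0

/-- All facts of a presentation, table by table. -/
def Listing.rows (L : Listing S) : List (DBFact S) :=
  (List.finRange S.numRel).flatMap fun r => (L r).map (DBFact.mk r)

theorem Listing.mem_rows {L : Listing S} {f : DBFact S} : f ∈ L.rows ↔ f.val ∈ L f.rel := by
  simp only [Listing.rows, List.mem_flatMap, List.mem_finRange, List.mem_map, true_and]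
  constructor
  · rintro ⟨r, t, ht, rfl⟩
    exact ht
  · exact fun h => ⟨_, _, h, rfl⟩

theorem Listing.Presents.mem_rows {L : Listing S} {db : Database S} (h : L.Presents db)
    {f : DBFact S} : f ∈ L.rows ↔ f ∈ db := by
  rw [Listing.mem_rows, (h f.rel).2]

theorem Listing.Presents.length_rows {L : Listing S} {db : Database S} (h : L.Presents db) :
    L.rows.length ≤ db.card := by
  classical
  have hnd : L.rows.Nodup := by
    rw [Listing.rows, List.nodup_flatMap]
    refine ⟨fun r _ => (h r).1.map fun t t' ht => by simpa using ht, ?_⟩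
    refine (List.nodup_finRange S.numRel).imp fun {r r'} hne => ?_
    rw [Function.onFun, List.disjoint_left]
    intro f hf hf'
    simp only [List.mem_map] at hf hf'
    obtain ⟨t, -, rfl⟩ := hf
    obtain ⟨t', -, ht'⟩ := hf'
    exact hne (congrArg DBFact.rel ht').symm
  rw [← List.toFinset_card_of_nodup hnd]
  exact Finset.card_le_card fun f hf => h.mem_rows.1 (List.mem_toFinset.1 hf)

/-- The maximal arity of the tables. -/
def maxArity (S : Schema) : ℕ := Finset.univ.sup S.arity

theorem arity_le_maxArity (r : S.Rel) : S.arity r ≤ maxArity S :=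
  Finset.le_sup (f := S.arity) (Finset.mem_univ r)

/-- The table of all facts: behind the arrays of the input, there is one array for each position
of the facts. -/
def rowLayout (S : Schema) : Layout (Listing S) where
  numRows L := L.rows.length
  size := S.numRel + 1 + maxArity S
  column L c i := if c < S.numRel then L.input.mem c i else
    (L.rows[i]?).elim 0 fun f => cell f (c - S.numRel)

theorem getElem?_flatMap_ofFn {n : ℕ} (l : List (Fin n → ℕ)) (k p : ℕ) (hk : k < l.length)
    (hp : p < n) : (l.flatMap List.ofFn)[k * n + p]? = some (l[k] ⟨p, hp⟩) := by
  induction l generalizing k with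
  | nil => simp at hk
  | cons t l ih =>
    rw [List.flatMap_cons]
    cases k with
    | zero =>
      rw [List.getElem?_append_left (by simpa using hp)]
      simp [hp]
    | succ k =>
      rw [List.getElem?_append_right (by simp; nlinarith)]
      have h : (k + 1) * n + p - (List.ofFn t).length = k * n + p := by
        rw [List.length_ofFn, add_mul, one_mul]
        omega
      rw [h, ih k (by simpa using hk)]
      simp

theorem getElem?_append_singleton {α : Type*} (l : List α) (a : α) (j : ℕ) :
    (l ++ [a])[j]? = if j = l.length then some a else l[j]? := by
  split_ifs with h
  · subst h
    simp
  · rcases lt_or_gt_of_ne h with h | h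
    · exact List.getElem?_append_left h
    · rw [List.getElem?_eq_none (by simp; omega), List.getElem?_eq_none (by omega)]

/-- The facts `rs` have been loaded, and the input is still in place. -/
def Loaded (L : Listing S) (rs : List (DBFact S)) (σ : State) : Prop :=
  σ.reg S.numRel = rs.length ∧
    (∀ c < S.numRel, σ.reg c = L.input.reg c ∧ σ.mem c = L.input.mem c) ∧
    ∀ c, S.numRel ≤ c → ∀ j, σ.mem c j = (rs[j]?).elim 0 fun f => cell f (c - S.numRel)

/-- Loads the first `n` attributes of a fact of table `r`. -/
def loadCells (m r : ℕ) : ℕ → Prog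
  | 0 => skip
  | n + 1 => .seq (loadCells m r n) (block [.load (m + 3) r (m + 2),
      .store (m + 1 + n) m (m + 3), .succ (m + 2) (m + 2)])

/-- Register `m` holds the index of the new row, `m + 2` a cursor into the input array, `m + 3` is
scratch. Attribute `p` goes to array `m + 1 + p`, since array `m` is reserved for table numbers. -/
theorem runs_loadCells {m r : ℕ} (hr : r < m) (n : ℕ) (σ : State) :
    Runs (loadCells m r n) σ (4 * n + 1) fun τ => (∀ c, c ≠ m + 2 → c ≠ m + 3 →
      τ.reg c = σ.reg c) ∧ τ.reg (m + 2) = σ.reg (m + 2) + n ∧ ∀ c, τ.mem c =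
        if m + 1 ≤ c ∧ c < m + 1 + n then Function.update (σ.mem c) (σ.reg m)
          (σ.mem r (σ.reg (m + 2) + (c - (m + 1)))) else σ.mem c := by
  induction n with
  | zero =>
    refine (Runs.skip ?_).mono (by omega) fun _ => id
    refine ⟨fun _ _ _ => rfl, rfl, fun c => ?_⟩
    rw [if_neg (by omega)]
  | succ n ih =>
    refine (Runs.seq (c' := 4) (ih.mono le_rfl ?_)).mono (by omega) fun _ => id
    rintro τ ⟨h1, h2, h3⟩
    have hm : τ.mem r = σ.mem r := by rw [h3, if_neg (by omega)]
    refine Runs.load' (v := σ.mem r (σ.reg (m + 2) + n)) (by rw [h2, hm]) ?_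
    refine Runs.store' (i := σ.reg m) (v := σ.mem r (σ.reg (m + 2) + n)) ?_ (by simp) ?_
    · simp only [State.reg_setReg]
      rw [if_neg (by omega), h1 _ (by omega) (by omega)]
    refine Runs.succ (Runs.block_nil (c := 0) ?_)
    refine ⟨fun c hc hc' => ?_, ?_, fun c => ?_⟩
    · simp only [State.reg_setReg, State.reg_setMem, if_neg hc, if_neg hc', h1 c hc hc']
    · simp only [State.reg_setReg, State.reg_setMem]
      rw [if_pos trivial, if_neg (by omega), h2]
      omega
    · simp only [State.mem_setReg, State.mem_setMem]
      by_cases hc : c = m + 1 + n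
      · subst hc
        rw [if_pos rfl, if_pos (by omega), h3, if_neg (by omega)]
        congr 3
        omega
      · rw [if_neg hc, h3]
        congr 1
        exact propext (by omega)

/-- Loads the facts of table `r`. -/
def loadTable (m r n : ℕ) : Prog :=
  .seq (.const (m + 2) 0) (forLoop (m + 1) r (.seq (loadCells m r n)
    (block [.const (m + 3) r, .store m m (m + 3), .succ m m])))

/-- The rows of a table are contiguous in the input, so the cursor runs through them without a reset
and stands at `k * S.arity r` before row `k`. Nothing is stored beyond the arity: those cells are
still zero, as `cell` prescribes. -/
theorem runs_loadTable {L : Listing S} {rs : List (DBFact S)} {σ : State} (hσ : Loaded L rs σ)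
    (r : S.Rel) : Runs (loadTable S.numRel r (S.arity r)) σ
      ((4 * maxArity S + 8) * ((L r).length + 1))
      (Loaded L (rs ++ (L r).map (DBFact.mk r))) := by
  obtain ⟨hN, hin, hcell⟩ := hσ
  set m := S.numRel with hm
  have hrm : r.val < m := r.2
  have hrr : L.input.reg r = (L r).length := by simp [Listing.input]
  let Inv : ℕ → State → Prop := fun k τ => τ.reg (m + 1) = k ∧
    τ.reg (m + 2) = k * S.arity r ∧ Loaded L (rs ++ ((L r).take k).map (DBFact.mk r)) τ
  have hloop : Runs (forLoop (m + 1) r (.seq (loadCells m r (S.arity r))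
    (block [.const (m + 3) r, .store m m (m + 3), .succ m m]))) (σ.setReg (m + 2) 0)
    ((4 * S.arity r + 1 + 4 + 2) * (L r).length + 2) (Inv (L r).length) := by
    refine Runs.forLoop Inv ?_ (fun k τ h => ⟨h.1, ?_⟩) ?_
    · refine ⟨by simp, by simp, ?_⟩
      simp only [List.take_zero, List.map_nil, List.append_nil]
      refine ⟨?_, fun c hc => ?_, by simpa using hcell⟩
      · simp only [State.reg_setReg]
        rw [if_neg (by omega), if_neg (by omega), hN]
      · simp only [State.reg_setReg, State.mem_setReg]
        rw [if_neg (by omega), if_neg (by omega)]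
        exact hin c hc
    · rw [(h.2.2.2.1 r hrm).1, hrr]
    · rintro k τ hk ⟨hr1, hr2, hlN, hlin, hlcell⟩
      set rs' := rs ++ ((L r).take k).map (DBFact.mk r) with hrs'
      set t := (L r)[k] with ht
      refine Runs.seq (c := 4 * S.arity r + 1) (c' := 4)
        ((runs_loadCells hrm _ _).mono le_rfl ?_)
      rintro υ ⟨hu1, hu2, hu3⟩
      have hur : υ.reg m = rs'.length := by rw [hu1 _ (by omega) (by omega), hlN]
      refine Runs.const (Runs.store' (i := rs'.length) (v := r) ?_ (by simp) ?_)
      · simp only [State.reg_setReg]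
        rw [if_neg (by omega), hur]
      refine Runs.succ (Runs.block_nil (c := 0) ?_)
      refine ⟨?_, by simp, ?_, ?_, ?_, ?_⟩
      · simp only [State.reg_setReg, State.reg_setMem]
        rw [if_neg (by omega), if_neg (by omega), hu1 _ (by omega) (by omega), hr1]
      · simp only [State.reg_setReg, State.reg_setMem]
        rw [if_neg (by omega), if_neg (by omega), if_neg (by omega), hu2, hr2]
        ring
      · simp only [State.reg_setReg, State.reg_setMem]
        rw [if_neg (by omega), if_pos hm.symm, if_neg (by omega), hur]
        simp [hrs', min_eq_left hk.le, min_eq_left (Nat.succ_le_of_lt hk), add_assoc]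
      · intro c hc
        simp only [State.reg_setReg, State.reg_setMem, State.mem_setReg, State.mem_setMem]
        rw [if_neg (by omega), if_neg (by omega), if_neg (by omega), if_neg (by omega),
          hu1 _ (by omega) (by omega), hu3, if_neg (by omega)]
        exact hlin c hc
      · intro c hc j
        have hrows : rs ++ ((L r).take (k + 1)).map (DBFact.mk r) =
            rs' ++ [DBFact.mk r t] := by
          rw [List.take_succ_eq_append_getElem hk, List.map_append, ← List.append_assoc]
          rfl
        rw [hrows, getElem?_append_singleton]
        have hold := hlcell c hc j
        simp only [State.mem_setReg, State.mem_setMem]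
        by_cases hcm : c = m
        · subst hcm
          rw [if_pos rfl, hu3, if_neg (by omega), Function.update_apply]
          split_ifs
          · simp [cell, hm]
          · exact hold
        · rw [if_neg hcm, hu3]
          obtain ⟨p, rfl⟩ : ∃ p, c = m + 1 + p := ⟨c - (m + 1), by omega⟩
          have hp : m + 1 + p - S.numRel = p + 1 := by omega
          have hp' : m + 1 + p - (m + 1) = p := by omega
          rw [hp] at hold ⊢
          rw [hp']
          by_cases hpa : p < S.arity r
          · rw [if_pos (by omega), Function.update_apply, hlN]
            by_cases hj : j = rs'.length
            · rw [if_pos hj, if_pos hj, (hlin r hrm).2, hr2]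
              have := getElem?_flatMap_ofFn (L r) k p hk hpa
              simp [Listing.input, this, cell, hpa, ht]
            · rw [if_neg hj, if_neg hj, hold]
          · rw [if_neg (by omega), hold]
            split_ifs with hj
            · rw [hj]
              simp [cell, hpa]
            · rfl
  have := Runs.seq (p := .const (m + 2) 0) (c := 1) ⟨1, _, Exec.const (m + 2) 0 σ, le_rfl, hloop⟩
  refine this.mono ?_ ?_
  · have h1 := Nat.mul_le_mul_right (L r).length (Nat.mul_le_mul_left 4 (arity_le_maxArity r))
    have e1 : (4 * S.arity r + 1 + 4 + 2) * (L r).length =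
        4 * S.arity r * (L r).length + 7 * (L r).length := by ring
    have e2 : (4 * maxArity S + 8) * ((L r).length + 1) =
        4 * maxArity S * (L r).length + 8 * (L r).length + 4 * maxArity S + 8 := by ring
    omega
  · rintro τ ⟨-, -, h⟩
    rwa [List.take_length] at h

/-- Loads the facts of a list of tables. -/
def loadTables : List S.Rel → Prog
  | [] => skip
  | r :: l => .seq (loadTable S.numRel r (S.arity r)) (loadTables l)

theorem runs_loadTables {L : Listing S} (l : List S.Rel) {rs : List (DBFact S)} {σ : State}
    (hσ : Loaded L rs σ) : Runs (loadTables l) σ ((4 * maxArity S + 8) *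
      ((l.flatMap fun r => (L r).map (DBFact.mk r)).length + l.length) + 1)
      (Loaded L (rs ++ l.flatMap fun r => (L r).map (DBFact.mk r))) := by
  induction l generalizing rs σ with
  | nil => exact (Runs.skip (by simpa using hσ)).mono (by omega) fun _ => id
  | cons r l ih =>
    refine (Runs.seq ((runs_loadTable hσ r).mono le_rfl fun τ hτ => ih hτ)).mono ?_ fun τ hτ => ?_
    · rw [List.flatMap_cons, List.length_append, List.length_map, List.length_cons]
      apply le_of_eq
      ring
    · rwa [List.flatMap_cons, ← List.append_assoc]

/-- Rows are counted in register `S.numRel`, behind the input registers; register `1` may hold the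
size of an input table and is overwritten only after loading. Arrays beyond the maximal arity
contain zeros, as `Ready` demands. -/
theorem exists_load (S : Schema) : ∃ p C, ∀ L : Listing S,
    Runs p L.input (C * (L.rows.length + 1)) ((rowLayout S).Ready (rowLayout S).size L) := by
  set K := 4 * maxArity S + 8 with hK
  refine ⟨.seq (.const S.numRel 0) (.seq (loadTables (List.finRange S.numRel))
    (.copy 1 S.numRel)), K * (S.numRel + 1) + 3, fun L => ?_⟩
  have hload : Loaded L [] (L.input.setReg S.numRel 0) := by
    refine ⟨by simp, fun c hc => ⟨?_, rfl⟩, fun c hc j => ?_⟩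
    · simp [hc.ne]
    · simp [Listing.input, not_lt.2 hc]
  have h1 := (runs_loadTables (List.finRange S.numRel) hload).mono le_rfl
    (Q' := fun τ => Runs (.copy 1 S.numRel) τ 1 ((rowLayout S).Ready (rowLayout S).size L)) ?_
  · refine (Runs.seq (c := 1) ⟨1, _, Exec.const _ _ _, le_rfl, Runs.seq h1⟩).mono ?_
      fun _ => id
    rw [List.length_finRange]
    change 1 + (K * (L.rows.length + S.numRel) + 1 + 1) ≤ _
    nlinarith [Nat.zero_le (K * S.numRel * L.rows.length), Nat.zero_le (L.rows.length)]
  · rintro τ ⟨hN, hin, hcell⟩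
    rw [List.nil_append] at hN hcell
    refine ⟨1, _, .copy .., le_rfl, ?_, ?_, ?_⟩
    · rw [State.reg_setReg, if_pos rfl]
      exact hN
    · intro c _
      funext i
      simp only [State.mem_setReg, rowLayout]
      split_ifs with hc
      · rw [(hin c hc).2]
      · exact hcell c (by omega) i
    · intro c hc i
      simp only [rowLayout] at hc
      obtain ⟨p, rfl⟩ : ∃ p, c = S.numRel + (p + 1) := ⟨c - (S.numRel + 1), by omega⟩
      rw [State.mem_setReg, hcell _ (by omega), Nat.add_sub_cancel_left]
      cases (List.flatMap (fun r => (L r).map (DBFact.mk r)) (List.finRange S.numRel))[i]? with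
      | none => rfl
      | some f =>
        have := arity_le_maxArity f.rel
        simp only [Option.elim_some, cell]
        rw [dif_neg (by omega)]

end RAM

/-! ### Certain answers in linear time -/

namespace RAM

open BCQ Layout

variable {S : Schema}

/-- The entries at position `p` of all facts. -/
def entry (p : ℕ) (L : Listing S) (i : ℕ) : ℕ := (L.rows[i]?).elim 0 fun f => cell f p

theorem comp_entry (p : ℕ) : (rowLayout S).Comp (entry p) := by
  by_cases hp : S.numRel + p < S.numRel + 1 + maxArity S
  · refine (comp_column (A := rowLayout S) hp).congr fun L i _ => ?_
    simp only [rowLayout, entry]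
    rw [if_neg (by omega), Nat.add_sub_cancel_left]
  · refine (comp_const 0).congr fun L i _ => ?_
    obtain ⟨n, rfl⟩ : ∃ n, p = n + 1 := ⟨p - 1, by omega⟩
    unfold entry
    cases L.rows[i]? with
    | none => rfl
    | some f =>
      have := arity_le_maxArity f.rel
      simp only [Option.elim_some, cell]
      rw [dif_neg (by omega)]

theorem entry_zero {L : Listing S} {i : ℕ} {f : DBFact S} (h : L.rows[i]? = some f) :
    entry 0 L i = f.rel := by simp [entry, h, cell]

theorem entry_succ {L : Listing S} {i : ℕ} {r : S.Rel} {t : Fin (S.arity r) → ℕ}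
    (h : L.rows[i]? = some ⟨r, t⟩) (p : Fin (S.arity r)) : entry (p + 1) L i = t p := by
  simp [entry, h, cell]

theorem exists_row {L : Listing S} {i : ℕ} (hi : i < L.rows.length) :
    ∃ f, L.rows[i]? = some f ∧ f ∈ L.rows :=
  ⟨L.rows[i], List.getElem?_eq_getElem hi, List.getElem_mem hi⟩

theorem row_lt {L : Listing S} {i : ℕ} {f : DBFact S} (h : L.rows[i]? = some f) :
    i < L.rows.length := by
  by_contra hi
  rw [List.getElem?_eq_none (by omega)] at h
  simp at h

open Classical in
/-- A position of the variable `v` in the atom `a`. -/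
noncomputable def varPos (a : Atom S) (v : ℕ) : ℕ :=
  if h : ∃ i, a.args i = .var v then h.choose.val + 1 else 0

theorem entry_varPos {a : Atom S} {v : ℕ} (hv : v ∈ a.vars) {L : Listing S} {i : ℕ} {ν : ℕ → ℕ}
    (h : L.rows[i]? = some (a.inst ν)) : entry (varPos a v) L i = ν v := by
  have hex := Atom.mem_vars.1 hv
  rw [varPos, dif_pos hex, entry_succ h, hex.choose_spec]
  rfl

/-- The value that a fact matching the atom must have at a position. -/
noncomputable def expected (a : Atom S) (i : Fin (S.arity a.rel)) (L : Listing S) (j : ℕ) : ℕ :=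
  match a.args i with
  | .const c => c
  | .var v => entry (varPos a v) L j

theorem comp_expected (a : Atom S) (i : Fin (S.arity a.rel)) :
    (rowLayout S).Comp (expected a i) := by
  unfold expected
  cases a.args i with
  | const c => exact comp_const c
  | var v => exact comp_entry _

/-- The row `j` is a fact that matches the atom. -/
def Matches (a : Atom S) (L : Listing S) (j : ℕ) : Prop :=
  entry 0 L j = a.rel ∧ ∀ i : Fin (S.arity a.rel), entry (i + 1) L j = expected a i L j

theorem compProp_matches (a : Atom S) : (rowLayout S).CompProp (Matches a) :=
  ((comp_entry 0).eq (comp_const _)).and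
    (CompProp.forall fun i => (comp_entry _).eq (comp_expected a i))

/-- It suffices to compare every occurrence of a variable with one chosen occurrence. -/
theorem matches_iff {a : Atom S} {L : Listing S} {j : ℕ} (hj : j < L.rows.length) :
    Matches a L j ↔ ∃ ν, L.rows[j]? = some (a.inst ν) := by
  obtain ⟨⟨r, t⟩, hf, -⟩ := exists_row hj
  constructor
  · rintro ⟨h0, h⟩
    rw [entry_zero hf] at h0
    obtain rfl : r = a.rel := Fin.ext h0
    have hm : ∃ ν, (⟨a.rel, t⟩ : DBFact S) = a.inst ν := by
      rw [Atom.exists_inst_iff]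
      have hvar : ∀ i v, a.args i = .var v → t i = entry (varPos a v) L j := by
        intro i v hi
        rw [← entry_succ hf, h i, expected, hi]
      refine ⟨fun i c hc => ?_, fun i k v hi hk => by rw [hvar i v hi, hvar k v hk]⟩
      rw [← entry_succ hf, h i, expected, hc]
    obtain ⟨ν, hν⟩ := hm
    exact ⟨ν, by rw [hf, hν]⟩
  · rintro ⟨ν, hν⟩
    refine ⟨by rw [entry_zero hν]; rfl, fun i => ?_⟩
    rw [entry_succ hν, expected]
    cases h : a.args i with
    | const c => rfl
    | var v => exact (entry_varPos (Atom.mem_vars.2 ⟨i, h⟩) hν).symm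

/-- A column that identifies the blocks of a table. -/
theorem exists_comp_block (r : S.Rel) : ∃ blk, (rowLayout S).Comp blk ∧
    ∀ (L : Listing S) i j f g, L.rows[i]? = some f → L.rows[j]? = some g → f.rel = r →
      (blk L i = blk L j ↔ f.KeyEq g) := by
  -- Column `0` is the table number and the next `S.keyLen r` columns are the key.
  obtain ⟨blk, hblk, h⟩ := exists_comp_class (A := rowLayout S) (Finset.range (S.keyLen r + 1))
    (F := entry) fun c _ => comp_entry c
  refine ⟨blk, hblk, ?_⟩
  rintro L i j ⟨r', t⟩ ⟨r'', t'⟩ hf hg rfl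
  rw [h]
  constructor
  · intro hc
    have h0 := hc 0 (by simp)
    rw [entry_zero hf, entry_zero hg] at h0
    obtain rfl : r' = r'' := Fin.ext h0
    refine ⟨rfl, (DBFact.key_eq_iff _ _ _).2 fun p hp => ?_⟩
    have := hc (p + 1) (by simpa using hp)
    rwa [entry_succ hf, entry_succ hg] at this
  · rintro ⟨hrel, hkey⟩ c hc
    obtain rfl : r' = r'' := hrel
    cases c with
    | zero => rw [entry_zero hf, entry_zero hg]
    | succ p =>
      have hp : p < S.keyLen r' := by simpa using hc
      have hpa := hp.trans_le (S.keyLen_le r')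
      have := (DBFact.key_eq_iff _ _ _).1 hkey ⟨p, hpa⟩ hp
      rw [← entry_succ hf, ← entry_succ hg] at this
      exact this

open Classical in
/-- The database given by a presentation. -/
noncomputable def Listing.db (L : Listing S) : Database S := L.rows.toFinset

theorem Listing.mem_db {L : Listing S} {f : DBFact S} :
    f ∈ L.db ↔ ∃ i < L.rows.length, L.rows[i]? = some f := by
  simp only [Listing.db, List.mem_toFinset, List.mem_iff_getElem?]
  exact ⟨fun ⟨i, hi⟩ => ⟨i, row_lt hi, hi⟩, fun ⟨i, _, hi⟩ => ⟨i, hi⟩⟩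

variable {q : BCQ S} {τ : SimpleGraph q} {R : q}

/-- The row `i` belongs to a block that makes the subquery rooted at `a` certain. -/
def GoodRow (τ : SimpleGraph q) (R a : q) (L : Listing S) (i : ℕ) : Prop :=
  ∃ μ, L.rows[i]? = some (a.1.inst μ) ∧ GoodBlock τ R a L.db μ (a.1.inst μ)

/-- All facts of a good block have the same interface values, so these can be read off any of its
rows. `GoodRow` is therefore independent of `θ` and is computed once for all facts of the parent. -/
theorem certainBelow_iff_goodRow (hq : q.SelfJoinFree) (hτ : q.IsPPJT τ R) {a : q}
    {L : Listing S} {θ : ℕ → ℕ} :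
    CertainBelow τ R a L.db θ ↔ ∃ i < L.rows.length, GoodRow τ R a L i ∧
      ∀ v ∈ iface τ R a, entry (varPos a.1 v) L i = θ v := by
  rw [certainBelow_iff hq hτ]
  constructor
  · rintro ⟨f, hf, -, hgood⟩
    obtain ⟨μ, rfl, hμ, -⟩ := hgood f hf (.refl f)
    obtain ⟨i, hi, hif⟩ := Listing.mem_db.1 hf
    refine ⟨i, hi, ⟨μ, hif, fun g hg hfg => ?_⟩, fun v hv => ?_⟩
    · obtain ⟨ν, h1, h2, h3⟩ := hgood g hg hfg
      exact ⟨ν, h1, fun v hv => (h2 v hv).trans (hμ v hv).symm, h3⟩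
    · rw [entry_varPos hv.1 hif, hμ v hv]
  · rintro ⟨i, hi, ⟨μ, hif, hgood⟩, hθ⟩
    refine ⟨_, Listing.mem_db.2 ⟨i, hi, hif⟩, rfl, fun g hg hfg => ?_⟩
    obtain ⟨ν, h1, h2, h3⟩ := hgood g hg hfg
    refine ⟨ν, h1, fun v hv => ?_, h3⟩
    rw [h2 v hv, ← hθ v hv, entry_varPos hv.1 hif]

/-- The join with a child is computable in linear time. -/
theorem exists_compProp_child (hq : q.SelfJoinFree) (hτ : q.IsPPJT τ R) {a b : q}
    (hab : IsParent τ R a b) (hb : (rowLayout S).CompProp (GoodRow τ R b)) :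
    ∃ E, (rowLayout S).CompProp E ∧ ∀ (L : Listing S) j ν, L.rows[j]? = some (a.1.inst ν) →
      (E L j ↔ CertainBelow τ R b L.db ν) := by
  classical
  have hne : (a.1.rel : ℕ) ≠ b.1.rel := fun h => hab.ne (hq.eq (Fin.ext h))
  -- A common variable may sit at different positions in the two tables. This column reads it from
  -- either, so one class column relates rows of `a` to rows of `b`.
  let F : ℕ → Listing S → ℕ → ℕ := fun v L i =>
    if entry 0 L i = (b.1.rel : ℕ) then entry (varPos b.1 v) L i else entry (varPos a.1 v) L i
  obtain ⟨cls, hcls, hclass⟩ := exists_comp_class (A := rowLayout S) (a.1.vars ∩ b.1.vars)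
    (F := F) fun v _ => (comp_entry 0).ite_eq (comp_const _) (comp_entry _) (comp_entry _)
  refine ⟨_, CompProp.exists_class hcls hb, fun L j ν hj => ?_⟩
  rw [certainBelow_iff_goodRow hq hτ]
  refine exists_congr fun k => and_congr_right fun _ => ?_
  rw [and_comm]
  refine and_congr_right ?_
  rintro ⟨μ, hk, -⟩
  rw [hclass]
  have hFk : ∀ v, F v L k = entry (varPos b.1 v) L k := fun v =>
    if_pos (by rw [entry_zero hk]; rfl)
  have hFj : ∀ v, F v L j = entry (varPos a.1 v) L j := fun v =>
    if_neg (by rw [entry_zero hj]; exact hne)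
  constructor
  · intro h v hv
    have hv' := (mem_iface_iff hτ.1.1 hab).1 hv
    have := h v (Finset.mem_inter.2 ⟨hv'.2, hv'.1⟩)
    rw [hFk, hFj, entry_varPos hv'.2 hj] at this
    exact this
  · intro h v hv
    have hv' := Finset.mem_inter.1 hv
    rw [hFk, hFj, entry_varPos hv'.1 hj]
    exact h v ((mem_iface_iff hτ.1.1 hab).2 hv'.symm)

/-- By induction from the leaves, each condition of `GoodBlock` becomes a test on the class of a row
under the block column: all rows match and pass the child tests, and the interface variables are
constant. -/
theorem compProp_goodRow (hq : q.SelfJoinFree) (hτ : q.IsPPJT τ R) (a : q) :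
    (rowLayout S).CompProp (GoodRow τ R a) := by
  have hT := hτ.1.1
  induction a using subtree_induction (R := R) hT with
  | h a ih =>
  have hch : ∀ b : q, ∃ E, (rowLayout S).CompProp E ∧ (IsParent τ R a b →
      ∀ (L : Listing S) j ν, L.rows[j]? = some (a.1.inst ν) →
        (E L j ↔ CertainBelow τ R b L.db ν)) := by
    intro b
    by_cases hab : IsParent τ R a b
    · obtain ⟨E, hE, h⟩ := exists_compProp_child hq hτ hab (ih b hab)
      exact ⟨E, hE, fun _ => h⟩
    -- A dummy test for atoms that are not children, so that `E` is indexed by all atoms.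
    · exact ⟨_, compProp_true, fun h => absurd h hab⟩
  choose E hE hEb using hch
  obtain ⟨blk, hblk, hblock⟩ := exists_comp_block (S := S) a.1.rel
  have h1 := CompProp.forall_class hblk ((compProp_matches a.1).and
    (CompProp.forall fun b => (compProp_const (IsParent τ R a b)).imp (hE b)))
  have h2 := CompProp.forall fun v : a.1.vars => (compProp_const (v.1 ∈ iface τ R a)).imp
    (hblk.constant_on_class (comp_entry (S := S) (varPos a.1 v)))
  refine (((comp_entry 0).eq (comp_const (a.1.rel : ℕ))).and (h1.and h2)).congr
    fun L i hi => ?_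
  constructor
  · rintro ⟨h0, h1, h2⟩
    obtain ⟨μ, hμ⟩ := (matches_iff hi).1 (h1 i hi rfl).1
    refine ⟨μ, hμ, fun g hg hfg => ?_⟩
    obtain ⟨j, hj, hjg⟩ := Listing.mem_db.1 hg
    have hij : blk L j = blk L i := ((hblock L i j _ _ hμ hjg rfl).2 hfg).symm
    obtain ⟨hm, hc⟩ := h1 j hj hij
    obtain ⟨ν, hν⟩ := (matches_iff hj).1 hm
    refine ⟨ν, by rw [hjg] at hν; exact Option.some.inj hν, fun v hv => ?_, fun b hb => ?_⟩
    · rw [← entry_varPos hv.1 hν, ← entry_varPos hv.1 hμ]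
      exact h2 ⟨v, hv.1⟩ hv j hj hij
    · exact (hEb b hb L j ν hν).1 (hc b hb)
  · rintro ⟨μ, hμ, hgood⟩
    have key : ∀ j < L.rows.length, blk L j = blk L i → ∃ ν, L.rows[j]? = some (a.1.inst ν) ∧
        (∀ v ∈ iface τ R a, ν v = μ v) ∧
        ∀ b, IsParent τ R a b → CertainBelow τ R b L.db ν := by
      intro j hj hji
      obtain ⟨g, hg, -⟩ := exists_row hj
      obtain ⟨ν, rfl, hν⟩ := hgood g (Listing.mem_db.2 ⟨j, hj, hg⟩)
        ((hblock L i j _ _ hμ hg rfl).1 hji.symm)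
      exact ⟨ν, hg, hν⟩
    refine ⟨by rw [entry_zero hμ]; rfl, fun j hj hji => ?_, fun v hv j hj hji => ?_⟩
    · obtain ⟨ν, hν, -, hc⟩ := key j hj hji
      exact ⟨(matches_iff hj).2 ⟨ν, hν⟩, fun b hb => (hEb b hb L j ν hν).2 (hc b hb)⟩
    · obtain ⟨ν, hν, hνμ, -⟩ := key j hj hji
      rw [entry_varPos v.2 hν, entry_varPos v.2 hμ, hνμ v hv]

theorem decidableInLinearTime_certain (hq : q.SelfJoinFree) (hτ : q.IsPPJT τ R) :
    DecidableInLinearTime q.Certain := by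
  obtain ⟨p, C, hp⟩ := exists_load S
  obtain ⟨p', C', hp'⟩ := (compProp_goodRow hq hτ R).decide
  refine ⟨.seq p p', C + C', fun db L hL => ?_⟩
  have hdb : L.db = db := by
    classical
    ext f
    rw [Listing.db, List.mem_toFinset, hL.mem_rows]
  have hcert : q.Certain db ↔ ∃ i < L.rows.length, GoodRow τ R R L i := by
    rw [← hdb, ← certainBelow_root hτ.1.1 (θ := fun _ => 0), certainBelow_iff_goodRow hq hτ]
    refine exists_congr fun i => and_congr_right fun _ => and_iff_left ?_
    rintro v ⟨-, T, h, -⟩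
    exact absurd h (not_isParent_root hτ.1.1)
  obtain ⟨t, σ, he, ht, hq'⟩ := Runs.seq ((hp L).mono le_rfl fun σ hσ => hp' L σ hσ)
  refine ⟨t, σ, he, ?_, fun h => hq'.1 (hcert.1 h), fun h => hq'.2 fun h' => h (hcert.2 h')⟩
  refine ht.trans ?_
  change C * (L.rows.length + 1) + C' * (L.rows.length + 1) ≤ _
  rw [← add_mul]
  exact Nat.mul_le_mul_left _ (Nat.add_le_add_right hL.length_rows 1)

end RAM

theorem mainTheorem1 (S : Schema) (q : BCQ S) (hq : q.SelfJoinFree)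
    (τ : SimpleGraph q) (R : q) (hτ : q.IsPPJT τ R) :
    Datalog.IsNonRecursiveProgram (Datalog.rewriting τ R) ∧
    (∀ rank, Datalog.Stratifies (Datalog.rewriting τ R) rank → ∀ db : Database S,
      (Datalog.goal R ∈ Datalog.result (Datalog.rewriting τ R) rank db ↔ q.Certain db)) ∧
    RAM.DecidableInLinearTime q.Certain :=
  ⟨Datalog.isNonRecursiveProgram_rewriting hq hτ.1.1,
    fun _ hP _ => Datalog.goal_mem_result_iff hq hτ hP,
    RAM.decidableInLinearTime_certain hq hτ⟩
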